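/- Let $N\ge 0$ be an integer, $m>0$, $\Omega>0$ and $V_1,\dots,V_N\ge 0$ real numbers. Let $\phi_1,\dots,\phi_N,\phi_d,V_d$ be mutually independent real random variables, where $\phi_1,\dots,\phi_N,\phi_d$ are uniform on $[0,2\pi]$ and $V_d$ has the Nakagami density $\frac{2}{\Gamma(m)}\left(\frac m\Omega\right)^m x^{2m-1}e^{-mx^2/\Omega}$ on $(0,\infty)$ (the Multiple-Waves with Generalized Diffuse Scatter model). Let $$R=\Big|\sum_{i=1}^N V_i e^{j\phi_i}+V_d e^{j\phi_d}\Big|$$ be the envelope and put $$\Phi(\nu)={}_1F_1\!\left(m;1;-\tfrac{\Omega}{4m}\nu^2\right)\prod_{i=1}^N J_0(V_i\nu),$$ where $J_n$ is the Bessel function of the first kind. All integrals below are improper, $\int_0^\infty=\lim_{T\to\infty}\int_0^T$, and their convergence is part of the claim. Write $$\Psi_2(a;b_1,\dots,b_n;x_1,\dots,x_n)=\sum_{k_1,\dots,k_n\ge 0}\frac{(a)_{k_1+\dots+k_n}}{(b_1)_{k_1}\cdots(b_n)_{k_n}\,k_1!\cdots k_n!}\,x_1^{k_1}\cdots x_n^{k_n},$$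 $[x]_n$ for the sequence $x,\dots,x$ of length $n$, and $$\underline\alpha(x)=\left(-\tfrac{V_1^2m}{\Omega},\dots,-\tfrac{V_N^2m}{\Omega},-\tfrac{x^2m}{\Omega}\right).$$ (PDF) The law of $R$ has a probability density $f_R$ with respect to Lebesgue measure, which vanishes on $(-\infty,0)$ and can be chosen such that: 1. if $m>\frac14$ or some $V_i$ is positive, then $$f_R(r)=r\int_0^\infty \Phi(\nu)\,\nu J_0(r\nu)\,d\nu$$ for every $r>0$ that is not one of the finitely many numbers $|\pm V_1\pm\dots\pm V_N|$, and for every $r>0$ without exception if $2m+\frac{N'}2>\frac32$, where $N'$ is the number of positive $V_i$; 2. if $m$ is a positive integer, then for every $r\ge 0$ this integral formula holds, the $\Psi_2$ series below converge absolutely, and $$f_R(r)=\frac{2m}{\Omega}\,r\sum_{k=0}^{m-1}\binom{m-1}{k}(-1)^k\,\Psi_2\big(k+1;[1]_{N+1};\underline\alpha(r)\big).$$ (CDF) For every $t\ge 0$ the distribution function $F_R(t)=\mathbb P(R\le t)$ satisfies $$F_R(t)=t\int_0^\infty \Phi(\nu)\,J_1(t\nu)\,d\nu,$$ and, if $m$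 is a positive integer, the $\Psi_2$ series below converge absolutely and $$F_R(t)=\frac m\Omega\,t^2\sum_{k=0}^{m-1}\binom{m-1}{k}(-1)^k\,\Psi_2\big(k+1;[1]_N,2;\underline\alpha(t)\big).$$ -/

import Mathlib

open MeasureTheory ProbabilityTheory Filter Topology

noncomputable section

/-- The Bessel function of the first kind of integer order `n ≥ 0`,
`J_n(x) = ∑ₖ (-1)^k / (k! (k+n)!) (x/2)^(2k+n)`. -/
def besselJ (n : ℕ) (x : ℝ) : ℝ :=
  ∑' k : ℕ, (-1) ^ k / ((k.factorial : ℝ) * ((k + n).factorial : ℝ)) * (x / 2) ^ (2 * k + n)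

/-- The Pochhammer symbol `(a)_n = a (a+1) ⋯ (a+n-1)`. -/
def pochhammer (a : ℝ) (n : ℕ) : ℝ := (ascPochhammer ℝ n).eval a

/-- Kummer's confluent hypergeometric function `₁F₁(a; b; x) = ∑ₖ (a)_k / (b)_k * x^k / k!`
(for `b` not a nonpositive integer). -/
def hyp1F1 (a b x : ℝ) : ℝ :=
  ∑' k : ℕ, pochhammer a k / pochhammer b k * (x ^ k / (k.factorial : ℝ))

/-- The term of multi-index `k` of the confluent hypergeometric series `Ψ₂` in `n` variables. -/
def psi2Term {n : ℕ} (a : ℝ) (b x : Fin n → ℝ) (k : Fin n → ℕ) : ℝ :=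
  pochhammer a (∑ i, k i) / (∏ i, pochhammer (b i) (k i) * ((k i).factorial : ℝ)) *
    ∏ i, x i ^ k i

/-- The confluent hypergeometric series
`Ψ₂(a; b₁, …, bₙ; x₁, …, xₙ) = ∑ (a)_{k₁+⋯+kₙ} / (∏ (b_i)_{k_i} k_i!) ∏ x_i^{k_i}`. -/
def psi2 {n : ℕ} (a : ℝ) (b x : Fin n → ℝ) : ℝ :=
  ∑' k : Fin n → ℕ, psi2Term a b x k

/-- The improper integral `∫₀^∞ g` converges to `L`: `g` is integrable on every `[0, T]` and
`∫₀^T g → L` as `T → ∞`. -/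
def HasImproperIntegral (g : ℝ → ℝ) (L : ℝ) : Prop :=
  (∀ T : ℝ, 0 ≤ T → IntervalIntegrable g volume 0 T) ∧
    Tendsto (fun T : ℝ => ∫ ν in (0 : ℝ)..T, g ν) atTop (𝓝 L)

/-- The Nakagami density with shape `m` and spread `w`. -/
def nakagamiDensity (m w x : ℝ) : ℝ :=
  if 0 < x then
    2 / Real.Gamma m * (m / w) ^ m * x ^ (2 * m - 1) * Real.exp (-(m / w) * x ^ 2)
  else 0

/-- The Nakagami distribution with shape `m` and spread `w`. -/
def nakagamiMeasure (m w : ℝ) : Measure ℝ :=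
  volume.withDensity fun x => ENNReal.ofReal (nakagamiDensity m w x)

/-- The random variables of the MWGD model: `N` specular phases `φ i` and a diffuse phase `φd`,
all uniform on `[0, 2π]`, and a Nakagami distributed diffuse amplitude `Vd`,
all `N + 2` of them mutually independent. -/
structure IsMWGD {S : Type*} [MeasurableSpace S] (P : Measure S) (N : ℕ) (m w : ℝ)
    (φ : Fin N → S → ℝ) (φd Vd : S → ℝ) : Prop where
  uniform_specular : ∀ i, HasLaw (φ i) (cond volume (Set.Icc 0 (2 * Real.pi))) P
  uniform_diffuse : HasLaw φd (cond volume (Set.Icc 0 (2 * Real.pi))) P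
  nakagami : HasLaw Vd (nakagamiMeasure m w) P
  indep : iIndepFun (Sum.elim φ ![φd, Vd] : Fin N ⊕ Fin 2 → S → ℝ) P

/-- The envelope `R = |∑ V_i e^{jφ_i} + V_d e^{jφ_d}|` of the received signal. -/
def envelope {S : Type*} {N : ℕ} (V : Fin N → ℝ) (φ : Fin N → S → ℝ) (φd Vd : S → ℝ)
    (s : S) : ℝ :=
  ‖(∑ i, (V i : ℂ) * Complex.exp (Complex.I * (φ i s : ℂ))) +
    (Vd s : ℂ) * Complex.exp (Complex.I * (φd s : ℂ))‖

/-- The finite set of the values `|±V₁ ± ⋯ ± V_N|`, for all choices of the signs. -/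
def resonantRadii {N : ℕ} (V : Fin N → ℝ) : Set ℝ :=
  {r | ∃ ε : Fin N → ℝ, (∀ i, ε i = 1 ∨ ε i = -1) ∧ r = |∑ i, ε i * V i|}

/-- The function `₁F₁(m; 1; -wν²/(4m)) ∏ J₀(V_i ν)`. -/
def mwgdPhi {N : ℕ} (m w : ℝ) (V : Fin N → ℝ) (ν : ℝ) : ℝ :=
  hyp1F1 m 1 (-(w / (4 * m) * ν ^ 2)) * ∏ i, besselJ 0 (V i * ν)

/-- The sequence `α(x) = (-V₁²m/w, …, -V_N²m/w, -x²m/w)`. -/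
def mwgdAlpha {N : ℕ} (m w : ℝ) (V : Fin N → ℝ) (x : ℝ) : Fin (N + 1) → ℝ :=
  Fin.snoc (α := fun _ => ℝ) (fun i => -(V i ^ 2 * m / w)) (-(x ^ 2 * m / w))

/-- The sequence `(1, …, 1)` of length `n`. -/
def onesSeq (n : ℕ) : Fin n → ℝ := fun _ => 1

/-- The sequence `(1, …, 1, 2)` with `N` ones. -/
def onesTwoSeq (N : ℕ) : Fin (N + 1) → ℝ := Fin.snoc (α := fun _ => ℝ) (onesSeq N) 2

end

/-! The Hankel transform `ν ↦ E J₀(ν R)` of the law of the envelope factorizes. The circular mean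
of `J₀ |a + v e^{jθ}|` is `J₀ |a| J₀ v` (`integral_besselJ_zero_norm_add`), so averaging over the
independent uniform phases, one wave at a time, turns `E J₀(ν R)` into `∏ J₀(V_i ν)` times
`E J₀(ν V_d)`, and the latter is the Nakagami integral giving `₁F₁`
(`IsMWGD.integral_besselJ_envelope`). It remains to invert this transform.

The inversion goes through Gaussian summation. By Fubini, the integral of `Φ(ν) J₁(tν)` against the
factor `exp (-σ²ν²)` is, up to the factor `t`, the mean over `R` of the mass that a planar Gaussian
of width `σ` centred at distance `R` from the origin gives to the disk of radius `t`
(`integral_besselJ_mul_besselJ_one_mul_exp`); as `σ → 0` this tends to `P(R < t)`, while the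
smoothed integral tends to the improper one whenever the latter converges
(`HasImproperIntegral.tendsto_integral_mul_exp`). The law of `R` has no atoms, because given the
phases `R = c` is a quadratic equation for the diffuse amplitude, so this is the distribution
function. The same smoothing exhibits the integral of `Φ(ν) ν J₀(rν)` as a limit of nonnegative
numbers.

Convergence rests on the asymptotics `J₀(x) = A cos(x - φ) x^{-1/2} + O(x^{-3/2})` and on the decay
of `₁F₁(m; 1; -x)`, at least like `x^{-min(m, 1)}`. Either the integrand decays fast enough, or
`m < 1` and the leading term oscillates with the frequencies `r ± V₁ ± ⋯ ± V_N`; integration by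
parts then gives a bound on the tails that is uniform for `r` in compact sets free of resonances
(`exists_tailBound_density`). By this uniformity the identity
`b J₁(bν) - a J₁(aν) = ∫_a^b rν J₀(rν) dr` passes to the limit, and the integral of the density over
a nonresonant interval is the increment of the distribution function. These intervals determine the
law, as the finitely many resonances carry no mass.

If `m` is a positive integer, `₁F₁(m; 1; -x)` is `exp (-x)` times a polynomial, and expanding the
Bessel functions and integrating term by term, with Gamma integrals, gives the `Ψ₂` series
(`integral_prod_hyp0F1`).
-/

/-! ### Pochhammer symbols and entire power series -/

@[simp] lemma pochhammer_zero (a : ℝ) : pochhammer a 0 = 1 := by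
  simp [pochhammer]

lemma pochhammer_succ (a : ℝ) (n : ℕ) : pochhammer a (n + 1) = pochhammer a n * (a + n) :=
  ascPochhammer_succ_eval n a

lemma pochhammer_succ_left (a : ℝ) (n : ℕ) :
    pochhammer a (n + 1) = a * pochhammer (a + 1) n := by
  simp [pochhammer, ascPochhammer_succ_left]

lemma pochhammer_one (n : ℕ) : pochhammer 1 n = n.factorial :=
  ascPochhammer_eval_one ℝ n

lemma pochhammer_two (n : ℕ) : pochhammer 2 n = (n + 1).factorial := by
  have h := pochhammer_succ_left 1 n
  rw [pochhammer_one] at h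
  norm_num at h
  exact h.symm

lemma pochhammer_nonneg {a : ℝ} (ha : 0 ≤ a) (n : ℕ) : 0 ≤ pochhammer a n := by
  induction n with
  | zero => simp
  | succ n ih => rw [pochhammer_succ]; positivity

lemma one_le_pochhammer {a : ℝ} (ha : 1 ≤ a) (n : ℕ) : 1 ≤ pochhammer a n := by
  induction n with
  | zero => simp
  | succ n ih =>
    rw [pochhammer_succ]
    exact one_le_mul_of_one_le_of_one_le ih (by linarith [(Nat.cast_nonneg n : (0 : ℝ) ≤ n)])

lemma factorial_le_pochhammer {a : ℝ} (ha : 1 ≤ a) (n : ℕ) :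
    (n.factorial : ℝ) ≤ pochhammer a n := by
  induction n with
  | zero => simp
  | succ n ih =>
    rw [pochhammer_succ, Nat.factorial_succ, mul_comm (n + 1)]
    push_cast
    exact mul_le_mul ih (by linarith) (by positivity) (pochhammer_nonneg (by linarith) n)

lemma pochhammer_le {a : ℝ} (ha : 0 ≤ a) (n : ℕ) :
    pochhammer a n ≤ (1 + a) ^ n * n.factorial := by
  induction n with
  | zero => simp
  | succ n ih =>
    rw [pochhammer_succ, Nat.factorial_succ, pow_succ]
    calc pochhammer a n * (a + n) ≤ ((1 + a) ^ n * n.factorial) * ((1 + a) * (n + 1)) := by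
          gcongr
          have : 0 ≤ a * n := by positivity
          linarith
      _ = _ := by push_cast; ring

/-- Coefficients of at most geometric size over `k!` define an entire power series. -/
lemma summable_of_le_pow_div_factorial {a : ℕ → ℝ} {K : ℝ}
    (h : ∀ k, |a k| ≤ K ^ k / k.factorial) (x : ℝ) : Summable fun k => a k * x ^ k := by
  refine Summable.of_norm_bounded (Real.summable_pow_div_factorial (K * |x|)) fun k => ?_
  rw [norm_mul, norm_pow, Real.norm_eq_abs, Real.norm_eq_abs, mul_pow, mul_div_right_comm]
  gcongr
  exact h k

/-- Termwise differentiation of an entire power series. -/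
lemma hasDerivAt_tsum_pow {a : ℕ → ℝ} {K : ℝ} (hK : 0 ≤ K)
    (h : ∀ k, |a k| ≤ K ^ k / k.factorial) (x : ℝ) :
    HasDerivAt (fun x => ∑' k, a k * x ^ k) (∑' k : ℕ, (k + 1) * a (k + 1) * x ^ k) x := by
  set R : ℝ := |x| + 1
  have hR : 0 ≤ R := by positivity
  have hs : Summable fun k : ℕ => K * ((K * R) ^ (k - 1) / (k - 1).factorial) := by
    rw [← summable_nat_add_iff 1]
    simpa using (Real.summable_pow_div_factorial (K * R)).mul_left K
  have key : ∀ k : ℕ, ∀ y : ℝ, |y| ≤ R → ‖a k * (k * y ^ (k - 1))‖ ≤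
      K * ((K * R) ^ (k - 1) / (k - 1).factorial) := by
    intro k y hy
    rcases k with _ | k
    · simp; positivity
    · simp only [Nat.add_sub_cancel, norm_mul, norm_pow, Real.norm_eq_abs]
      rw [abs_of_nonneg (by positivity : (0 : ℝ) ≤ (k + 1 : ℕ))]
      calc |a (k + 1)| * (((k + 1 : ℕ) : ℝ) * |y| ^ k)
          ≤ (K ^ (k + 1) / (k + 1).factorial) * (((k + 1 : ℕ) : ℝ) * R ^ k) := by
            gcongr; exact h _
        _ = _ := by
            rw [Nat.factorial_succ]; push_cast; field_simp
            ring_nf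
  have := hasDerivAt_tsum_of_isPreconnected (𝕜 := ℝ) (g := fun k y => a k * y ^ k)
    (g' := fun k y => a k * (k * y ^ (k - 1))) (t := Metric.ball 0 R) (y₀ := 0) (y := x) hs
    Metric.isOpen_ball (convex_ball _ _).isPreconnected
    (fun k y _ => (hasDerivAt_pow k y).const_mul (a k))
    (fun k y hy => key k y (by simpa using (mem_ball_zero_iff.1 hy).le))
    (by simp; positivity) (summable_of_le_pow_div_factorial h 0)
    (by simp [R])
  refine this.congr_deriv ?_
  have hs' : Summable fun k : ℕ => a k * (k * x ^ (k - 1)) :=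
    Summable.of_norm_bounded hs fun k => key k x (by simp [R])
  rw [hs'.tsum_eq_zero_add]
  simp only [Nat.cast_zero, zero_mul, mul_zero, zero_add, Nat.add_sub_cancel]
  exact tsum_congr fun k => by push_cast; ring

/-! ### Bessel functions -/

/-- The entire function `₀F₁(b; y) = ∑ₖ y^k / ((b)_k k!)`; for `b = 1, 2` it carries `J₀` and
`J₁`. -/
noncomputable def hyp0F1 (b y : ℝ) : ℝ :=
  ∑' k : ℕ, 1 / (pochhammer b k * k.factorial) * y ^ k

lemma hyp0F1_coeff_le {b : ℝ} (hb : 1 ≤ b) (k : ℕ) :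
    |1 / (pochhammer b k * k.factorial)| ≤ 1 ^ k / k.factorial := by
  have := one_le_pochhammer hb k
  rw [abs_of_nonneg (by positivity), one_pow]
  gcongr
  exact le_mul_of_one_le_left (by positivity) this

lemma hasSum_hyp0F1 {b : ℝ} (hb : 1 ≤ b) (y : ℝ) :
    HasSum (fun k : ℕ => 1 / (pochhammer b k * k.factorial) * y ^ k) (hyp0F1 b y) :=
  (summable_of_le_pow_div_factorial (hyp0F1_coeff_le hb) y).hasSum

lemma hasDerivAt_hyp0F1_one (y : ℝ) : HasDerivAt (hyp0F1 1) (hyp0F1 2 y) y := by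
  refine (hasDerivAt_tsum_pow zero_le_one (hyp0F1_coeff_le le_rfl) y).congr_deriv ?_
  refine tsum_congr fun k => ?_
  rw [pochhammer_one, pochhammer_two, Nat.factorial_succ]
  push_cast
  field_simp

lemma hasDerivAt_mul_hyp0F1_two (y : ℝ) :
    HasDerivAt (fun y => y * hyp0F1 2 y) (hyp0F1 1 y) y := by
  have h := (hasDerivAt_id y).mul (hasDerivAt_tsum_pow zero_le_one
    (hyp0F1_coeff_le (b := 2) (by norm_num)) y)
  refine h.congr_deriv ?_
  have h2 := hasSum_hyp0F1 (b := 2) (by norm_num) y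
  have h1 := hasSum_hyp0F1 (b := 1) le_rfl y
  have hs : Summable fun k : ℕ => ((k : ℝ) + 1) * (1 / (pochhammer 2 (k + 1) * (k + 1).factorial))
      * y ^ k := by
    refine summable_of_le_pow_div_factorial (K := 1) (fun k => ?_) y
    have := one_le_pochhammer (a := 2) (by norm_num) (k + 1)
    rw [abs_of_nonneg (by positivity), one_pow, Nat.factorial_succ]
    push_cast
    rw [mul_one_div, div_le_div_iff₀ (by positivity) (by positivity)]
    have h3 : (0 : ℝ) ≤ (k + 1) * k.factorial := by positivity
    nlinarith
  have e : ∑' k : ℕ, 1 / (pochhammer 2 k * k.factorial) * y ^ k = hyp0F1 2 y := rfl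
  simp only [one_mul, id]
  rw [e, ← tsum_mul_left, ← h2.tsum_eq]
  have hs2 := hs.mul_left y
  have hz : Summable fun k : ℕ => (k : ℝ) / (pochhammer 2 k * k.factorial) * y ^ k := by
    rw [← summable_nat_add_iff 1]
    refine hs2.congr fun k => ?_
    push_cast; ring
  have : ∑' k : ℕ, y * ((k + 1) * (1 / (pochhammer 2 (k + 1) * (k + 1).factorial)) * y ^ k) =
      ∑' k : ℕ, (k : ℝ) / (pochhammer 2 k * k.factorial) * y ^ k := by
    rw [hz.tsum_eq_zero_add]
    simp only [Nat.cast_zero, zero_div, zero_mul, zero_add]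
    exact tsum_congr fun k => by push_cast; ring
  rw [this, ← h2.summable.tsum_add hz]
  refine tsum_congr fun k => ?_
  rw [pochhammer_one, pochhammer_two, Nat.factorial_succ]
  push_cast
  field_simp
  ring

lemma besselJ_zero_eq (x : ℝ) : besselJ 0 x = hyp0F1 1 (-(x ^ 2 / 4)) := by
  refine tsum_congr fun k => ?_
  rw [pochhammer_one, neg_pow (x ^ 2 / 4)]
  have : (x / 2) ^ (2 * k) = (x ^ 2 / 4) ^ k := by rw [pow_mul]; ring
  simp only [add_zero]
  rw [this]; ring

lemma besselJ_one_eq (x : ℝ) : besselJ 1 x = x / 2 * hyp0F1 2 (-(x ^ 2 / 4)) := by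
  unfold besselJ hyp0F1
  rw [← tsum_mul_left]
  refine tsum_congr fun k => ?_
  rw [pochhammer_two, neg_pow (x ^ 2 / 4)]
  have : (x / 2) ^ (2 * k + 1) = (x ^ 2 / 4) ^ k * (x / 2) := by rw [pow_succ, pow_mul]; ring
  rw [this]; ring

lemma hasDerivAt_besselJ_zero (x : ℝ) : HasDerivAt (besselJ 0) (-besselJ 1 x) x := by
  have e : besselJ 0 = fun x => hyp0F1 1 (-(x ^ 2 / 4)) := funext besselJ_zero_eq
  rw [e]
  have h : HasDerivAt (fun x : ℝ => -(x ^ 2 / 4)) (-(x / 2)) x := by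
    refine (((hasDerivAt_pow 2 x).div_const 4).neg).congr_deriv ?_
    norm_num; ring
  refine ((hasDerivAt_hyp0F1_one _).comp x h).congr_deriv ?_
  rw [besselJ_one_eq]; ring

lemma hasDerivAt_mul_besselJ_one (x : ℝ) :
    HasDerivAt (fun x => x * besselJ 1 x) (x * besselJ 0 x) x := by
  have e : (fun x => x * besselJ 1 x) =
      fun x => -2 * (-(x ^ 2 / 4) * hyp0F1 2 (-(x ^ 2 / 4))) := by
    funext x; rw [besselJ_one_eq]; ring
  rw [e]
  have h : HasDerivAt (fun x : ℝ => -(x ^ 2 / 4)) (-(x / 2)) x := by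
    refine (((hasDerivAt_pow 2 x).div_const 4).neg).congr_deriv ?_
    norm_num; ring
  refine (((hasDerivAt_mul_hyp0F1_two _).comp x h).const_mul (-2)).congr_deriv ?_
  rw [besselJ_zero_eq]; ring

lemma hasDerivAt_besselJ_one {x : ℝ} (hx : x ≠ 0) :
    HasDerivAt (besselJ 1) (besselJ 0 x - besselJ 1 x / x) x := by
  have h := (hasDerivAt_mul_besselJ_one x).div (hasDerivAt_id x) hx
  have e : besselJ 1 =ᶠ[𝓝 x] (fun x => x * besselJ 1 x) / id := by
    filter_upwards [isOpen_ne.mem_nhds hx] with y hy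
    simp only [Pi.div_apply, id]
    field_simp [show y ≠ 0 from hy]
  refine (h.congr_of_eventuallyEq e).congr_deriv ?_
  simp only [id]
  field_simp

@[fun_prop] lemma continuous_besselJ_zero : Continuous (besselJ 0) :=
  continuous_iff_continuousAt.2 fun x => (hasDerivAt_besselJ_zero x).continuousAt

@[fun_prop] lemma continuous_besselJ_one : Continuous (besselJ 1) := by
  have e : besselJ 1 = fun x => x / 2 * hyp0F1 2 (-(x ^ 2 / 4)) := funext besselJ_one_eq
  have h : Continuous (hyp0F1 2) := continuous_iff_continuousAt.2 fun x =>
    (hasDerivAt_tsum_pow zero_le_one (hyp0F1_coeff_le (b := 2) (by norm_num)) x).continuousAt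
  rw [e]; fun_prop

@[simp] lemma besselJ_zero_zero : besselJ 0 0 = 1 := by
  unfold besselJ
  rw [tsum_eq_single 0 (by intro k hk; simp [hk])]
  simp

/-! ### Kummer's function `₁F₁(m; 1; ·)` -/

lemma hyp1F1_coeff_le {m : ℝ} (hm : 0 ≤ m) (k : ℕ) :
    |pochhammer m k / (k.factorial * k.factorial : ℝ)| ≤ (1 + m) ^ k / k.factorial := by
  have := pochhammer_nonneg hm k
  rw [abs_of_nonneg (by positivity), div_le_div_iff₀ (by positivity) (by positivity)]
  have := mul_le_mul_of_nonneg_right (pochhammer_le hm k)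
    (by positivity : (0 : ℝ) ≤ k.factorial)
  linarith

lemma hyp1F1_one_eq (m x : ℝ) :
    hyp1F1 m 1 x = ∑' k : ℕ, pochhammer m k / (k.factorial * k.factorial : ℝ) * x ^ k := by
  refine tsum_congr fun k => ?_
  rw [pochhammer_one]; ring

lemma hasSum_hyp1F1 {m : ℝ} (hm : 0 ≤ m) (x : ℝ) :
    HasSum (fun k : ℕ => pochhammer m k / (k.factorial * k.factorial : ℝ) * x ^ k)
      (hyp1F1 m 1 x) := by
  rw [hyp1F1_one_eq]
  exact (summable_of_le_pow_div_factorial (hyp1F1_coeff_le hm) x).hasSum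

lemma differentiable_hyp1F1 {m : ℝ} (hm : 0 ≤ m) : Differentiable ℝ (hyp1F1 m 1) := by
  rw [show hyp1F1 m 1 = _ from funext (hyp1F1_one_eq m)]
  exact fun x => (hasDerivAt_tsum_pow (by linarith) (hyp1F1_coeff_le hm) x).differentiableAt

/-- The relation `z M'(m; z) = m (M(m + 1; z) - M(m; z))` for `M(m; z) = ₁F₁(m; 1; z)`. -/
lemma mul_deriv_hyp1F1 {m : ℝ} (hm : 0 ≤ m) (z : ℝ) :
    z * deriv (hyp1F1 m 1) z = m * (hyp1F1 (m + 1) 1 z - hyp1F1 m 1 z) := by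
  have hd : deriv (hyp1F1 m 1) z = ∑' k : ℕ, ((k : ℝ) + 1) *
      (pochhammer m (k + 1) / ((k + 1).factorial * (k + 1).factorial)) * z ^ k := by
    rw [show hyp1F1 m 1 = _ from funext (hyp1F1_one_eq m)]
    exact (hasDerivAt_tsum_pow (by linarith) (hyp1F1_coeff_le hm) z).deriv
  have h1 := ((hasSum_hyp1F1 (m := m + 1) (by linarith) z).sub (hasSum_hyp1F1 hm z)).mul_left m
  have e : (fun k : ℕ => m * (pochhammer (m + 1) k / (k.factorial * k.factorial : ℝ) * z ^ k -
      pochhammer m k / (k.factorial * k.factorial : ℝ) * z ^ k)) =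
      fun k : ℕ => (k : ℝ) * (pochhammer m k / (k.factorial * k.factorial : ℝ)) * z ^ k := by
    funext k
    have h2 := pochhammer_succ_left m k
    rw [pochhammer_succ] at h2
    calc _ = (m * pochhammer (m + 1) k - m * pochhammer m k) /
          (k.factorial * k.factorial : ℝ) * z ^ k := by ring
      _ = _ := by rw [← h2]; ring
  rw [e] at h1
  rw [← h1.tsum_eq, h1.summable.tsum_eq_zero_add, hd, ← tsum_mul_left]
  simp only [Nat.cast_zero, zero_mul, zero_add]
  refine tsum_congr fun k => by push_cast; ring

/-- The contiguous relation for `M(m; z) = ₁F₁(m; 1; z)` in the parameter `m`. -/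
lemma mul_hyp1F1 {m : ℝ} (hm : 1 ≤ m) (z : ℝ) :
    z * hyp1F1 m 1 z = (m - 1) * hyp1F1 (m - 1) 1 z - (2 * m - 1) * hyp1F1 m 1 z +
      m * hyp1F1 (m + 1) 1 z := by
  have h0 := hasSum_hyp1F1 (m := m) (by linarith) z
  have h1 := (((hasSum_hyp1F1 (m := m - 1) (by linarith) z).mul_left (m - 1)).sub
    (h0.mul_left (2 * m - 1))).add
    ((hasSum_hyp1F1 (m := m + 1) (by linarith) z).mul_left m)
  rw [← h1.tsum_eq, h1.summable.tsum_eq_zero_add, ← h0.tsum_eq, ← tsum_mul_left]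
  simp only [pochhammer_zero, Nat.factorial_zero, pow_zero]
  norm_num
  rw [show m - 2 * m + m = 0 by ring, zero_add]
  refine tsum_congr fun k => ?_
  have e1 : (m - 1) * pochhammer (m - 1) (k + 1) = (m - 1) ^ 2 * pochhammer m k := by
    rw [pochhammer_succ_left]; ring_nf
  have e2 := pochhammer_succ m k
  have e3 : m * pochhammer (m + 1) (k + 1) = pochhammer m k * (m + k) * (m + k + 1) := by
    rw [← pochhammer_succ_left, pochhammer_succ, pochhammer_succ]; push_cast; ring
  rw [Nat.factorial_succ]
  push_cast
  have hk : ((k : ℝ) + 1) ≠ 0 := by positivity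
  have hf : (k.factorial : ℝ) ≠ 0 := by positivity
  have : (m - 1) * (pochhammer (m - 1) (k + 1) /
        (((k : ℝ) + 1) * k.factorial * (((k : ℝ) + 1) * k.factorial)) * z ^ (k + 1)) -
      (2 * m - 1) * (pochhammer m (k + 1) /
        (((k : ℝ) + 1) * k.factorial * (((k : ℝ) + 1) * k.factorial)) * z ^ (k + 1)) +
      m * (pochhammer (m + 1) (k + 1) /
        (((k : ℝ) + 1) * k.factorial * (((k : ℝ) + 1) * k.factorial)) * z ^ (k + 1)) =
      ((m - 1) * pochhammer (m - 1) (k + 1) - (2 * m - 1) * pochhammer m (k + 1) +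
        m * pochhammer (m + 1) (k + 1)) /
        (((k : ℝ) + 1) * k.factorial * (((k : ℝ) + 1) * k.factorial)) * z ^ (k + 1) := by ring
  rw [this, e1, e2, e3]
  field_simp
  ring

/-- For a positive integer `n`, Kummer's transformation makes `₁F₁(n; 1; ·)` an exponential
polynomial. The coefficients come from Vandermonde's identity
`(n)_k / k! = ∑ⱼ (n-1 choose j) (k choose j)`. -/
lemma hyp1F1_natCast {n : ℕ} (hn : 0 < n) (z : ℝ) :
    hyp1F1 n 1 z = Real.exp z * ∑ j ∈ Finset.range n,
      ((n - 1).choose j : ℝ) * (z ^ j / j.factorial) := by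
  have hj : ∀ j : ℕ, HasSum (fun k : ℕ => (k.choose j : ℝ) * (z ^ k / k.factorial))
      (Real.exp z * (z ^ j / j.factorial)) := by
    intro j
    rw [← hasSum_nat_add_iff' j]
    rw [Finset.sum_eq_zero (fun i hi => by
      rw [Nat.choose_eq_zero_of_lt (Finset.mem_range.1 hi)]; simp), sub_zero]
    have h := (NormedSpace.expSeries_div_hasSum_exp (𝔸 := ℝ) z).mul_right (z ^ j / j.factorial)
    rw [← Real.exp_eq_exp_ℝ] at h
    refine h.congr_fun fun k => ?_
    rw [Nat.cast_choose ℝ (Nat.le_add_left j k), Nat.add_sub_cancel, pow_add]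
    field_simp
  rw [Finset.mul_sum]
  have h := hasSum_sum (s := Finset.range n) fun j _ =>
    (hj j).mul_left ((n - 1).choose j : ℝ)
  have e : ∀ k : ℕ, ∑ j ∈ Finset.range n, ((n - 1).choose j : ℝ) *
      ((k.choose j : ℝ) * (z ^ k / k.factorial)) =
      pochhammer n k / (k.factorial * k.factorial : ℝ) * z ^ k := by
    intro k
    have hv : pochhammer n k = k.factorial * ((n - 1 + k).choose k : ℕ) := by
      rw [pochhammer, ascPochhammer_nat_eq_natCast_ascFactorial, ← Nat.cast_mul]
      congr 1
      rw [Nat.ascFactorial_eq_factorial_mul_choose']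
      congr 2; omega
    have hc : ((n - 1 + k).choose k : ℕ) =
        ∑ j ∈ Finset.range n, (n - 1).choose j * k.choose j := by
      rw [Nat.choose_symm_add.symm, Nat.add_choose_eq, Finset.Nat.sum_antidiagonal_eq_sum_range_succ
        (fun i j => (n - 1).choose i * k.choose j), show (n - 1).succ = n by omega,
        ← Finset.sum_range_reflect]
      refine Finset.sum_congr rfl fun j hj => ?_
      have : j < n := Finset.mem_range.1 hj
      rw [show n - 1 - (n - 1 - j) = j by omega, Nat.choose_symm (by omega)]
    rw [hv, hc]
    push_cast
    rw [Finset.mul_sum, Finset.sum_div, Finset.sum_mul]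
    refine Finset.sum_congr rfl fun j _ => ?_
    field_simp
  simp_rw [e] at h
  rw [hyp1F1_one_eq, h.tsum_eq]
  exact Finset.sum_congr rfl fun j _ => by ring

/-! ### Circular averages of `J₀` -/

lemma intervalIntegral_swap_of_continuous {F : ℝ → ℝ → ℝ} (hF : Continuous (Function.uncurry F))
    (a b c d : ℝ) :
    ∫ x in a..b, ∫ y in c..d, F x y = ∫ y in c..d, ∫ x in a..b, F x y := by
  refine intervalIntegral_intervalIntegral_swap ?_
  exact (hF.continuousOn.integrableOn_compact (isCompact_uIcc.prod isCompact_uIcc)).mono_set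
    (Set.prod_mono Set.uIoc_subset_uIcc Set.uIoc_subset_uIcc)

lemma integral_sin_pow_even_full (k : ℕ) :
    ∫ θ in (0 : ℝ)..2 * Real.pi, Real.sin θ ^ (2 * k) =
      2 * Real.pi * ((2 * k).factorial / (4 ^ k * (k.factorial * k.factorial))) := by
  have hi : ∀ a b : ℝ, IntervalIntegrable (fun θ => Real.sin θ ^ (2 * k)) volume a b :=
    fun a b => (by fun_prop : Continuous fun θ => Real.sin θ ^ (2 * k)).intervalIntegrable a b
  rw [← intervalIntegral.integral_add_adjacent_intervals (hi 0 Real.pi) (hi _ _)]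
  have h2 : ∫ θ in Real.pi..2 * Real.pi, Real.sin θ ^ (2 * k) =
      ∫ θ in (0 : ℝ)..Real.pi, Real.sin θ ^ (2 * k) := by
    have := intervalIntegral.integral_comp_add_right (a := 0) (b := Real.pi)
      (fun θ => Real.sin θ ^ (2 * k)) Real.pi
    rw [zero_add, ← two_mul] at this
    rw [← this]
    simp [Real.sin_add_pi, pow_mul]
  rw [h2, integral_sin_pow_even, ← two_mul, ← mul_assoc]
  congr 1
  clear hi h2
  induction k with
  | zero => simp
  | succ k ih =>
    rw [Finset.prod_range_succ, ih, show 2 * (k + 1) = 2 * k + 1 + 1 by ring,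
      Nat.factorial_succ, Nat.factorial_succ, Nat.factorial_succ, pow_succ]
    push_cast
    field_simp
    ring

/-- Bessel's integral. -/
lemma integral_cos_mul_sin (x : ℝ) :
    ∫ θ in (0 : ℝ)..2 * Real.pi, Real.cos (x * Real.sin θ) = 2 * Real.pi * besselJ 0 x := by
  have h := intervalIntegral.hasSum_integral_of_dominated_convergence (μ := volume)
    (a := 0) (b := 2 * Real.pi)
    (F := fun (n : ℕ) θ => (-1) ^ n * (x * Real.sin θ) ^ (2 * n) / ((2 * n).factorial : ℝ))
    (f := fun θ => Real.cos (x * Real.sin θ))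
    (fun n _ => |x| ^ (2 * n) / ((2 * n).factorial : ℝ))
    (fun n => (by fun_prop : Continuous fun θ : ℝ => (-1) ^ n * (x * Real.sin θ) ^ (2 * n) /
      ((2 * n).factorial : ℝ)).aestronglyMeasurable)
    (fun n => ae_of_all _ fun θ _ => by
      simp only [norm_div, norm_mul, norm_pow, norm_neg, norm_one, one_pow, one_mul,
        Real.norm_eq_abs, Nat.abs_cast]
      gcongr
      exact mul_le_of_le_one_right (abs_nonneg _) (Real.abs_sin_le_one θ))
    (ae_of_all _ fun θ _ =>
      (Real.summable_pow_div_factorial |x|).comp_injective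
        (mul_right_injective₀ (two_ne_zero' ℕ)))
    (by simp)
    (ae_of_all _ fun θ _ => Real.hasSum_cos _)
  rw [← h.tsum_eq, besselJ, ← tsum_mul_left]
  refine tsum_congr fun k => ?_
  have e : (fun θ => (-1) ^ k * (x * Real.sin θ) ^ (2 * k) / ((2 * k).factorial : ℝ)) =
      fun θ => ((-1) ^ k * x ^ (2 * k) / ((2 * k).factorial : ℝ)) * Real.sin θ ^ (2 * k) := by
    funext θ; rw [mul_pow]; ring
  rw [e, intervalIntegral.integral_const_mul, integral_sin_pow_even_full]
  have h4 : (x / 2) ^ (2 * k) = x ^ (2 * k) / 4 ^ k := by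
    rw [div_pow, pow_mul 2]; norm_num
  simp only [add_zero]
  rw [h4]
  field_simp

lemma integral_sin_mul_sin (x : ℝ) :
    ∫ θ in (0 : ℝ)..2 * Real.pi, Real.sin (x * Real.sin θ) = 0 := by
  have hp : Function.Periodic (fun θ => Real.sin (x * Real.sin θ)) (2 * Real.pi) := fun θ => by
    simp
  have h := hp.intervalIntegral_add_eq 0 (-Real.pi)
  rw [zero_add, show -Real.pi + 2 * Real.pi = Real.pi by ring] at h
  rw [h]
  have h2 := intervalIntegral.integral_comp_neg (a := -Real.pi) (b := Real.pi)
    (fun θ => Real.sin (x * Real.sin θ))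
  simp only [Real.sin_neg, mul_neg, neg_neg, intervalIntegral.integral_neg] at h2
  linarith

lemma integral_cos_add_mul_sin (A x ψ : ℝ) :
    ∫ θ in (0 : ℝ)..2 * Real.pi, Real.cos (A + x * Real.sin (θ + ψ)) =
      2 * Real.pi * (Real.cos A * besselJ 0 x) := by
  have hp : Function.Periodic (fun θ => Real.cos (A + x * Real.sin θ)) (2 * Real.pi) := fun θ => by
    simp
  rw [intervalIntegral.integral_comp_add_right (fun θ => Real.cos (A + x * Real.sin θ)) ψ,
    zero_add, add_comm _ ψ, hp.intervalIntegral_add_eq ψ 0, zero_add]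
  simp_rw [Real.cos_add]
  rw [intervalIntegral.integral_sub
    ((by fun_prop : Continuous _).intervalIntegrable _ _)
    ((by fun_prop : Continuous _).intervalIntegrable _ _),
    intervalIntegral.integral_const_mul, intervalIntegral.integral_const_mul,
    integral_cos_mul_sin, integral_sin_mul_sin]
  ring

lemma abs_besselJ_zero_le (x : ℝ) : |besselJ 0 x| ≤ 1 := by
  have h := intervalIntegral.norm_integral_le_of_norm_le_const (a := 0) (b := 2 * Real.pi)
    (f := fun θ => Real.cos (x * Real.sin θ)) (C := 1) (fun θ _ => Real.abs_cos_le_one _)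
  rw [integral_cos_mul_sin, norm_mul, sub_zero, one_mul, Real.norm_eq_abs, Real.norm_eq_abs] at h
  have : 0 < |2 * Real.pi| := by have := Real.pi_pos; positivity
  nlinarith

/-- Multiplication by `e^{iψ}` turns the imaginary part into a sinusoid of amplitude `‖z‖`. -/
lemma im_mul_exp (z : ℂ) (ψ : ℝ) :
    (z * Complex.exp (Complex.I * ψ)).im = ‖z‖ * Real.sin (ψ + z.arg) := by
  conv_lhs => rw [← Complex.norm_mul_exp_arg_mul_I z]
  rw [mul_assoc, ← Complex.exp_add,
    show (z.arg : ℂ) * Complex.I + Complex.I * ψ = ((ψ + z.arg : ℝ) : ℂ) * Complex.I by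
      push_cast; ring, Complex.im_ofReal_mul, Complex.exp_ofReal_mul_I_im]

/-- `J₀` is a radial average of plane waves. -/
lemma integral_cos_im (z : ℂ) :
    ∫ ψ in (0 : ℝ)..2 * Real.pi, Real.cos ((z * Complex.exp (Complex.I * ψ)).im) =
      2 * Real.pi * besselJ 0 ‖z‖ := by
  simp_rw [im_mul_exp]
  have := integral_cos_add_mul_sin 0 ‖z‖ z.arg
  simpa using this

/-- Neumann's addition theorem, averaged: `J₀ ∘ ‖·‖` is an eigenfunction of every circular mean,
the mean over radius `v` having eigenvalue `J₀ v`. -/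
lemma integral_besselJ_zero_norm_add (a : ℂ) (v : ℝ) :
    ∫ θ in (0 : ℝ)..2 * Real.pi, besselJ 0 ‖a + v * Complex.exp (Complex.I * θ)‖ =
      2 * Real.pi * (besselJ 0 ‖a‖ * besselJ 0 v) := by
  have hpi : 2 * Real.pi ≠ 0 := by have := Real.pi_pos; positivity
  have h1 : ∀ θ : ℝ, besselJ 0 ‖a + v * Complex.exp (Complex.I * θ)‖ =
      (2 * Real.pi)⁻¹ * ∫ ψ in (0 : ℝ)..2 * Real.pi, Real.cos
        (((a + v * Complex.exp (Complex.I * θ)) * Complex.exp (Complex.I * ψ)).im) := by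
    intro θ; rw [integral_cos_im]; field_simp
  have h2 : ∀ θ ψ : ℝ,
      ((a + v * Complex.exp (Complex.I * θ)) * Complex.exp (Complex.I * ψ)).im =
      (a * Complex.exp (Complex.I * ψ)).im + v * Real.sin (θ + ψ) := by
    intro θ ψ
    rw [add_mul, Complex.add_im, mul_assoc, ← Complex.exp_add,
      show Complex.I * (θ : ℂ) + Complex.I * ψ = ((θ + ψ : ℝ) : ℂ) * Complex.I by push_cast; ring,
      Complex.im_ofReal_mul, Complex.exp_ofReal_mul_I_im]
  simp_rw [h1, h2]
  rw [intervalIntegral.integral_const_mul, intervalIntegral_swap_of_continuous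
    (by unfold Function.uncurry; fun_prop)]
  simp_rw [integral_cos_add_mul_sin]
  rw [intervalIntegral.integral_const_mul, intervalIntegral.integral_mul_const, integral_cos_im]
  field_simp

/-! ### Gaussian moments of products of Bessel series -/

/-- A product of absolutely convergent series is the sum over multi-indices. -/
lemma hasSum_pi_prod {n : ℕ} {f : Fin n → ℕ → ℝ} {c : Fin n → ℝ}
    (hf : ∀ i, Summable fun j => |f i j|) (hc : ∀ i, HasSum (f i) (c i)) :
    (Summable fun k : Fin n → ℕ => |∏ i, f i (k i)|) ∧
      HasSum (fun k : Fin n → ℕ => ∏ i, f i (k i)) (∏ i, c i) := by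
  have hmono : Monotone fun M : ℕ => Fintype.piFinset fun _ : Fin n => Finset.range M :=
    fun M M' h => Fintype.piFinset_subset _ _ fun _ => Finset.range_mono h
  have hmem : ∀ k : Fin n → ℕ, ∃ M, k ∈ Fintype.piFinset fun _ : Fin n => Finset.range M := by
    intro k
    refine ⟨∑ i, k i + 1, Fintype.mem_piFinset.2 fun i => Finset.mem_range.2 ?_⟩
    exact Nat.lt_succ_of_le (Finset.single_le_sum (f := k) (fun _ _ => Nat.zero_le _)
      (Finset.mem_univ i))
  have ht := Monotone.tendsto_atTop_finset hmono hmem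
  have hs : Summable fun k : Fin n → ℕ => |∏ i, f i (k i)| := by
    refine summable_of_sum_le (c := ∏ i, ∑' j, |f i j|) (fun _ => abs_nonneg _) fun u => ?_
    obtain ⟨M, hM⟩ := (ht.eventually_ge_atTop u).exists
    calc ∑ k ∈ u, |∏ i, f i (k i)|
        ≤ ∑ k ∈ Fintype.piFinset fun _ : Fin n => Finset.range M, |∏ i, f i (k i)| :=
          Finset.sum_le_sum_of_subset_of_nonneg hM fun _ _ _ => abs_nonneg _
      _ = ∏ i, ∑ j ∈ Finset.range M, |f i j| := by
          simp_rw [Finset.abs_prod]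
          rw [Finset.prod_univ_sum]
      _ ≤ _ := Finset.prod_le_prod (fun i _ => Finset.sum_nonneg fun _ _ => abs_nonneg _)
          fun i _ => (hf i).sum_le_tsum _ fun _ _ => abs_nonneg _
  refine ⟨hs, ?_⟩
  have h1 := (hs.of_abs.hasSum).comp ht
  have h2 : Tendsto (fun M : ℕ => ∏ i, ∑ j ∈ Finset.range M, f i j) atTop (𝓝 (∏ i, c i)) :=
    tendsto_finsetProd _ fun i _ => (hc i).tendsto_sum_nat
  have h3 : (fun M : ℕ => ∏ i, ∑ j ∈ Finset.range M, f i j) =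
      (fun u : Finset (Fin n → ℕ) => ∑ k ∈ u, ∏ i, f i (k i)) ∘
        fun M : ℕ => Fintype.piFinset fun _ : Fin n => Finset.range M := by
    funext M; simp [Finset.prod_univ_sum]
  rw [h3] at h2
  rw [← tendsto_nhds_unique h1 h2]
  exact hs.of_abs.hasSum

lemma factorial_sum_le {ι : Type*} (s : Finset ι) (k : ι → ℕ) :
    (∑ i ∈ s, k i).factorial ≤ (2 ^ s.card) ^ (∑ i ∈ s, k i) * ∏ i ∈ s, (k i).factorial := by
  classical
  induction s using Finset.induction_on with
  | empty => simp
  | insert i s hi ih =>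
    rw [Finset.sum_insert hi, Finset.prod_insert hi, Finset.card_insert_of_notMem hi]
    set K := ∑ i ∈ s, k i
    rw [← Nat.add_choose_mul_factorial_mul_factorial (k i) K]
    calc (k i + K).choose K * (k i).factorial * K.factorial
        ≤ 2 ^ (k i + K) * (k i).factorial *
          ((2 ^ s.card) ^ (k i + K) * ∏ i ∈ s, (k i).factorial) := by
          gcongr
          · exact Nat.choose_le_two_pow _ _
          · refine ih.trans ?_
            gcongr
            · exact Nat.one_le_two_pow
            · omega
      _ = (2 ^ (s.card + 1)) ^ (k i + K) *
          ((k i).factorial * ∏ i ∈ s, (k i).factorial) := by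
          rw [pow_succ, mul_pow]; ring

/-- The series `Ψ₂` converges absolutely everywhere when its lower parameters are at least `1`. -/
lemma summable_psi2Term {n : ℕ} {s : ℝ} (hs : 0 ≤ s) {b : Fin n → ℝ} (hb : ∀ i, 1 ≤ b i)
    (x : Fin n → ℝ) : Summable (psi2Term s b x) := by
  have hexp : ∀ i : Fin n, HasSum (fun j : ℕ => ((1 + s) * 2 ^ n * |x i|) ^ j / j.factorial)
      (Real.exp ((1 + s) * 2 ^ n * |x i|)) := fun i => by
    rw [Real.exp_eq_exp_ℝ]; exact NormedSpace.expSeries_div_hasSum_exp _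
  have h := (hasSum_pi_prod (fun i => (hexp i).summable.abs) hexp).1
  refine Summable.of_norm_bounded h fun k => ?_
  set K := ∑ i, k i
  have h1 := pochhammer_le hs K
  have h2 : (K.factorial : ℝ) ≤ (2 ^ n) ^ K * ∏ i, ((k i).factorial : ℝ) := by
    have := factorial_sum_le Finset.univ k
    rw [Finset.card_univ, Fintype.card_fin] at this
    exact_mod_cast this
  have h3 : ∏ i, (((k i).factorial : ℝ) * ((k i).factorial : ℝ)) ≤
      ∏ i, pochhammer (b i) (k i) * ((k i).factorial : ℝ) :=
    Finset.prod_le_prod (fun i _ => by positivity) fun i _ => by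
      gcongr; exact factorial_le_pochhammer (hb i) _
  have hpos : 0 < ∏ i, (((k i).factorial : ℝ) * ((k i).factorial : ℝ)) :=
    Finset.prod_pos fun i _ => by positivity
  have hF : 0 < ∏ i, ((k i).factorial : ℝ) := Finset.prod_pos fun i _ => by positivity
  rw [psi2Term, norm_mul, norm_div, Real.norm_of_nonneg (pochhammer_nonneg hs _),
    Real.norm_of_nonneg (hpos.le.trans h3), norm_prod]
  simp_rw [norm_pow, Real.norm_eq_abs]
  calc pochhammer s K / (∏ i, pochhammer (b i) (k i) * ((k i).factorial : ℝ)) *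
        ∏ i, |x i| ^ k i
      ≤ ((1 + s) ^ K * ((2 ^ n) ^ K * ∏ i, ((k i).factorial : ℝ))) /
          (∏ i, (((k i).factorial : ℝ) * ((k i).factorial : ℝ))) * ∏ i, |x i| ^ k i := by
        have hx : 0 ≤ ∏ i, |x i| ^ k i := Finset.prod_nonneg fun i _ => by positivity
        have h4 : pochhammer s K ≤ (1 + s) ^ K * ((2 ^ n) ^ K * ∏ i, ((k i).factorial : ℝ)) :=
          h1.trans (by gcongr)
        gcongr
    _ = ∏ i, ((1 + s) * 2 ^ n * |x i|) ^ k i / (k i).factorial := by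
        rw [Finset.prod_div_distrib, Finset.prod_mul_distrib]
        simp_rw [mul_pow]
        rw [Finset.prod_mul_distrib, Finset.prod_mul_distrib, Finset.prod_pow_eq_pow_sum,
          Finset.prod_pow_eq_pow_sum]
        field_simp
        ring
    _ = |∏ i, ((1 + s) * 2 ^ n * |x i|) ^ k i / (k i).factorial| := by
        rw [abs_of_nonneg]
        exact Finset.prod_nonneg fun i _ => by positivity

lemma Gamma_add_natCast {s : ℝ} (hs : 0 < s) (K : ℕ) :
    Real.Gamma (s + K) = pochhammer s K * Real.Gamma s := by
  induction K with
  | zero => simp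
  | succ K ih =>
    rw [pochhammer_succ, Nat.cast_succ, ← add_assoc, Real.Gamma_add_one (by positivity), ih]
    ring

/-- A series of integrable functions with summable `L¹` norms has an integrable sum. -/
lemma integrable_of_hasSum {α ι : Type*} [MeasurableSpace α] {μ : Measure α} [Countable ι]
    {F : ι → α → ℝ} {f : α → ℝ} (hF : ∀ i, Integrable (F i) μ)
    (hs : Summable fun i => ∫ a, ‖F i a‖ ∂μ) (hf : ∀ᵐ a ∂μ, HasSum (fun i => F i a) (f a)) :
    Integrable f μ := by
  refine ⟨aestronglyMeasurable_of_tendsto_ae (atTop : Filter (Finset ι))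
    (f := fun u a => ∑ i ∈ u, F i a)
    (fun u => Finset.aestronglyMeasurable_fun_sum _ fun i _ => (hF i).1) hf, ?_⟩
  calc ∫⁻ a, ‖f a‖ₑ ∂μ ≤ ∫⁻ a, ∑' i, ‖F i a‖ₑ ∂μ := by
        refine lintegral_mono_ae (hf.mono fun a ha => ?_)
        rw [← ha.tsum_eq]
        exact enorm_tsum_le_tsum_enorm
    _ = ∑' i, ∫⁻ a, ‖F i a‖ₑ ∂μ := lintegral_tsum fun i => (hF i).1.enorm
    _ = ∑' i, ENNReal.ofReal (∫ a, ‖F i a‖ ∂μ) := by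
        simp_rw [ofReal_integral_norm_eq_lintegral_enorm (hF _)]
    _ < ⊤ := by
        rw [← ENNReal.ofReal_tsum_of_nonneg (fun i => integral_nonneg fun a => norm_nonneg _) hs]
        exact ENNReal.ofReal_lt_top

lemma integral_rpow_mul_exp_neg_sq {s c : ℝ} (hs : 0 < s) (hc : 0 < c) :
    ∫ x in Set.Ioi (0 : ℝ), 2 * x ^ (2 * s - 1) * Real.exp (-c * x ^ 2) =
      c ^ (-s) * Real.Gamma s := by
  have h := integral_rpow_mul_exp_neg_mul_rpow (p := 2) (q := 2 * s - 1) (b := c) two_pos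
    (by linarith) hc
  simp_rw [Real.rpow_two] at h
  simp_rw [mul_assoc]
  rw [integral_const_mul, h, show -(2 * s - 1 + 1) / 2 = -s by ring,
    show (2 * s - 1 + 1) / 2 = s by ring]
  ring

/-- Gaussian moments of a product of functions `₀F₁(bᵢ; -(aᵢ x)² / 4)` are values of `Ψ₂`:
expand the product and integrate termwise, the resulting Gamma functions being `(s)_{∑ kᵢ} Γ(s)`. -/
lemma integral_prod_hyp0F1 {n : ℕ} {s c : ℝ} (hs : 0 < s) (hc : 0 < c) {b : Fin n → ℝ}
    (hb : ∀ i, 1 ≤ b i) (a : Fin n → ℝ) :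
    IntegrableOn (fun x : ℝ => 2 * x ^ (2 * s - 1) * Real.exp (-c * x ^ 2) *
        ∏ i, hyp0F1 (b i) (-((a i * x) ^ 2 / 4))) (Set.Ioi 0) ∧
    ∫ x in Set.Ioi (0 : ℝ), 2 * x ^ (2 * s - 1) * Real.exp (-c * x ^ 2) *
        ∏ i, hyp0F1 (b i) (-((a i * x) ^ 2 / 4)) =
      c ^ (-s) * Real.Gamma s * psi2 s b (fun i => -(a i ^ 2 / (4 * c))) := by
  set C : (Fin n → ℕ) → ℝ := fun k =>
    ∏ i, (1 / (pochhammer (b i) (k i) * (k i).factorial) * (-(a i ^ 2 / 4)) ^ k i)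
  set F : (Fin n → ℕ) → ℝ → ℝ := fun k x =>
    C k * (2 * x ^ (2 * (s + (∑ i, k i : ℕ)) - 1) * Real.exp (-c * x ^ 2)) with hFdef
  have hF0 : ∀ k x, x ∈ Set.Ioi (0 : ℝ) → F k x = 2 * x ^ (2 * s - 1) * Real.exp (-c * x ^ 2) *
      ∏ i, (1 / (pochhammer (b i) (k i) * (k i).factorial) * (-((a i * x) ^ 2 / 4)) ^ k i) := by
    intro k x hx
    have e1 : x ^ (2 * (s + (∑ i, k i : ℕ)) - 1) = x ^ (2 * s - 1) * ∏ i, (x ^ 2) ^ k i := by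
      rw [Finset.prod_pow_eq_pow_sum, ← pow_mul, ← Real.rpow_natCast, ← Real.rpow_add hx]
      congr 1; push_cast; ring
    simp only [hFdef, C]
    rw [e1]
    have e2 : ∀ i, (-((a i * x) ^ 2 / 4)) ^ k i = (-(a i ^ 2 / 4)) ^ k i * (x ^ 2) ^ k i := by
      intro i; rw [← mul_pow]; congr 1; ring
    have e3 : ∏ i, (1 / (pochhammer (b i) (k i) * (k i).factorial) *
        (-((a i * x) ^ 2 / 4)) ^ k i) = C k * ∏ i, (x ^ 2) ^ k i := by
      simp_rw [e2, ← mul_assoc]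
      rw [Finset.prod_mul_distrib]
    rw [e3]
    ring
  have hInt : ∀ k : Fin n → ℕ, IntegrableOn (fun x : ℝ => 2 * x ^ (2 * (s + (∑ i, k i : ℕ)) - 1) *
      Real.exp (-c * x ^ 2)) (Set.Ioi 0) := by
    intro k
    simp_rw [mul_assoc]
    exact (integrableOn_rpow_mul_exp_neg_mul_sq hc (by
      have : (0 : ℝ) ≤ (∑ i, k i : ℕ) := Nat.cast_nonneg _
      linarith)).const_mul 2
  have hFi : ∀ k, IntegrableOn (F k) (Set.Ioi 0) := fun k => (hInt k).const_mul _
  have hval : ∀ k : Fin n → ℕ, C k * (c ^ (-(s + (∑ i, k i : ℕ))) * Real.Gamma (s + (∑ i, k i : ℕ))) =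
      c ^ (-s) * Real.Gamma s * psi2Term s b (fun i => -(a i ^ 2 / (4 * c))) k := by
    intro k
    rw [Gamma_add_natCast hs, neg_add, Real.rpow_add hc, Real.rpow_neg hc.le ((∑ i, k i : ℕ) : ℝ),
      Real.rpow_natCast, psi2Term]
    have e2 : ∀ i, (-(a i ^ 2 / (4 * c))) ^ k i = (-(a i ^ 2 / 4)) ^ k i * (c⁻¹) ^ k i := by
      intro i; rw [← mul_pow]; congr 1; field_simp
    have e3 : ∏ i, (-(a i ^ 2 / (4 * c))) ^ k i =
        (∏ i, (-(a i ^ 2 / 4)) ^ k i) * (c ^ ∑ i, k i)⁻¹ := by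
      simp_rw [e2]
      rw [Finset.prod_mul_distrib, Finset.prod_pow_eq_pow_sum, inv_pow]
    have e4 : C k = 1 / (∏ i, pochhammer (b i) (k i) * ((k i).factorial : ℝ)) *
        ∏ i, (-(a i ^ 2 / 4)) ^ k i := by
      simp_rw [C]
      rw [Finset.prod_mul_distrib, Finset.prod_div_distrib, Finset.prod_const_one]
    rw [e3, e4]
    ring
  have hnorm : ∀ k, ∫ x in Set.Ioi (0 : ℝ), ‖F k x‖ =
      |c ^ (-s) * Real.Gamma s * psi2Term s b (fun i => -(a i ^ 2 / (4 * c))) k| := by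
    intro k
    have hK : (0 : ℝ) ≤ (∑ i, k i : ℕ) := Nat.cast_nonneg _
    rw [← hval, abs_mul, abs_of_nonneg (a := c ^ _ * _)
      (mul_nonneg (Real.rpow_nonneg hc.le _) (Real.Gamma_pos_of_pos (by linarith)).le),
      ← integral_rpow_mul_exp_neg_sq (by linarith) hc, ← integral_const_mul]
    refine setIntegral_congr_fun measurableSet_Ioi fun x hx => ?_
    have hx0 : (0 : ℝ) < x := hx
    simp only [hFdef]
    rw [norm_mul, Real.norm_eq_abs, Real.norm_of_nonneg]
    positivity
  have hsum : Summable fun k => ∫ x in Set.Ioi (0 : ℝ), ‖F k x‖ := by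
    simp_rw [hnorm]
    exact ((summable_psi2Term hs.le hb _).mul_left _).abs
  have hlim : ∀ x ∈ Set.Ioi (0 : ℝ), HasSum (fun k => F k x)
      (2 * x ^ (2 * s - 1) * Real.exp (-c * x ^ 2) *
        ∏ i, hyp0F1 (b i) (-((a i * x) ^ 2 / 4))) := by
    intro x hx
    simp_rw [hF0 _ x hx]
    exact (hasSum_pi_prod (fun i => (hasSum_hyp0F1 (hb i) _).summable.abs)
      (fun i => hasSum_hyp0F1 (hb i) _)).2.mul_left _
  have hlim' := (ae_restrict_iff' (μ := volume) measurableSet_Ioi).2 (ae_of_all _ hlim)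
  refine ⟨integrable_of_hasSum hFi hsum hlim', ?_⟩
  have h := hasSum_integral_of_summable_integral_norm hFi hsum
  rw [integral_congr_ae (hlim'.mono fun x hx => hx.tsum_eq)] at h
  rw [← h.tsum_eq, psi2, ← tsum_mul_left]
  refine tsum_congr fun k => ?_
  have hK : (0 : ℝ) ≤ (∑ i, k i : ℕ) := Nat.cast_nonneg _
  simp only [hFdef]
  rw [integral_const_mul, integral_rpow_mul_exp_neg_sq (by linarith) hc, hval]

/-- In one variable `Ψ₂` is Kummer's function. -/
lemma psi2_one_variable (s b x : ℝ) :
    psi2 (n := 1) s (fun _ => b) (fun _ => x) = hyp1F1 s b x := by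
  rw [psi2, ← (Equiv.funUnique (Fin 1) ℕ).symm.tsum_eq, hyp1F1]
  refine tsum_congr fun k => ?_
  simp [psi2Term]
  ring

lemma hyp1F1_one_one (x : ℝ) : hyp1F1 1 1 x = Real.exp x := by
  have := hyp1F1_natCast one_pos x
  simpa using this

/-- The Hankel transform of the Gaussian. -/
lemma integral_mul_exp_mul_besselJ_zero {c : ℝ} (hc : 0 < c) (a : ℝ) :
    IntegrableOn (fun x : ℝ => x * Real.exp (-c * x ^ 2) * besselJ 0 (a * x)) (Set.Ioi 0) ∧
    ∫ x in Set.Ioi (0 : ℝ), x * Real.exp (-c * x ^ 2) * besselJ 0 (a * x) =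
      (2 * c)⁻¹ * Real.exp (-(a ^ 2 / (4 * c))) := by
  have h := integral_prod_hyp0F1 (n := 1) one_pos hc (b := fun _ => 1) (fun _ => le_rfl)
    (fun _ => a)
  simp only [Finset.univ_unique, Finset.prod_singleton, psi2_one_variable, hyp1F1_one_one,
    ← besselJ_zero_eq, Real.Gamma_one, mul_one] at h
  norm_num at h
  have e : (fun x : ℝ => x * Real.exp (-c * x ^ 2) * besselJ 0 (a * x)) =
      fun x => 2⁻¹ * (2 * x * Real.exp (-(c * x ^ 2)) * besselJ 0 (a * x)) := by
    funext x; ring_nf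
  rw [e]
  refine ⟨h.1.const_mul _, ?_⟩
  rw [integral_const_mul, h.2, Real.rpow_neg_one]
  ring_nf

/-- The characteristic function of a Nakagami amplitude with uniform phase. -/
lemma integral_nakagami_besselJ_zero {m w : ℝ} (hm : 0 < m) (hw : 0 < w) (ν : ℝ) :
    ∫ x in Set.Ioi (0 : ℝ), nakagamiDensity m w x * besselJ 0 (ν * x) =
      hyp1F1 m 1 (-(w / (4 * m) * ν ^ 2)) := by
  have hc : 0 < m / w := by positivity
  have h := integral_prod_hyp0F1 (n := 1) hm hc (b := fun _ => 1) (fun _ => le_rfl) (fun _ => ν)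
  simp only [Finset.univ_unique, Finset.prod_singleton, psi2_one_variable,
    ← besselJ_zero_eq] at h
  have e : ∀ x ∈ Set.Ioi (0 : ℝ), nakagamiDensity m w x * besselJ 0 (ν * x) =
      ((Real.Gamma m)⁻¹ * (m / w) ^ m) *
        (2 * x ^ (2 * m - 1) * Real.exp (-(m / w) * x ^ 2) * besselJ 0 (ν * x)) := by
    intro x hx
    rw [nakagamiDensity, if_pos (show 0 < x from hx)]; ring
  rw [setIntegral_congr_fun measurableSet_Ioi e, integral_const_mul, h.2, Real.rpow_neg hc.le]
  have h1 := (Real.Gamma_pos_of_pos hm).ne'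
  have h2 := (Real.rpow_pos_of_pos hc m).ne'
  field_simp

/-! ### Asymptotics of `J₀` and `J₁` -/

/-- A function whose derivative is `O(x^{-p-1})` converges at infinity at the rate `x^{-p}`. -/
lemma exists_abs_sub_le_of_deriv_le {f f' : ℝ → ℝ} {K p : ℝ} (hp : 0 < p)
    (hf : ∀ x, 1 ≤ x → HasDerivAt f (f' x) x)
    (hb : ∀ x, 1 ≤ x → |f' x| ≤ K * p * x ^ (-p - 1)) :
    ∃ l, ∀ x, 1 ≤ x → |f x - l| ≤ K * x ^ (-p) := by
  have hd : ∀ x : ℝ, 1 ≤ x → HasDerivAt (fun x => K * x ^ (-p)) (-(K * p * x ^ (-p - 1))) x := by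
    intro x hx
    refine ((Real.hasDerivAt_rpow_const (Or.inl (by linarith : x ≠ 0))).const_mul K).congr_deriv ?_
    ring
  have hint : interior (Set.Ici (1 : ℝ)) = Set.Ioi 1 := interior_Ici
  have hm : MonotoneOn (fun x => f x - K * x ^ (-p)) (Set.Ici 1) := by
    refine monotoneOn_of_deriv_nonneg (convex_Ici 1) (fun x hx => ?_) (fun x hx => ?_)
      fun x hx => ?_
    · exact ((hf x hx).sub (hd x hx)).continuousAt.continuousWithinAt
    · rw [hint] at hx
      exact ((hf x hx.le).sub (hd x hx.le)).differentiableAt.differentiableWithinAt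
    · rw [hint] at hx
      rw [((hf x hx.le).fun_sub (hd x hx.le)).deriv]
      linarith [(abs_le.1 (hb x hx.le)).1]
  have ha : AntitoneOn (fun x => f x + K * x ^ (-p)) (Set.Ici 1) := by
    refine antitoneOn_of_deriv_nonpos (convex_Ici 1) (fun x hx => ?_) (fun x hx => ?_)
      fun x hx => ?_
    · exact ((hf x hx).add (hd x hx)).continuousAt.continuousWithinAt
    · rw [hint] at hx
      exact ((hf x hx.le).add (hd x hx.le)).differentiableAt.differentiableWithinAt
    · rw [hint] at hx
      rw [((hf x hx.le).fun_add (hd x hx.le)).deriv]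
      linarith [(abs_le.1 (hb x hx.le)).2]
  have hK : 0 ≤ K := by
    have h := (abs_nonneg _).trans (hb 1 le_rfl)
    rw [Real.one_rpow, mul_one] at h
    exact nonneg_of_mul_nonneg_left h hp
  have key : ∀ x y : ℝ, 1 ≤ x → 1 ≤ y → f y - K * y ^ (-p) ≤ f x + K * x ^ (-p) := by
    intro x y hx hy
    have h1 := hm (Set.mem_Ici.2 hy) (Set.mem_Ici.2 (hy.trans (le_max_right x y)))
      (le_max_right x y)
    have h2 := ha (Set.mem_Ici.2 hx) (Set.mem_Ici.2 (hx.trans (le_max_left x y)))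
      (le_max_left x y)
    have h3 : 0 ≤ K * (max x y) ^ (-p) := by
      have : 0 ≤ max x y := by positivity
      positivity
    simp only at h1 h2
    linarith
  have hbdd : BddAbove (Set.range fun y : Set.Ici (1 : ℝ) => f y - K * (y : ℝ) ^ (-p)) :=
    ⟨f 1 + K * 1 ^ (-p), by rintro _ ⟨y, rfl⟩; exact key 1 y le_rfl y.2⟩
  have : Nonempty (Set.Ici (1 : ℝ)) := ⟨⟨1, Set.self_mem_Ici⟩⟩
  refine ⟨⨆ y : Set.Ici (1 : ℝ), (f y - K * (y : ℝ) ^ (-p)), fun x hx => ?_⟩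
  have h1 := le_ciSup hbdd ⟨x, hx⟩
  have h2 : ⨆ y : Set.Ici (1 : ℝ), (f y - K * (y : ℝ) ^ (-p)) ≤ f x + K * x ^ (-p) :=
    ciSup_le fun y => key x y hx y.2
  simp only at h1
  rw [abs_le]
  constructor <;> linarith

lemma integral_mul_besselJ_zero (a b ν : ℝ) :
    ∫ r in a..b, r * ν * besselJ 0 (r * ν) = b * besselJ 1 (b * ν) - a * besselJ 1 (a * ν) := by
  rcases eq_or_ne ν 0 with rfl | hν
  · simp [besselJ]
  have hd : ∀ r ∈ Set.uIcc a b, HasDerivAt (fun r => ν⁻¹ * (r * ν * besselJ 1 (r * ν)))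
      (r * ν * besselJ 0 (r * ν)) r := by
    intro r _
    have h := ((hasDerivAt_mul_besselJ_one (r * ν)).comp r (hasDerivAt_mul_const ν)).const_mul ν⁻¹
    refine h.congr_deriv ?_
    field_simp
  rw [intervalIntegral.integral_eq_sub_of_hasDerivAt hd
    ((by fun_prop : Continuous _).intervalIntegrable _ _)]
  field_simp

lemma abs_besselJ_one_le (x : ℝ) : |besselJ 1 x| ≤ |x| := by
  have h := integral_mul_besselJ_zero 0 1 x
  simp only [one_mul, zero_mul, sub_zero] at h
  rw [← h]
  have := intervalIntegral.norm_integral_le_of_norm_le_const (a := 0) (b := 1)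
    (f := fun r => r * x * besselJ 0 (r * x)) (C := |x|) (fun r hr => by
      rw [Set.uIoc_of_le zero_le_one] at hr
      rw [norm_mul, norm_mul, Real.norm_of_nonneg hr.1.le, Real.norm_eq_abs, Real.norm_eq_abs]
      have := abs_besselJ_zero_le (r * x)
      calc r * |x| * |besselJ 0 (r * x)| ≤ 1 * |x| * 1 := by gcongr; exact hr.2
        _ = |x| := by ring)
  simpa using this

/-- The leading asymptotics of `J₀` and `J₁`. Here `u = √x J₀` solves `u'' = -(1 + 1/(4x²)) u`; its
energy `u² + u'²` stays bounded, so `(u, u')` follows a rotation up to an error `O(1/x)`. The values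
of the amplitude and phase (`√(2/π)` and `π/4`) play no role below. -/
lemma exists_besselJ_asymptotics : ∃ A φ C : ℝ, 0 ≤ C ∧ ∀ x : ℝ, 0 < x →
    |besselJ 0 x - A * Real.cos (x - φ) * x ^ (-(1 / 2) : ℝ)| ≤ C * x ^ (-(3 / 2) : ℝ) ∧
    |besselJ 1 x - A * Real.sin (x - φ) * x ^ (-(1 / 2) : ℝ)| ≤ C * x ^ (-(3 / 2) : ℝ) := by
  set u : ℝ → ℝ := fun x => √x * besselJ 0 x with hu
  set v : ℝ → ℝ := fun x => u x / (2 * x) - √x * besselJ 1 x with hv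
  have hud : ∀ x, 1 ≤ x → HasDerivAt u (v x) x := by
    intro x hx
    have hx0 : 0 < x := by linarith
    refine ((Real.hasDerivAt_sqrt hx0.ne').mul (hasDerivAt_besselJ_zero x)).congr_deriv ?_
    have h1 := Real.mul_self_sqrt hx0.le
    have h2 : √x ≠ 0 := (Real.sqrt_pos.2 hx0).ne'
    simp only [hv, hu]
    field_simp
    rw [Real.sq_sqrt hx0.le]
    ring
  have hvd : ∀ x, 1 ≤ x → HasDerivAt v (-u x - u x / (4 * x ^ 2)) x := by
    intro x hx
    have hx0 : 0 < x := by linarith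
    have h2 : √x ≠ 0 := (Real.sqrt_pos.2 hx0).ne'
    refine (((hud x hx).div ((hasDerivAt_id x).const_mul 2) (by simp; positivity)).sub
      ((Real.hasDerivAt_sqrt hx0.ne').mul (hasDerivAt_besselJ_one hx0.ne'))).congr_deriv ?_
    simp only [hv, hu, id]
    field_simp
    rw [Real.sq_sqrt hx0.le]
    ring
  set E : ℝ → ℝ := fun x => u x ^ 2 + v x ^ 2
  set B : ℝ := √(E 1 * Real.exp (1 / 4))
  have hE : ∀ x, 1 ≤ x → E x ≤ E 1 * Real.exp (1 / 4) := by
    intro x hx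
    have hdE : ∀ x, 1 ≤ x → HasDerivAt (fun x => E x * Real.exp (1 / 4 * x⁻¹))
        (-(u x * v x / (2 * x ^ 2) + E x / (4 * x ^ 2)) * Real.exp (1 / 4 * x⁻¹)) x := by
      intro x hx
      have hx0 : x ≠ 0 := by linarith
      have h1 := (((hud x hx).pow 2).add ((hvd x hx).pow 2)).mul
        (((hasDerivAt_inv hx0).const_mul (1 / 4)).exp)
      refine h1.congr_deriv ?_
      simp only [E, Pi.add_apply, Pi.pow_apply]
      field_simp
      ring
    have hanti : AntitoneOn (fun x => E x * Real.exp (1 / 4 * x⁻¹)) (Set.Ici 1) := by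
      refine antitoneOn_of_deriv_nonpos (convex_Ici 1)
        (fun x hx => (hdE x hx).continuousAt.continuousWithinAt) (fun x hx => ?_) fun x hx => ?_
      · rw [interior_Ici] at hx
        exact (hdE x hx.le).differentiableAt.differentiableWithinAt
      · rw [interior_Ici] at hx
        rw [(hdE x hx.le).deriv]
        refine mul_nonpos_of_nonpos_of_nonneg (neg_nonpos.2 ?_) (Real.exp_pos _).le
        have hx0 : x ≠ 0 := by have : 1 < x := hx; linarith
        have : u x * v x / (2 * x ^ 2) + E x / (4 * x ^ 2) = (u x + v x) ^ 2 / (4 * x ^ 2) := by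
          simp only [E]; field_simp; ring
        rw [this]; positivity
    have h := hanti Set.self_mem_Ici hx hx
    simp only [inv_one, mul_one] at h
    refine le_trans ?_ h
    have hE0 : 0 ≤ E x := by positivity
    exact le_mul_of_one_le_right hE0 (Real.one_le_exp (by positivity))
  have hB : ∀ x, 1 ≤ x → |u x| ≤ B := fun x hx => by
    refine Real.abs_le_sqrt (le_trans ?_ (hE x hx))
    simp only [E]; nlinarith [sq_nonneg (v x)]
  have hB0 : 0 ≤ B := Real.sqrt_nonneg _
  have hpow : ∀ x : ℝ, 1 ≤ x → x ^ (-1 - 1 : ℝ) = 1 / x ^ 2 := fun x hx => by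
    rw [show (-1 - 1 : ℝ) = -(2 : ℕ) by norm_num, Real.rpow_neg (by linarith), Real.rpow_natCast,
      one_div]
  have hterm : ∀ x s : ℝ, 1 ≤ x → |s| ≤ 1 → |u x * s / (4 * x ^ 2)| ≤
      B / 4 * 1 * x ^ (-1 - 1 : ℝ) := fun x s hx hs => by
    rw [hpow x hx, abs_div, abs_mul, abs_of_pos (by positivity : (0 : ℝ) < 4 * x ^ 2)]
    rw [mul_one, mul_one_div, div_div]
    gcongr
    calc |u x| * |s| ≤ B * 1 := by gcongr; exact hB x hx
      _ = B := mul_one B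
  obtain ⟨α, hα⟩ := exists_abs_sub_le_of_deriv_le (f := fun x => u x * Real.cos x - v x * Real.sin x)
    (f' := fun x => u x * Real.sin x / (4 * x ^ 2)) (K := B / 4) one_pos
    (fun x hx => by
      refine (((hud x hx).mul (Real.hasDerivAt_cos x)).sub
        ((hvd x hx).mul (Real.hasDerivAt_sin x))).congr_deriv ?_
      ring)
    (fun x hx => hterm x _ hx (Real.abs_sin_le_one x))
  obtain ⟨β, hβ⟩ := exists_abs_sub_le_of_deriv_le (f := fun x => u x * Real.sin x + v x * Real.cos x)
    (f' := fun x => u x * (-Real.cos x) / (4 * x ^ 2)) (K := B / 4) one_pos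
    (fun x hx => by
      refine (((hud x hx).mul (Real.hasDerivAt_sin x)).add
        ((hvd x hx).mul (Real.hasDerivAt_cos x))).congr_deriv ?_
      ring)
    (fun x hx => hterm x _ hx (by rw [abs_neg]; exact Real.abs_cos_le_one x))
  set z : ℂ := ⟨α, β⟩
  have hzα : α = ‖z‖ * Real.cos z.arg := (Complex.norm_mul_cos_arg z).symm
  have hzβ : β = ‖z‖ * Real.sin z.arg := (Complex.norm_mul_sin_arg z).symm
  refine ⟨‖z‖, z.arg, B + 1 + ‖z‖, by positivity, fun x hx0 => ?_⟩
  have hsq : x ^ (-(1 / 2) : ℝ) = (√x)⁻¹ := by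
    rw [Real.rpow_neg hx0.le, ← Real.sqrt_eq_rpow]
  rcases lt_or_ge x 1 with hx | hx
  · have h1 : 1 ≤ x ^ (-(3 / 2) : ℝ) := Real.one_le_rpow_of_pos_of_le_one_of_nonpos hx0 hx.le
      (by norm_num)
    have h2 : x ^ (-(1 / 2) : ℝ) ≤ x ^ (-(3 / 2) : ℝ) :=
      Real.rpow_le_rpow_of_exponent_ge hx0 hx.le (by norm_num)
    have h3 : ∀ J s : ℝ, |J| ≤ 1 → |s| ≤ 1 → |J - ‖z‖ * s * x ^ (-(1 / 2) : ℝ)| ≤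
        (B + 1 + ‖z‖) * x ^ (-(3 / 2) : ℝ) := by
      intro J s hJ hs
      calc |J - ‖z‖ * s * x ^ (-(1 / 2) : ℝ)| ≤ |J| + |‖z‖ * s * x ^ (-(1 / 2) : ℝ)| := abs_sub _ _
        _ = |J| + ‖z‖ * |s| * x ^ (-(1 / 2) : ℝ) := by
            rw [abs_mul, abs_mul, abs_norm, abs_of_nonneg (Real.rpow_nonneg hx0.le _)]
        _ ≤ x ^ (-(3 / 2) : ℝ) + ‖z‖ * 1 * x ^ (-(3 / 2) : ℝ) := by
            gcongr; exact hJ.trans h1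
        _ ≤ _ := by
            have : 0 ≤ B * x ^ (-(3 / 2) : ℝ) := by positivity
            linarith
    refine ⟨h3 _ _ (abs_besselJ_zero_le x) (Real.abs_cos_le_one _),
      h3 _ _ ((abs_besselJ_one_le x).trans ?_) (Real.abs_sin_le_one _)⟩
    rw [abs_of_pos hx0]; exact hx.le
  · have hs0 : 0 < √x := Real.sqrt_pos.2 hx0
    have h32 : x ^ (-(3 / 2) : ℝ) = x⁻¹ * (√x)⁻¹ := by
      rw [← hsq, ← Real.rpow_neg_one, ← Real.rpow_add hx0]; norm_num
    have hα' := hα x hx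
    have hβ' := hβ x hx
    rw [Real.rpow_neg_one] at hα' hβ'
    have hcs := Real.sin_sq_add_cos_sq x
    have hx1 : 0 < x⁻¹ := by positivity
    -- rotating back recovers `u` and `v` up to the error of the two limits
    have hrot : ∀ p q c s : ℝ, |p| ≤ B / 4 * x⁻¹ → |q| ≤ B / 4 * x⁻¹ → |c| ≤ 1 → |s| ≤ 1 →
        |p * c + q * s| ≤ B / 2 * x⁻¹ := by
      intro p q c s hp hq hc hs
      calc |p * c + q * s| ≤ |p| * |c| + |q| * |s| := by
            rw [← abs_mul, ← abs_mul]; exact abs_add_le _ _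
        _ ≤ (B / 4 * x⁻¹) * 1 + (B / 4 * x⁻¹) * 1 := by gcongr
        _ = _ := by ring
    have hJ0 : |u x - ‖z‖ * Real.cos (x - z.arg)| ≤ B / 2 * x⁻¹ := by
      have := hrot _ _ (Real.cos x) (Real.sin x) hα' hβ' (Real.abs_cos_le_one x)
        (Real.abs_sin_le_one x)
      convert this using 2
      rw [Real.cos_sub]
      linear_combination (-(u x)) * hcs + Real.cos x * hzα + Real.sin x * hzβ
    have hJ1 : |-v x - ‖z‖ * Real.sin (x - z.arg)| ≤ B / 2 * x⁻¹ := by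
      have := hrot _ _ (Real.sin x) (-Real.cos x) hα' hβ' (Real.abs_sin_le_one x)
        (by rw [abs_neg]; exact Real.abs_cos_le_one x)
      convert this using 2
      rw [Real.sin_sub]
      linear_combination (v x) * hcs + Real.sin x * hzα - Real.cos x * hzβ
    rw [hsq, h32]
    constructor
    · have e : besselJ 0 x - ‖z‖ * Real.cos (x - z.arg) * (√x)⁻¹ =
          (u x - ‖z‖ * Real.cos (x - z.arg)) * (√x)⁻¹ := by
        simp only [hu]; field_simp
      rw [e, abs_mul, abs_of_pos (inv_pos.2 hs0), ← mul_assoc]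
      gcongr
      refine hJ0.trans ?_
      gcongr
      have := norm_nonneg z
      linarith
    · have e : besselJ 1 x - ‖z‖ * Real.sin (x - z.arg) * (√x)⁻¹ =
          ((-v x - ‖z‖ * Real.sin (x - z.arg)) + u x / 2 * x⁻¹) * (√x)⁻¹ := by
        simp only [hv]; field_simp; ring
      rw [e, abs_mul, abs_of_pos (inv_pos.2 hs0), ← mul_assoc]
      gcongr
      calc _ ≤ B / 2 * x⁻¹ + |u x / 2 * x⁻¹| := (abs_add_le _ _).trans (by gcongr)
        _ ≤ B / 2 * x⁻¹ + B / 2 * x⁻¹ := by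
            rw [abs_mul, abs_div, abs_of_pos hx1, abs_two]
            gcongr; exact hB x hx
        _ = B * x⁻¹ := by ring
        _ ≤ _ := by
          gcongr
          have := norm_nonneg z
          linarith

/-! ### Decay of `₁F₁(m; 1; -x)` -/

lemma integrableOn_nakagamiDensity {m w : ℝ} (hm : 0 < m) (hw : 0 < w) :
    IntegrableOn (nakagamiDensity m w) (Set.Ioi 0) := by
  have h := (integrableOn_rpow_mul_exp_neg_mul_sq (b := m / w) (by positivity)
    (s := 2 * m - 1) (by linarith)).const_mul (2 / Real.Gamma m * (m / w) ^ m)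
  refine IntegrableOn.congr_fun h (fun x hx => ?_) measurableSet_Ioi
  rw [nakagamiDensity, if_pos (show 0 < x from hx)]; ring

lemma nakagamiDensity_nonneg {m w : ℝ} (hm : 0 < m) (hw : 0 < w) (x : ℝ) :
    0 ≤ nakagamiDensity m w x := by
  unfold nakagamiDensity
  split_ifs with hx
  · have := Real.Gamma_pos_of_pos hm
    positivity
  · exact le_rfl

@[simp] lemma hyp1F1_zero (m : ℝ) : hyp1F1 m 1 0 = 1 := by
  unfold hyp1F1
  rw [tsum_eq_single 0 (by intro k hk; simp [hk])]
  simp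

lemma integral_nakagamiDensity {m w : ℝ} (hm : 0 < m) (hw : 0 < w) :
    ∫ x in Set.Ioi (0 : ℝ), nakagamiDensity m w x = 1 := by
  have := integral_nakagami_besselJ_zero hm hw 0
  simpa using this

lemma abs_hyp1F1_neg_le_one {m : ℝ} (hm : 0 < m) {x : ℝ} (hx : 0 ≤ x) :
    |hyp1F1 m 1 (-x)| ≤ 1 := by
  have h := integral_nakagami_besselJ_zero hm (w := 4 * m) (by positivity) √x
  rw [Real.sq_sqrt hx, div_self (by positivity), one_mul] at h
  rw [← h, ← integral_nakagamiDensity hm (w := 4 * m) (by positivity)]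
  rw [← Real.norm_eq_abs]
  refine norm_integral_le_of_norm_le (μ := volume.restrict (Set.Ioi 0))
    (integrableOn_nakagamiDensity hm (by positivity)) (ae_of_all _ fun y => ?_)
  rw [norm_mul, Real.norm_of_nonneg (nakagamiDensity_nonneg hm (by positivity) y)]
  exact mul_le_of_le_one_right (nakagamiDensity_nonneg hm (by positivity) y)
    (abs_besselJ_zero_le _)

/-- For `m ≥ 1` the contiguous relation gives decay of order `1/x` from boundedness. -/
lemma abs_hyp1F1_neg_le_inv {m : ℝ} (hm : 1 ≤ m) {x : ℝ} (hx : 0 < x) :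
    |hyp1F1 m 1 (-x)| ≤ (4 * m - 2) * x⁻¹ := by
  have h := mul_hyp1F1 hm (-x)
  have h0 : |(m - 1) * hyp1F1 (m - 1) 1 (-x)| ≤ m - 1 := by
    rcases hm.eq_or_lt with rfl | h1
    · simp
    · rw [abs_mul, abs_of_pos (by linarith)]
      exact mul_le_of_le_one_right (by linarith) (abs_hyp1F1_neg_le_one (by linarith) hx.le)
  have h1 : |(2 * m - 1) * hyp1F1 m 1 (-x)| ≤ 2 * m - 1 := by
    rw [abs_mul, abs_of_pos (by linarith)]
    exact mul_le_of_le_one_right (by linarith) (abs_hyp1F1_neg_le_one (by linarith) hx.le)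
  have h2 : |m * hyp1F1 (m + 1) 1 (-x)| ≤ m := by
    rw [abs_mul, abs_of_pos (by linarith)]
    exact mul_le_of_le_one_right (by linarith) (abs_hyp1F1_neg_le_one (by linarith) hx.le)
  rw [← div_eq_mul_inv, le_div_iff₀ hx, ← abs_of_pos hx, ← abs_mul, abs_of_pos hx]
  rw [abs_le] at h0 h1 h2 ⊢
  constructor <;> linarith

/-- For `m < 1` the function `x ↦ x^m ₁F₁(m; 1; -x)` has the integrable derivative
`m x^(m-1) ₁F₁(m+1; 1; -x)`, hence is bounded. -/
lemma exists_abs_hyp1F1_neg_le {m : ℝ} (hm : 0 < m) (hm1 : m < 1) :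
    ∃ C, 0 ≤ C ∧ ∀ x, 0 < x → |hyp1F1 m 1 (-x)| ≤ C * x ^ (-m) ∧
      |hyp1F1 (m + 1) 1 (-x)| ≤ C * x ^ (-m) := by
  set K : ℝ := m * (4 * m + 2) / (1 - m)
  have hm1' : 0 < 1 - m := by linarith
  have hK : 0 ≤ K := by positivity
  obtain ⟨l, hl⟩ := exists_abs_sub_le_of_deriv_le (f := fun x => x ^ m * hyp1F1 m 1 (-x))
    (f' := fun x => m * x ^ (m - 1) * hyp1F1 (m + 1) 1 (-x)) (K := K) (p := 1 - m) hm1'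
    (fun x hx => by
      have hx0 : 0 < x := by linarith
      have hd := (differentiable_hyp1F1 hm.le (-x)).hasDerivAt.comp x (hasDerivAt_neg x)
      refine ((Real.hasDerivAt_rpow_const (p := m) (Or.inl hx0.ne')).mul hd).congr_deriv ?_
      have h := mul_deriv_hyp1F1 hm.le (-x)
      have e : x ^ m = x ^ (m - 1) * x := by
        rw [Real.rpow_sub_one hx0.ne']; field_simp
      simp only [Function.comp_apply]
      rw [e]
      linear_combination x ^ (m - 1) * h)
    (fun x hx => by
      have hx0 : 0 < x := by linarith
      have h := abs_hyp1F1_neg_le_inv (m := m + 1) (by linarith) hx0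
      rw [abs_mul, abs_mul, abs_of_pos hm, abs_of_pos (Real.rpow_pos_of_pos hx0 _)]
      calc m * x ^ (m - 1) * |hyp1F1 (m + 1) 1 (-x)|
          ≤ m * x ^ (m - 1) * ((4 * (m + 1) - 2) * x⁻¹) := by gcongr
        _ = K * (1 - m) * (x ^ (m - 1) * x⁻¹) := by simp only [K]; field_simp; ring
        _ = _ := by
          rw [← Real.rpow_neg_one x, ← Real.rpow_add hx0]; congr 2; ring)
  set C : ℝ := K + |l| + 1
  have hC : 1 ≤ C := by have := abs_nonneg l; simp only [C]; linarith
  have h1 : ∀ x, 0 < x → |hyp1F1 m 1 (-x)| ≤ C * x ^ (-m) := by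
    intro x hx
    have hxm := Real.rpow_pos_of_pos hx m
    rw [Real.rpow_neg hx.le, ← div_eq_mul_inv, le_div_iff₀ hxm]
    rcases lt_or_ge x 1 with h | h
    · calc |hyp1F1 m 1 (-x)| * x ^ m ≤ 1 * 1 := by
            gcongr
            · exact abs_hyp1F1_neg_le_one hm hx.le
            · exact Real.rpow_le_one hx.le h.le hm.le
        _ ≤ C := by linarith
    · have h2 := hl x h
      have h3 : K * x ^ (-(1 - m)) ≤ K :=
        mul_le_of_le_one_right hK (Real.rpow_le_one_of_one_le_of_nonpos h (by linarith))
      calc |hyp1F1 m 1 (-x)| * x ^ m = |(x ^ m * hyp1F1 m 1 (-x) - l) + l| := by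
            rw [sub_add_cancel, abs_mul, abs_of_pos hxm, mul_comm]
        _ ≤ |x ^ m * hyp1F1 m 1 (-x) - l| + |l| := abs_add_le _ _
        _ ≤ C := by simp only [C]; linarith
  refine ⟨4 * m + 3 + C, by positivity, fun x hx => ⟨(h1 x hx).trans ?_, ?_⟩⟩
  · gcongr
    linarith
  · calc |hyp1F1 (m + 1) 1 (-x)| ≤ (4 * m + 3) * x ^ (-m) := by
          rcases lt_or_ge x 1 with h | h
          · have := Real.one_le_rpow_of_pos_of_le_one_of_nonpos hx h.le (by linarith : -m ≤ 0)
            have := abs_hyp1F1_neg_le_one (m := m + 1) (by linarith) hx.le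
            nlinarith
          · refine (abs_hyp1F1_neg_le_inv (m := m + 1) (by linarith) hx).trans ?_
            rw [← Real.rpow_neg_one]
            refine mul_le_mul (by linarith) ?_ (by positivity) (by linarith)
            exact Real.rpow_le_rpow_of_exponent_le h (by linarith)
      _ ≤ _ := mul_le_mul_of_nonneg_right (by linarith) (Real.rpow_nonneg hx.le _)

/-! ### Oscillatory integrals -/

lemma exists_abs_besselJ_le : ∃ B : ℝ, 0 ≤ B ∧ ∀ x : ℝ, 0 < x →
    |besselJ 0 x| ≤ B * x ^ (-(1 / 2) : ℝ) ∧ |besselJ 1 x| ≤ B * x ^ (-(1 / 2) : ℝ) := by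
  obtain ⟨A, φ, C, hC, h⟩ := exists_besselJ_asymptotics
  refine ⟨|A| + C + 1, by positivity, fun x hx => ?_⟩
  have hp := Real.rpow_pos_of_pos hx (-(1 / 2))
  have key : ∀ J s : ℝ, (x < 1 → |J| ≤ 1) → |s| ≤ 1 →
      |J - A * s * x ^ (-(1 / 2) : ℝ)| ≤ C * x ^ (-(3 / 2) : ℝ) →
      |J| ≤ (|A| + C + 1) * x ^ (-(1 / 2) : ℝ) := by
    intro J s hJ hs h
    rcases lt_or_ge x 1 with h1 | h1
    · have := Real.one_le_rpow_of_pos_of_le_one_of_nonpos hx h1.le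
        (by norm_num : -(1 / 2 : ℝ) ≤ 0)
      have hA := abs_nonneg A
      nlinarith [hJ h1]
    · have h3 : x ^ (-(3 / 2) : ℝ) ≤ x ^ (-(1 / 2) : ℝ) :=
        Real.rpow_le_rpow_of_exponent_le h1 (by norm_num)
      calc |J| = |(J - A * s * x ^ (-(1 / 2) : ℝ)) + A * s * x ^ (-(1 / 2) : ℝ)| := by
            rw [sub_add_cancel]
        _ ≤ C * x ^ (-(3 / 2) : ℝ) + |A * s * x ^ (-(1 / 2) : ℝ)| :=
            (abs_add_le _ _).trans (by gcongr)
        _ = C * x ^ (-(3 / 2) : ℝ) + |A| * |s| * x ^ (-(1 / 2) : ℝ) := by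
            rw [abs_mul, abs_mul, abs_of_pos hp]
        _ ≤ C * x ^ (-(1 / 2) : ℝ) + |A| * 1 * x ^ (-(1 / 2) : ℝ) := by gcongr
        _ ≤ _ := by linarith
  refine ⟨key _ _ (fun _ => abs_besselJ_zero_le x) (Real.abs_cos_le_one _) (h x hx).1,
    key _ _ (fun h1 => (abs_besselJ_one_le x).trans ?_) (Real.abs_sin_le_one _) (h x hx).2⟩
  rw [abs_of_pos hx]; exact h1.le

/-- The integrals of `g` over `[S, T]` are at most `C S^(-q)` for `1 ≤ S ≤ T`; a quantitative
Cauchy criterion for the improper integral of `g`. -/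
def TailBound (g : ℝ → ℝ) (C q : ℝ) : Prop :=
  ∀ S T : ℝ, 1 ≤ S → S ≤ T → |∫ ν in S..T, g ν| ≤ C * S ^ (-q)

lemma integral_rpow_le {q S T : ℝ} (hq : 0 < q) (hS : 1 ≤ S) (hT : S ≤ T) :
    ∫ ν in S..T, ν ^ (-q - 1) ≤ S ^ (-q) / q := by
  have hS0 : 0 < S := by linarith
  have hT0 : 0 < T := by linarith
  rw [integral_rpow (Or.inr ⟨by linarith, by
    rw [Set.uIcc_of_le hT]; exact fun h => by linarith [h.1]⟩)]
  rw [show -q - 1 + 1 = -q by ring, div_neg, ← neg_div, neg_sub]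
  gcongr
  have := Real.rpow_nonneg hT0.le (-q)
  linarith

lemma tailBound_of_abs_le {g : ℝ → ℝ} {K q : ℝ} (hq : 0 < q)
    (hg : ∀ ν, 1 ≤ ν → |g ν| ≤ K * ν ^ (-q - 1)) : TailBound g (K / q) q := by
  intro S T hS hT
  have hK : 0 ≤ K := by
    have := (abs_nonneg _).trans (hg 1 le_rfl); simpa using this
  have hint : IntervalIntegrable (fun ν : ℝ => K * ν ^ (-q - 1)) volume S T := by
    refine ContinuousOn.intervalIntegrable fun x hx => ?_
    rw [Set.uIcc_of_le hT] at hx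
    have : x ≠ 0 := by linarith [hx.1]
    exact (continuousAt_const.mul
      (Real.continuousAt_rpow_const x _ (Or.inl this))).continuousWithinAt
  calc |∫ ν in S..T, g ν| ≤ ∫ ν in S..T, K * ν ^ (-q - 1) := by
        rw [← Real.norm_eq_abs]
        exact intervalIntegral.norm_integral_le_of_norm_le hT
          (ae_of_all _ fun ν hν => hg ν (hS.trans hν.1.le)) hint
    _ ≤ K * (S ^ (-q) / q) := by
        rw [intervalIntegral.integral_const_mul]
        gcongr
        exact integral_rpow_le hq hS hT
    _ = _ := by ring

lemma TailBound.exists_hasImproperIntegral {g : ℝ → ℝ} {C q : ℝ} (h : TailBound g C q)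
    (hq : 0 < q) (hg : Continuous g) : ∃ L, HasImproperIntegral g L := by
  have hi : ∀ a b, IntervalIntegrable g volume a b := fun a b => hg.intervalIntegrable a b
  have hc : CauchySeq fun T : ℝ => ∫ ν in (0 : ℝ)..T, g ν := by
    refine Metric.cauchySeq_iff'.2 fun ε hε => ?_
    have ht : Tendsto (fun S : ℝ => C * S ^ (-q)) atTop (𝓝 0) := by
      simpa using (tendsto_rpow_neg_atTop hq).const_mul C
    obtain ⟨S, hS1, hS⟩ := ((eventually_ge_atTop (1 : ℝ)).and
      (ht.eventually (gt_mem_nhds hε))).exists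
    refine ⟨S, fun T hT => ?_⟩
    rw [Real.dist_eq, intervalIntegral.integral_interval_sub_left (hi _ _) (hi _ _)]
    exact (h S T hS1 hT).trans_lt hS
  obtain ⟨L, hL⟩ := cauchySeq_tendsto_of_complete hc
  exact ⟨L, fun T _ => hi 0 T, hL⟩

lemma TailBound.abs_integral_le {g : ℝ → ℝ} {C q D : ℝ} (h : TailBound g C q)
    (hC : 0 ≤ C) (hg : Continuous g) (hD : ∀ ν ∈ Set.Icc (0 : ℝ) 1, |g ν| ≤ D) {T : ℝ}
    (hT : 0 ≤ T) : |∫ ν in (0 : ℝ)..T, g ν| ≤ D + C := by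
  have hD0 : 0 ≤ D := (abs_nonneg _).trans (hD 0 (by simp))
  have h1 : ∀ T, 0 ≤ T → T ≤ 1 → |∫ ν in (0 : ℝ)..T, g ν| ≤ D := by
    intro T hT hT1
    rw [← Real.norm_eq_abs]
    refine (intervalIntegral.norm_integral_le_of_norm_le_const (C := D) fun ν hν => ?_).trans ?_
    · rw [Set.uIoc_of_le hT] at hν
      exact hD ν ⟨hν.1.le, hν.2.trans hT1⟩
    · rw [sub_zero, abs_of_nonneg hT]
      exact mul_le_of_le_one_right hD0 hT1
  rcases le_total T 1 with hT1 | hT1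
  · linarith [h1 T hT hT1]
  · rw [← intervalIntegral.integral_add_adjacent_intervals (hg.intervalIntegrable 0 1)
      (hg.intervalIntegrable 1 T)]
    have h2 := h 1 T le_rfl hT1
    rw [Real.one_rpow, mul_one] at h2
    exact (abs_add_le _ _).trans (add_le_add (h1 1 zero_le_one le_rfl) h2)

/-- Integration by parts against a pure oscillation. -/
lemma tailBound_mul_cos {G G' : ℝ → ℝ} {K a : ℝ} (ha : 0 < a)
    (hG : ∀ ν, 1 ≤ ν → HasDerivAt G (G' ν) ν) (hG' : ContinuousOn G' (Set.Ici 1))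
    (hb : ∀ ν, 1 ≤ ν → |G ν| ≤ K * ν ^ (-a)) (hb' : ∀ ν, 1 ≤ ν → |G' ν| ≤ K * ν ^ (-a - 1))
    {ω δ : ℝ} (hδ : 0 < δ) (hω : δ ≤ |ω|) (θ : ℝ) :
    TailBound (fun ν => G ν * Real.cos (ω * ν + θ)) ((2 * K + K / a) / δ) a := by
  intro S T hS hT
  have hω0 : ω ≠ 0 := abs_pos.1 (hδ.trans_le hω)
  have hS0 : 0 < S := by linarith
  have hK : 0 ≤ K := by
    have := (abs_nonneg _).trans (hb 1 le_rfl); simpa using this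
  have hsub : Set.uIcc S T ⊆ Set.Ici 1 := by
    rw [Set.uIcc_of_le hT]; exact fun x hx => hS.trans hx.1
  have hv : ∀ ν ∈ Set.uIcc S T, HasDerivAt (fun ν => Real.sin (ω * ν + θ) / ω)
      (Real.cos (ω * ν + θ)) ν := by
    intro ν _
    have := (((hasDerivAt_id ν).const_mul ω).add_const θ).sin.div_const ω
    refine this.congr_deriv ?_
    simp only [id]; field_simp
  have hparts := intervalIntegral.integral_mul_deriv_eq_deriv_mul
    (fun ν hν => hG ν (hsub hν)) hv (hG'.mono hsub).intervalIntegrable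
    ((by fun_prop : Continuous fun ν => Real.cos (ω * ν + θ)).intervalIntegrable _ _)
  have hsin : ∀ x : ℝ, |Real.sin x / ω| ≤ 1 / δ := by
    intro x
    rw [abs_div]
    gcongr
    exact Real.abs_sin_le_one x
  have hend : ∀ ν, S ≤ ν → |G ν * (Real.sin (ω * ν + θ) / ω)| ≤ K * S ^ (-a) * (1 / δ) := by
    intro ν hν
    rw [abs_mul]
    refine mul_le_mul ((hb ν (hS.trans hν)).trans ?_) (hsin _) (abs_nonneg _) (by positivity)
    exact mul_le_mul_of_nonneg_left (Real.rpow_le_rpow_of_nonpos hS0 hν (by linarith)) hK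
  have hint : |∫ ν in S..T, G' ν * (Real.sin (ω * ν + θ) / ω)| ≤ K * (1 / δ) / a * S ^ (-a) := by
    refine tailBound_of_abs_le (K := K * (1 / δ)) ha (fun ν hν => ?_) S T hS hT
    rw [abs_mul]
    calc |G' ν| * |Real.sin (ω * ν + θ) / ω| ≤ (K * ν ^ (-a - 1)) * (1 / δ) := by
          have := Real.rpow_nonneg (by linarith : 0 ≤ ν) (-a - 1)
          exact mul_le_mul (hb' ν hν) (hsin _) (abs_nonneg _) (by positivity)
      _ = _ := by ring
  rw [hparts]
  calc _ ≤ |G T * (Real.sin (ω * T + θ) / ω)| + |G S * (Real.sin (ω * S + θ) / ω)| +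
        |∫ ν in S..T, G' ν * (Real.sin (ω * ν + θ) / ω)| :=
        (abs_sub _ _).trans (by gcongr; exact abs_sub _ _)
    _ ≤ K * S ^ (-a) * (1 / δ) + K * S ^ (-a) * (1 / δ) + K * (1 / δ) / a * S ^ (-a) := by
        gcongr
        · exact hend T hT
        · exact hend S le_rfl
    _ = _ := by ring

/-- Replacing a Bessel-type factor `J(rν)` by its leading term `A cos(rν - φ) (rν)^(-1/2)` shifts
the frequency by `±r` and leaves an absolutely integrable error. -/
lemma tailBound_mul_kernel {H J : ℝ → ℝ} {K b M A φ C r ω θ : ℝ} (hq : 0 < b + 1 / 2) (hr : 0 < r)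
    (hC : 0 ≤ C) (hH : ContinuousOn H (Set.Ici 1)) (hHb : ∀ ν, 1 ≤ ν → |H ν| ≤ K * ν ^ (-b))
    (hJc : Continuous J)
    (hJ : ∀ x, 0 < x → |J x - A * Real.cos (x - φ) * x ^ (-(1 / 2) : ℝ)| ≤ C * x ^ (-(3 / 2) : ℝ))
    (hM : ∀ σ : ℝ, (σ = 1 ∨ σ = -1) → ∀ θ', TailBound
      (fun ν => H ν * ν ^ (-(1 / 2) : ℝ) * Real.cos ((ω + σ * r) * ν + θ')) M (b + 1 / 2)) :
    TailBound (fun ν => H ν * J (r * ν) * Real.cos (ω * ν + θ))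
      (|A| * r ^ (-(1 / 2) : ℝ) * M + C * r ^ (-(3 / 2) : ℝ) * K / (b + 1 / 2)) (b + 1 / 2) := by
  intro S T hS hT
  have hS0 : 0 < S := by linarith
  have hsub : Set.uIcc S T ⊆ Set.Ici 1 := by
    rw [Set.uIcc_of_le hT]; exact fun x hx => hS.trans hx.1
  have hHc := hH.mono hsub
  have hpc : ContinuousOn (fun ν : ℝ => ν ^ (-(1 / 2) : ℝ)) (Set.uIcc S T) := fun x hx =>
    (Real.continuousAt_rpow_const x _ (Or.inl (by have := hsub hx; simp at this; linarith)))
      |>.continuousWithinAt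
  set m : ℝ → ℝ → ℝ := fun σ ν => H ν * ν ^ (-(1 / 2) : ℝ) *
    Real.cos ((ω + σ * r) * ν + (θ - σ * φ))
  set e : ℝ → ℝ := fun ν => H ν * (J (r * ν) - A * Real.cos (r * ν - φ) *
    (r ^ (-(1 / 2) : ℝ) * ν ^ (-(1 / 2) : ℝ))) * Real.cos (ω * ν + θ) with he
  have hmc : ∀ σ, IntervalIntegrable (m σ) volume S T := fun σ =>
    ((hHc.mul hpc).mul (by fun_prop : Continuous fun ν : ℝ =>
      Real.cos ((ω + σ * r) * ν + (θ - σ * φ))).continuousOn).intervalIntegrable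
  have hec : IntervalIntegrable e volume S T := by
    refine ContinuousOn.intervalIntegrable ?_
    refine (hHc.mul (ContinuousOn.sub (by fun_prop) ?_)).mul (by fun_prop)
    exact ContinuousOn.mul (by fun_prop) (continuousOn_const.mul hpc)
  have hdec : ∀ ν ∈ Set.uIcc S T, H ν * J (r * ν) * Real.cos (ω * ν + θ) =
      A * r ^ (-(1 / 2) : ℝ) / 2 * (m 1 ν + m (-1) ν) + e ν := by
    intro ν _
    have h1 : Real.cos (r * ν - φ) * Real.cos (ω * ν + θ) =
        (Real.cos ((ω + 1 * r) * ν + (θ - 1 * φ)) +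
          Real.cos ((ω + -1 * r) * ν + (θ - -1 * φ))) / 2 := by
      rw [show (ω + 1 * r) * ν + (θ - 1 * φ) = (ω * ν + θ) + (r * ν - φ) by ring,
        show (ω + -1 * r) * ν + (θ - -1 * φ) = (ω * ν + θ) - (r * ν - φ) by ring,
        Real.cos_add (ω * ν + θ), Real.cos_sub (ω * ν + θ)]
      ring
    simp only [m, he]
    linear_combination (H ν * A * r ^ (-(1 / 2) : ℝ) * ν ^ (-(1 / 2) : ℝ)) * h1
  rw [intervalIntegral.integral_congr hdec, intervalIntegral.integral_add
    (((hmc 1).add (hmc (-1))).const_mul _) hec, intervalIntegral.integral_const_mul,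
    intervalIntegral.integral_add (hmc 1) (hmc (-1))]
  have he' : |∫ ν in S..T, e ν| ≤ C * r ^ (-(3 / 2) : ℝ) * K / (b + 1 / 2) * S ^ (-(b + 1 / 2)) := by
    refine tailBound_of_abs_le hq (fun ν hν => ?_) S T hS hT
    have hν0 : 0 < ν := by linarith
    have h1 := hJ (r * ν) (by positivity)
    rw [Real.mul_rpow hr.le hν0.le, Real.mul_rpow hr.le hν0.le] at h1
    simp only [he]
    rw [abs_mul, abs_mul]
    calc |H ν| * _ * |Real.cos (ω * ν + θ)| ≤
          (K * ν ^ (-b)) * (C * (r ^ (-(3 / 2) : ℝ) * ν ^ (-(3 / 2) : ℝ))) * 1 := by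
          have h2 := hHb ν hν
          have h3 := (abs_nonneg _).trans h2
          gcongr
          exact Real.abs_cos_le_one _
      _ = C * r ^ (-(3 / 2) : ℝ) * K * (ν ^ (-b) * ν ^ (-(3 / 2) : ℝ)) := by ring
      _ = _ := by rw [← Real.rpow_add hν0]; congr 2; ring
  have h1 := hM 1 (Or.inl rfl) (θ - 1 * φ) S T hS hT
  have h2 := hM (-1) (Or.inr rfl) (θ - -1 * φ) S T hS hT
  have hr2 := Real.rpow_pos_of_pos hr (-(1 / 2))
  calc _ ≤ |A * r ^ (-(1 / 2) : ℝ) / 2 * ((∫ ν in S..T, m 1 ν) + ∫ ν in S..T, m (-1) ν)| +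
        |∫ ν in S..T, e ν| := abs_add_le _ _
    _ ≤ |A| * r ^ (-(1 / 2) : ℝ) / 2 * (M * S ^ (-(b + 1 / 2)) + M * S ^ (-(b + 1 / 2))) +
        C * r ^ (-(3 / 2) : ℝ) * K / (b + 1 / 2) * S ^ (-(b + 1 / 2)) := by
        rw [abs_mul, abs_div, abs_mul, abs_of_pos hr2, abs_two]
        gcongr
        exact (abs_add_le _ _).trans (add_le_add h1 h2)
    _ = _ := by ring

lemma abs_prod_besselJ_zero_le {ι : Type*} {V : ι → ℝ} (s : Finset ι) (hV : ∀ i ∈ s, 0 < V i) :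
    ∃ B, 0 ≤ B ∧ ∀ ν, 0 < ν →
      |∏ i ∈ s, besselJ 0 (V i * ν)| ≤ B * ν ^ (-(s.card / 2 : ℝ)) := by
  obtain ⟨B, hB, h⟩ := exists_abs_besselJ_le
  have hnn : ∀ i ∈ s, 0 ≤ B * V i ^ (-(1 / 2) : ℝ) := fun i hi =>
    mul_nonneg hB (Real.rpow_nonneg (hV i hi).le _)
  refine ⟨∏ i ∈ s, (B * V i ^ (-(1 / 2) : ℝ)), Finset.prod_nonneg hnn, fun ν hν => ?_⟩
  rw [Finset.abs_prod]
  calc ∏ i ∈ s, |besselJ 0 (V i * ν)|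
      ≤ ∏ i ∈ s, (B * V i ^ (-(1 / 2) : ℝ) * ν ^ (-(1 / 2) : ℝ)) := by
        refine Finset.prod_le_prod (fun _ _ => abs_nonneg _) fun i hi => ?_
        have := (h (V i * ν) (mul_pos (hV i hi) hν)).1
        rwa [Real.mul_rpow (hV i hi).le hν.le, ← mul_assoc] at this
    _ = _ := by
        rw [Finset.prod_mul_distrib, Finset.prod_const, ← Real.rpow_natCast,
          ← Real.rpow_mul hν.le]
        congr 2; ring

/-- A slowly varying decaying amplitude times a product of functions `J₀(Vᵢ ν)` times
`cos(ων + θ)` has a convergent integral, uniformly in `(ω, θ)` as long as no combination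
`ω ± V₁ ± ⋯ ± Vₙ` of the frequencies comes near zero. -/
lemma exists_tailBound_prod_besselJ {ι : Type*} {V : ι → ℝ} (s : Finset ι)
    (hV : ∀ i ∈ s, 0 < V i) {δ : ℝ} (hδ : 0 < δ) :
    ∀ {G G' : ℝ → ℝ} {K a : ℝ}, 0 < a + s.card / 2 →
    (∀ ν, 1 ≤ ν → HasDerivAt G (G' ν) ν) → ContinuousOn G' (Set.Ici 1) →
    (∀ ν, 1 ≤ ν → |G ν| ≤ K * ν ^ (-a)) → (∀ ν, 1 ≤ ν → |G' ν| ≤ K * ν ^ (-a - 1)) →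
    ∃ C, 0 ≤ C ∧ ∀ ω θ : ℝ,
      (∀ ε : ι → ℝ, (∀ i, ε i = 1 ∨ ε i = -1) → δ ≤ |ω + ∑ i ∈ s, ε i * V i|) →
      TailBound (fun ν => G ν * (∏ i ∈ s, besselJ 0 (V i * ν)) * Real.cos (ω * ν + θ)) C
        (a + s.card / 2) := by
  classical
  induction s using Finset.induction_on with
  | empty =>
    intro G G' K a ha hG hG' hb hb'
    have hK : 0 ≤ K := by
      have := (abs_nonneg _).trans (hb 1 le_rfl); simpa using this
    simp only [Finset.card_empty, Nat.cast_zero, zero_div, add_zero] at ha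
    refine ⟨(2 * K + K / a) / δ, by positivity, fun ω θ h => ?_⟩
    have h1 := h (fun _ => 1) (fun _ => Or.inl rfl)
    simp only [Finset.sum_empty, add_zero] at h1
    simpa using tailBound_mul_cos ha hG hG' hb hb' hδ h1 θ
  | insert j s hj ih =>
    intro G G' K a ha hG hG' hb hb'
    have hVj : 0 < V j := hV j (Finset.mem_insert_self j s)
    have hVs : ∀ i ∈ s, 0 < V i := fun i hi => hV i (Finset.mem_insert_of_mem hi)
    have hK : 0 ≤ K := by
      have := (abs_nonneg _).trans (hb 1 le_rfl); simpa using this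
    rw [Finset.card_insert_of_notMem hj] at ha ⊢
    push_cast at ha ⊢
    have hG1 : ∀ ν, 1 ≤ ν → HasDerivAt (fun ν => G ν * ν ^ (-(1 / 2) : ℝ))
        (G' ν * ν ^ (-(1 / 2) : ℝ) + G ν * (-(1 / 2) * ν ^ (-(1 / 2) - 1 : ℝ))) ν := fun ν hν =>
      (hG ν hν).mul (Real.hasDerivAt_rpow_const (Or.inl (by linarith : ν ≠ 0)))
    have hGc : ContinuousOn G (Set.Ici 1) := fun ν hν => (hG ν hν).continuousAt.continuousWithinAt
    have hpc : ∀ p : ℝ, ContinuousOn (fun ν : ℝ => ν ^ p) (Set.Ici 1) := fun p x hx =>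
      (Real.continuousAt_rpow_const x _ (Or.inl (by have : 1 ≤ x := hx; linarith)))
        |>.continuousWithinAt
    obtain ⟨C, hC, h⟩ := ih hVs (K := K + K) (a := a + 1 / 2) (by linarith) hG1
      ((hG'.mul (hpc _)).add (hGc.mul (continuousOn_const.mul (hpc _))))
      (fun ν hν => by
        have hν0 : 0 < ν := by linarith
        rw [abs_mul, abs_of_pos (Real.rpow_pos_of_pos hν0 _)]
        calc |G ν| * ν ^ (-(1 / 2) : ℝ) ≤ (K * ν ^ (-a)) * ν ^ (-(1 / 2) : ℝ) := by
              gcongr; exact hb ν hν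
          _ = K * ν ^ (-(a + 1 / 2)) := by
              rw [mul_assoc, ← Real.rpow_add hν0]; congr 2; ring
          _ ≤ _ := by gcongr; linarith)
      (fun ν hν => by
        have hν0 : 0 < ν := by linarith
        have h1 : |G' ν * ν ^ (-(1 / 2) : ℝ)| ≤ K * ν ^ (-(a + 1 / 2) - 1) := by
          rw [abs_mul, abs_of_pos (Real.rpow_pos_of_pos hν0 _)]
          calc |G' ν| * ν ^ (-(1 / 2) : ℝ) ≤ (K * ν ^ (-a - 1)) * ν ^ (-(1 / 2) : ℝ) := by
                gcongr; exact hb' ν hν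
            _ = _ := by rw [mul_assoc, ← Real.rpow_add hν0]; congr 2; ring
        have h2 : |G ν * (-(1 / 2) * ν ^ (-(1 / 2) - 1 : ℝ))| ≤ K * ν ^ (-(a + 1 / 2) - 1) := by
          rw [abs_mul, abs_mul, abs_of_pos (Real.rpow_pos_of_pos hν0 _)]
          calc |G ν| * (|(-(1 / 2) : ℝ)| * ν ^ (-(1 / 2) - 1 : ℝ))
              ≤ (K * ν ^ (-a)) * (1 * ν ^ (-(1 / 2) - 1 : ℝ)) := by
                gcongr
                · exact hb ν hν
                · norm_num [abs_of_pos]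
            _ = _ := by rw [one_mul, mul_assoc, ← Real.rpow_add hν0]; congr 2; ring
        calc _ ≤ _ := abs_add_le _ _
          _ ≤ K * ν ^ (-(a + 1 / 2) - 1) + K * ν ^ (-(a + 1 / 2) - 1) := add_le_add h1 h2
          _ = _ := by ring)
    obtain ⟨A, φ, C0, hC0, hJ⟩ := exists_besselJ_asymptotics
    obtain ⟨B, hB, hprod⟩ := abs_prod_besselJ_zero_le s hVs
    have hq : 0 < (a + s.card / 2) + 1 / 2 := by linarith
    refine ⟨|A| * V j ^ (-(1 / 2) : ℝ) * C + C0 * V j ^ (-(3 / 2) : ℝ) * (K * B) /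
      (a + s.card / 2 + 1 / 2), by positivity, fun ω θ hω => ?_⟩
    have hT := tailBound_mul_kernel (H := fun ν => G ν * ∏ i ∈ s, besselJ 0 (V i * ν))
      (J := besselJ 0) (K := K * B) (b := a + s.card / 2) (M := C) (A := A) (φ := φ) (C := C0)
      (r := V j) (ω := ω) (θ := θ) hq hVj hC0
      (hGc.mul (by fun_prop : Continuous fun ν => ∏ i ∈ s, besselJ 0 (V i * ν)).continuousOn)
      (fun ν hν => by
        have hν0 : 0 < ν := by linarith
        rw [abs_mul]
        calc |G ν| * |∏ i ∈ s, besselJ 0 (V i * ν)|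
            ≤ (K * ν ^ (-a)) * (B * ν ^ (-(s.card / 2 : ℝ))) := by
              gcongr
              · exact hb ν hν
              · exact hprod ν hν0
          _ = K * B * (ν ^ (-a) * ν ^ (-(s.card / 2 : ℝ))) := by ring
          _ = _ := by rw [← Real.rpow_add hν0]; congr 2; ring)
      continuous_besselJ_zero (fun x hx => (hJ x hx).1)
      (fun σ hσ θ' => by
        have := h (ω + σ * V j) θ' (fun ε hε => by
          have h1 := hω (Function.update ε j σ) (fun i => by
            rcases eq_or_ne i j with rfl | hij
            · simpa using hσ
            · simpa [hij] using hε i)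
          rw [Finset.sum_insert hj, Function.update_self] at h1
          rw [add_assoc]
          convert h1 using 4
          refine Finset.sum_congr rfl fun i hi => ?_
          rw [Function.update_of_ne (ne_of_mem_of_not_mem hi hj)])
        rw [show a + s.card / 2 + 1 / 2 = a + 1 / 2 + s.card / 2 by ring]
        convert this using 2
        ring)
    rw [show a + (s.card + 1 : ℝ) / 2 = a + s.card / 2 + 1 / 2 by ring]
    convert hT using 2 with ν
    rw [Finset.prod_insert hj]
    ring

/-! ### Convergence of the integrals of the model -/

/-- The indices of the specular waves of positive amplitude. -/
noncomputable def posSupport {N : ℕ} (V : Fin N → ℝ) : Finset (Fin N) :=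
  {i | 0 < V i}.toFinite.toFinset

lemma mem_posSupport {N : ℕ} {V : Fin N → ℝ} {i : Fin N} : i ∈ posSupport V ↔ 0 < V i := by
  simp [posSupport]

lemma card_posSupport {N : ℕ} (V : Fin N → ℝ) :
    (posSupport V).card = Nat.card {i : Fin N // 0 < V i} := by
  rw [posSupport, ← Nat.card_eq_card_finite_toFinset]
  rfl

section

variable {N : ℕ} {m w : ℝ} {V : Fin N → ℝ}

lemma eq_zero_of_notMem_posSupport (hV : ∀ i, 0 ≤ V i) {i : Fin N} (hi : i ∉ posSupport V) :
    V i = 0 :=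
  le_antisymm (not_lt.1 fun h => hi (mem_posSupport.2 h)) (hV i)

lemma prod_posSupport (hV : ∀ i, 0 ≤ V i) (ν : ℝ) :
    ∏ i ∈ posSupport V, besselJ 0 (V i * ν) = ∏ i, besselJ 0 (V i * ν) :=
  Finset.prod_subset (Finset.subset_univ _) fun i _ hi => by
    simp [eq_zero_of_notMem_posSupport hV hi]

lemma sum_posSupport (hV : ∀ i, 0 ≤ V i) (ε : Fin N → ℝ) :
    ∑ i ∈ posSupport V, ε i * V i = ∑ i, ε i * V i :=
  Finset.sum_subset (Finset.subset_univ _) fun i _ hi => by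
    simp [eq_zero_of_notMem_posSupport hV hi]

lemma continuous_hyp1F1_sq {a : ℝ} (ha : 0 ≤ a) (κ : ℝ) :
    Continuous fun ν : ℝ => hyp1F1 a 1 (-(κ * ν ^ 2)) := by
  have := (differentiable_hyp1F1 ha).continuous
  fun_prop

lemma continuous_mwgdPhi (hm : 0 ≤ m) (w : ℝ) (V : Fin N → ℝ) : Continuous (mwgdPhi m w V) := by
  have := continuous_hyp1F1_sq hm (w / (4 * m))
  unfold mwgdPhi
  fun_prop

lemma abs_mwgdPhi_le_one (hm : 0 < m) (hw : 0 < w) (V : Fin N → ℝ) (ν : ℝ) :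
    |mwgdPhi m w V ν| ≤ 1 := by
  rw [mwgdPhi, abs_mul, Finset.abs_prod]
  refine mul_le_one₀ (abs_hyp1F1_neg_le_one hm (by positivity))
    (Finset.prod_nonneg fun _ _ => abs_nonneg _) ?_
  exact Finset.prod_le_one (fun _ _ => abs_nonneg _) fun _ _ => abs_besselJ_zero_le _

/-- The decay exponent of `|Φ|`. For `m ≥ 1` the diffuse factor decays at least like `ν^(-2)`, and
nothing better is needed. -/
noncomputable def phiDecay (m : ℝ) (V : Fin N → ℝ) : ℝ :=
  2 * min m 1 + (posSupport V).card / 2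

lemma exists_abs_mwgdPhi_le (hm : 0 < m) (hw : 0 < w) (hV : ∀ i, 0 ≤ V i) :
    ∃ K, 0 ≤ K ∧ ∀ ν, 0 < ν → |mwgdPhi m w V ν| ≤ K * ν ^ (-phiDecay m V) := by
  set κ : ℝ := w / (4 * m)
  have hκ : 0 < κ := by positivity
  have hD : ∃ K, 0 ≤ K ∧ ∀ x, 0 < x → |hyp1F1 m 1 (-x)| ≤ K * x ^ (-min m 1) := by
    rcases lt_or_ge m 1 with h | h
    · obtain ⟨C, hC, h1⟩ := exists_abs_hyp1F1_neg_le hm h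
      exact ⟨C, hC, fun x hx => by rw [min_eq_left h.le]; exact (h1 x hx).1⟩
    · refine ⟨4 * m - 2, by linarith, fun x hx => ?_⟩
      rw [min_eq_right h, Real.rpow_neg_one]
      exact abs_hyp1F1_neg_le_inv h hx
  obtain ⟨K, hK, hD⟩ := hD
  obtain ⟨B, hB, hP⟩ := abs_prod_besselJ_zero_le (V := V) (posSupport V)
    fun i hi => mem_posSupport.1 hi
  refine ⟨K * κ ^ (-min m 1) * B, by positivity, fun ν hν => ?_⟩
  rw [mwgdPhi, abs_mul, ← prod_posSupport hV]
  have h1 := hD (κ * ν ^ 2) (by positivity)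
  calc _ ≤ (K * (κ * ν ^ 2) ^ (-min m 1)) * (B * ν ^ (-((posSupport V).card / 2 : ℝ))) :=
        mul_le_mul h1 (hP ν hν) (abs_nonneg _) (by positivity)
    _ = K * κ ^ (-min m 1) * B * (ν ^ (-(2 * min m 1)) * ν ^ (-((posSupport V).card / 2 : ℝ))) := by
        rw [Real.mul_rpow hκ.le (by positivity), ← Real.rpow_natCast ν 2, ← Real.rpow_mul hν.le]
        rw [show ((2 : ℕ) : ℝ) * -min m 1 = -(2 * min m 1) by push_cast; ring]
        ring
    _ = _ := by rw [← Real.rpow_add hν, phiDecay]; congr 2; ring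

/-- Absolute convergence: `Φ(ν) ν^p J(rν)` is `O(ν^(-q-1))`, uniformly for `r ≥ δ`. -/
lemma exists_tailBound_of_lt_phiDecay (hm : 0 < m) (hw : 0 < w) (hV : ∀ i, 0 ≤ V i) {J : ℝ → ℝ}
    {B : ℝ} (hB : 0 ≤ B) (hJ : ∀ x, 0 < x → |J x| ≤ B * x ^ (-(1 / 2) : ℝ)) (p : ℝ)
    (hp : p + 1 / 2 < phiDecay m V) {δ : ℝ} (hδ : 0 < δ) :
    ∃ C q, 0 ≤ C ∧ 0 < q ∧ ∀ r, δ ≤ r →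
      TailBound (fun ν => mwgdPhi m w V ν * (ν ^ p * J (r * ν))) C q := by
  obtain ⟨K, hK, hΦ⟩ := exists_abs_mwgdPhi_le hm hw hV
  set q := phiDecay m V - p - 1 / 2
  have hq : 0 < q := by simp only [q]; linarith
  refine ⟨K * (B * δ ^ (-(1 / 2) : ℝ)) / q, q, by positivity, hq, fun r hr => ?_⟩
  refine tailBound_of_abs_le hq fun ν hν => ?_
  have hν0 : 0 < ν := by linarith
  have hr0 : 0 < r := hδ.trans_le hr
  have h1 := hJ (r * ν) (by positivity)
  rw [Real.mul_rpow hr0.le hν0.le] at h1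
  have h2 : r ^ (-(1 / 2) : ℝ) ≤ δ ^ (-(1 / 2) : ℝ) :=
    Real.rpow_le_rpow_of_nonpos hδ hr (by norm_num)
  rw [abs_mul, abs_mul, abs_of_pos (Real.rpow_pos_of_pos hν0 p)]
  calc |mwgdPhi m w V ν| * (ν ^ p * |J (r * ν)|)
      ≤ (K * ν ^ (-phiDecay m V)) * (ν ^ p * (B * (δ ^ (-(1 / 2) : ℝ) * ν ^ (-(1 / 2) : ℝ)))) := by
        refine mul_le_mul (hΦ ν hν0) ?_ (by positivity) (by positivity)
        gcongr
        exact h1.trans (by gcongr)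
    _ = K * (B * δ ^ (-(1 / 2) : ℝ)) *
        (ν ^ (-phiDecay m V) * ν ^ p * ν ^ (-(1 / 2) : ℝ)) := by ring
    _ = _ := by
        rw [← Real.rpow_add hν0, ← Real.rpow_add hν0]
        congr 2
        simp only [q]; ring

lemma TailBound.congr {g h : ℝ → ℝ} {C q : ℝ} (hg : TailBound g C q)
    (e : ∀ ν, 1 ≤ ν → g ν = h ν) : TailBound h C q := by
  intro S T hS hT
  rw [← intervalIntegral.integral_congr fun ν hν => e ν ?_]
  · exact hg S T hS hT
  · rw [Set.uIcc_of_le hT] at hν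
    exact hS.trans hν.1

/-- Conditional convergence for `m < 1`: `Φ(ν) ν^p J(rν)` oscillates with the frequencies
`r ± V₁ ± ⋯ ± V_N`, and its amplitude tends to zero. -/
lemma exists_tailBound_of_nonresonant (hm : 0 < m) (hm1 : m < 1) (hw : 0 < w) (hV : ∀ i, 0 ≤ V i)
    {J : ℝ → ℝ} {A φ C : ℝ} (hC : 0 ≤ C) (hJc : Continuous J)
    (hJ : ∀ x, 0 < x → |J x - A * Real.cos (x - φ) * x ^ (-(1 / 2) : ℝ)| ≤ C * x ^ (-(3 / 2) : ℝ))
    (p : ℝ) (hp : p < phiDecay m V + 1 / 2) {δ : ℝ} (hδ : 0 < δ) :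
    ∃ C q, 0 ≤ C ∧ 0 < q ∧ ∀ r, δ ≤ r →
      (∀ ε : Fin N → ℝ, (∀ i, ε i = 1 ∨ ε i = -1) → δ ≤ |r - ∑ i, ε i * V i|) →
      TailBound (fun ν => mwgdPhi m w V ν * (ν ^ p * J (r * ν))) C q := by
  set κ : ℝ := w / (4 * m)
  have hκ : 0 < κ := by positivity
  rw [phiDecay, min_eq_left hm1.le] at hp
  obtain ⟨C1, hC1, h1⟩ := exists_abs_hyp1F1_neg_le hm hm1
  set D : ℝ → ℝ → ℝ := fun a ν => hyp1F1 a 1 (-(κ * ν ^ 2))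
  set K : ℝ := C1 * κ ^ (-m)
  have hK : 0 ≤ K := by positivity
  have hpow : ∀ ν : ℝ, 0 < ν → C1 * (κ * ν ^ 2) ^ (-m) = K * ν ^ (-(2 * m)) := fun ν hν => by
    rw [Real.mul_rpow hκ.le (by positivity), ← Real.rpow_natCast ν 2, ← Real.rpow_mul hν.le]
    rw [show ((2 : ℕ) : ℝ) * -m = -(2 * m) by push_cast; ring]
    ring
  have hD : ∀ ν, 0 < ν → |D m ν| ≤ K * ν ^ (-(2 * m)) := fun ν hν => by
    rw [← hpow ν hν]; exact (h1 _ (by positivity)).1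
  have hD' : ∀ ν, 0 < ν → |D (m + 1) ν| ≤ K * ν ^ (-(2 * m)) := fun ν hν => by
    rw [← hpow ν hν]; exact (h1 _ (by positivity)).2
  have hDc : ∀ a, 0 ≤ a → Continuous (D a) := fun a ha => continuous_hyp1F1_sq ha κ
  have hDd : ∀ ν, 0 < ν → HasDerivAt (D m) (2 * m * (D (m + 1) ν - D m ν) / ν) ν := by
    intro ν hν
    have h2 : HasDerivAt (fun ν : ℝ => -(κ * ν ^ 2)) (-(κ * (2 * ν))) ν := by
      simpa using ((hasDerivAt_pow 2 ν).const_mul κ).fun_neg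
    refine ((differentiable_hyp1F1 hm.le _).hasDerivAt.comp ν h2).congr_deriv ?_
    rw [eq_div_iff hν.ne']
    have := mul_deriv_hyp1F1 hm.le (-(κ * ν ^ 2))
    simp only [D]
    linear_combination 2 * this
  set s := posSupport V
  have hVs : ∀ i ∈ s, 0 < V i := fun i hi => mem_posSupport.1 hi
  set P : ℝ → ℝ := fun ν => ∏ i ∈ s, besselJ 0 (V i * ν)
  have hPc : Continuous P := by simp only [P]; fun_prop
  have hpc : ∀ p : ℝ, ContinuousOn (fun ν : ℝ => ν ^ p) (Set.Ici 1) := fun p x hx =>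
    (Real.continuousAt_rpow_const x _ (Or.inl (by have : 1 ≤ x := hx; linarith)))
      |>.continuousWithinAt
  -- the slowly varying amplitude of the leading term
  have hGd : ∀ ν, 1 ≤ ν → HasDerivAt (fun ν => D m ν * ν ^ (p - 1 / 2))
      (2 * m * (D (m + 1) ν - D m ν) / ν * ν ^ (p - 1 / 2) +
        D m ν * ((p - 1 / 2) * ν ^ (p - 1 / 2 - 1))) ν := fun ν hν =>
    (hDd ν (by linarith)).mul (Real.hasDerivAt_rpow_const (Or.inl (by linarith : ν ≠ 0)))
  have hGc : ContinuousOn (fun ν => 2 * m * (D (m + 1) ν - D m ν) / ν * ν ^ (p - 1 / 2) +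
      D m ν * ((p - 1 / 2) * ν ^ (p - 1 / 2 - 1))) (Set.Ici 1) := by
    have hm1' := hDc (m + 1) (by linarith)
    have hm0' := hDc m hm.le
    refine ContinuousOn.add (ContinuousOn.mul (ContinuousOn.div (by fun_prop) continuousOn_id
      fun x hx => ?_) (hpc _)) (hm0'.continuousOn.mul (continuousOn_const.mul (hpc _)))
    have : (1 : ℝ) ≤ x := hx
    exact (by linarith : x ≠ 0)
  set K' : ℝ := K * (1 + 4 * m + |p - 1 / 2|)
  have hKK' : K ≤ K' := le_mul_of_one_le_right hK (by
    have := abs_nonneg (p - 1 / 2); linarith)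
  obtain ⟨M, hM, hosc⟩ := exists_tailBound_prod_besselJ (V := V) s hVs hδ
    (a := 2 * m - (p - 1 / 2)) (K := K') (by linarith) hGd hGc
    (fun ν hν => by
      have hν0 : 0 < ν := by linarith
      rw [abs_mul, abs_of_pos (Real.rpow_pos_of_pos hν0 _)]
      calc |D m ν| * ν ^ (p - 1 / 2) ≤ (K * ν ^ (-(2 * m))) * ν ^ (p - 1 / 2) := by
            gcongr; exact hD ν hν0
        _ = K * ν ^ (-(2 * m - (p - 1 / 2))) := by
            rw [mul_assoc, ← Real.rpow_add hν0]; congr 2; ring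
        _ ≤ _ := by gcongr)
    (fun ν hν => by
      have hν0 : 0 < ν := by linarith
      have e1 : ν ^ (-(2 * m - (p - 1 / 2)) - 1) = ν ^ (-(2 * m)) * ν ^ (p - 1 / 2) / ν := by
        rw [← Real.rpow_add hν0, ← Real.rpow_sub_one hν0.ne']; congr 1; ring
      rw [e1, Real.rpow_sub_one hν0.ne' (p - 1 / 2)]
      have hx := Real.rpow_pos_of_pos hν0 (p - 1 / 2)
      rw [show 2 * m * (D (m + 1) ν - D m ν) / ν * ν ^ (p - 1 / 2) +
        D m ν * ((p - 1 / 2) * (ν ^ (p - 1 / 2) / ν)) =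
        (2 * m * (D (m + 1) ν - D m ν) + D m ν * (p - 1 / 2)) * (ν ^ (p - 1 / 2) / ν) by ring,
        abs_mul, abs_of_pos (div_pos hx hν0), mul_div_assoc, ← mul_assoc]
      refine mul_le_mul_of_nonneg_right ?_ (div_pos hx hν0).le
      have h2 := hD ν hν0
      have h3 := hD' ν hν0
      calc |2 * m * (D (m + 1) ν - D m ν) + D m ν * (p - 1 / 2)|
          ≤ 2 * m * (|D (m + 1) ν| + |D m ν|) + |D m ν| * |p - 1 / 2| := by
            refine (abs_add_le _ _).trans ?_
            rw [abs_mul (2 * m), abs_mul (D m ν), abs_of_pos (by positivity : 0 < 2 * m)]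
            gcongr
            exact abs_sub _ _
        _ ≤ 2 * m * (K * ν ^ (-(2 * m)) + K * ν ^ (-(2 * m))) +
            K * ν ^ (-(2 * m)) * |p - 1 / 2| := by gcongr
        _ ≤ _ := by
            have h4 : 0 ≤ K * ν ^ (-(2 * m)) := by positivity
            simp only [K']
            linarith)
  obtain ⟨B, hB, hprod⟩ := abs_prod_besselJ_zero_le s hVs
  set b : ℝ := 2 * m + s.card / 2 - p
  have hq : 0 < b + 1 / 2 := by simp only [b]; linarith
  refine ⟨|A| * δ ^ (-(1 / 2) : ℝ) * M + C * δ ^ (-(3 / 2) : ℝ) * (K * B) / (b + 1 / 2),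
    b + 1 / 2, by positivity, hq, fun r hr hres => ?_⟩
  have hr0 : 0 < r := hδ.trans_le hr
  have hT := tailBound_mul_kernel (H := fun ν => D m ν * ν ^ p * P ν) (J := J) (K := K * B)
    (b := b) (M := M) (A := A) (φ := φ) (C := C) (r := r) (ω := 0) (θ := 0) hq hr0 hC
    (((hDc m hm.le).continuousOn.mul (hpc p)).mul hPc.continuousOn)
    (fun ν hν => by
      have hν0 : 0 < ν := by linarith
      rw [abs_mul, abs_mul, abs_of_pos (Real.rpow_pos_of_pos hν0 p)]
      calc |D m ν| * ν ^ p * |P ν|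
          ≤ (K * ν ^ (-(2 * m))) * ν ^ p * (B * ν ^ (-(s.card / 2 : ℝ))) := by
            gcongr
            · exact hD ν hν0
            · exact hprod ν hν0
        _ = K * B * (ν ^ (-(2 * m)) * ν ^ p * ν ^ (-(s.card / 2 : ℝ))) := by ring
        _ = _ := by
            rw [← Real.rpow_add hν0, ← Real.rpow_add hν0]; congr 2; simp only [b]; ring)
    hJc hJ
    (fun σ hσ θ' => by
      have hσ2 : σ * σ = 1 := by rcases hσ with rfl | rfl <;> norm_num
      have hσa : |σ| = 1 := by rcases hσ with rfl | rfl <;> norm_num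
      have := hosc (0 + σ * r) θ' (fun ε hε => by
        have h2 := hres (fun i => -σ * ε i) (fun i => by
          rcases hσ with rfl | rfl <;> rcases hε i with h | h <;> simp [h])
        rw [sum_posSupport hV, zero_add]
        have e : σ * r + ∑ i, ε i * V i = σ * (r - ∑ i, -σ * ε i * V i) := by
          rw [mul_sub, Finset.mul_sum, sub_eq_add_neg, ← Finset.sum_neg_distrib]
          congr 1
          exact Finset.sum_congr rfl fun i _ => by linear_combination -(ε i * V i) * hσ2
        rwa [e, abs_mul, hσa, one_mul])
      rw [show b + 1 / 2 = 2 * m - (p - 1 / 2) + s.card / 2 by simp only [b]; ring]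
      refine this.congr fun ν hν => ?_
      have hν0 : 0 < ν := by linarith
      rw [sub_eq_add_neg p, Real.rpow_add hν0]
      simp only [P]
      ring)
  have hle : |A| * r ^ (-(1 / 2) : ℝ) * M + C * r ^ (-(3 / 2) : ℝ) * (K * B) / (b + 1 / 2) ≤
      |A| * δ ^ (-(1 / 2) : ℝ) * M + C * δ ^ (-(3 / 2) : ℝ) * (K * B) / (b + 1 / 2) := by
    have h2 : r ^ (-(1 / 2) : ℝ) ≤ δ ^ (-(1 / 2) : ℝ) :=
      Real.rpow_le_rpow_of_nonpos hδ hr (by norm_num)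
    have h3 : r ^ (-(3 / 2) : ℝ) ≤ δ ^ (-(3 / 2) : ℝ) :=
      Real.rpow_le_rpow_of_nonpos hδ hr (by norm_num)
    gcongr
  have hT' : TailBound (fun ν => mwgdPhi m w V ν * (ν ^ p * J (r * ν))) _ (b + 1 / 2) :=
    hT.congr fun ν _ => by
      simp only [P, mwgdPhi, zero_mul, zero_add, Real.cos_zero, mul_one, s, prod_posSupport hV]
      simp only [D, κ]
      ring
  intro S T hS hST
  have hS0 : 0 ≤ S := by linarith
  exact (hT' S T hS hST).trans (mul_le_mul_of_nonneg_right hle (Real.rpow_nonneg hS0 _))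

lemma one_half_lt_phiDecay (hm : 0 < m) (hA : 1 / 4 < m ∨ ∃ i, 0 < V i) :
    1 / 2 < phiDecay m V := by
  have hmin : 0 < min m 1 := lt_min hm one_pos
  rw [phiDecay]
  rcases hA with h | ⟨i, hi⟩
  · have : 1 / 4 < min m 1 := lt_min h (by norm_num)
    have : (0 : ℝ) ≤ (posSupport V).card := Nat.cast_nonneg _
    linarith
  · have : (1 : ℝ) ≤ (posSupport V).card := by
      exact_mod_cast Finset.card_pos.2 ⟨i, mem_posSupport.2 hi⟩
    linarith

/-- The density integrals have uniformly small tails for `r` away from `0` and from the sums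
`± V₁ ± ⋯ ± V_N`. -/
lemma exists_tailBound_density (hm : 0 < m) (hw : 0 < w) (hV : ∀ i, 0 ≤ V i)
    (hA : 1 / 4 < m ∨ ∃ i, 0 < V i) {δ : ℝ} (hδ : 0 < δ) :
    ∃ C q, 0 ≤ C ∧ 0 < q ∧ ∀ r, δ ≤ r →
      (∀ ε : Fin N → ℝ, (∀ i, ε i = 1 ∨ ε i = -1) → δ ≤ |r - ∑ i, ε i * V i|) →
      TailBound (fun ν => mwgdPhi m w V ν * (ν * besselJ 0 (r * ν))) C q := by
  have h12 := one_half_lt_phiDecay hm hA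
  rcases lt_or_ge m 1 with h | h
  · obtain ⟨A, φ, C, hC, hJ⟩ := exists_besselJ_asymptotics
    have := exists_tailBound_of_nonresonant hm h hw hV hC continuous_besselJ_zero
      (fun x hx => (hJ x hx).1) 1 (by linarith) hδ
    simpa only [Real.rpow_one] using this
  · obtain ⟨B, hB, hJ⟩ := exists_abs_besselJ_le
    obtain ⟨C, q, hC, hq, h1⟩ := exists_tailBound_of_lt_phiDecay hm hw hV hB
      (fun x hx => (hJ x hx).1) 1 (by
        rw [phiDecay, min_eq_right h]
        have : (0 : ℝ) ≤ (posSupport V).card := Nat.cast_nonneg _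
        linarith) hδ
    simp only [Real.rpow_one] at h1
    exact ⟨C, q, hC, hq, fun r hr _ => h1 r hr⟩

lemma ne_signedSum_of_notMem_resonantRadii {r : ℝ} (hr : 0 < r) (hres : r ∉ resonantRadii V)
    (ε : Fin N → ℝ) (hε : ∀ i, ε i = 1 ∨ ε i = -1) : r ≠ ∑ i, ε i * V i := fun h =>
  hres ⟨ε, hε, by rw [← h, abs_of_pos hr]⟩

lemma finite_signedSums (V : Fin N → ℝ) :
    {x : ℝ | ∃ ε : Fin N → ℝ, (∀ i, ε i = 1 ∨ ε i = -1) ∧ x = ∑ i, ε i * V i}.Finite := by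
  have : (Set.pi Set.univ fun _ : Fin N => ({1, -1} : Set ℝ)).Finite :=
    Set.Finite.pi fun _ => Set.toFinite _
  refine (this.image fun ε => ∑ i, ε i * V i).subset ?_
  rintro x ⟨ε, hε, rfl⟩
  exact ⟨ε, fun i _ => by simpa using hε i, rfl⟩

lemma finite_resonantRadii (V : Fin N → ℝ) : (resonantRadii V).Finite := by
  refine ((finite_signedSums V).image fun x => |x|).subset ?_
  rintro x ⟨ε, hε, rfl⟩
  exact ⟨_, ⟨ε, hε, rfl⟩, rfl⟩

/-- A compact set of nonresonant positive radii keeps a distance from the resonances. -/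
lemma exists_separation {s : Set ℝ} (hs : IsCompact s)
    (hpos : ∀ r ∈ s, 0 < r ∧ r ∉ resonantRadii V) : ∃ δ, 0 < δ ∧ ∀ r ∈ s, δ ≤ r ∧
      ∀ ε : Fin N → ℝ, (∀ i, ε i = 1 ∨ ε i = -1) → δ ≤ |r - ∑ i, ε i * V i| := by
  set Z : Set ℝ := insert 0
    {x : ℝ | ∃ ε : Fin N → ℝ, (∀ i, ε i = 1 ∨ ε i = -1) ∧ x = ∑ i, ε i * V i}
  have hZ : IsClosed Z := ((finite_signedSums V).insert 0).isClosed
  have hd : Disjoint s Z := by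
    rw [Set.disjoint_left]
    intro r hr hrZ
    obtain ⟨h0, h1⟩ := hpos r hr
    rcases hrZ with rfl | ⟨ε, hε, h⟩
    · exact lt_irrefl _ h0
    · exact ne_signedSum_of_notMem_resonantRadii h0 h1 ε hε h
  obtain ⟨δ, hδ, h⟩ := Metric.exists_pos_forall_lt_edist hs hZ hd
  have h' : ∀ r ∈ s, ∀ y ∈ Z, (δ : ℝ) ≤ |r - y| := fun r hr y hy => by
    have := h r hr y hy
    rw [edist_nndist, ENNReal.coe_lt_coe, ← NNReal.coe_lt_coe, coe_nndist, Real.dist_eq] at this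
    exact this.le
  refine ⟨δ, hδ, fun r hr => ⟨?_, fun ε hε => h' r hr _ (Or.inr ⟨ε, hε, rfl⟩)⟩⟩
  have := h' r hr 0 (Or.inl rfl)
  rwa [sub_zero, abs_of_pos (hpos r hr).1] at this

lemma continuous_density_integrand (hm : 0 ≤ m) (w : ℝ) (V : Fin N → ℝ) (r : ℝ) :
    Continuous fun ν => mwgdPhi m w V ν * (ν * besselJ 0 (r * ν)) := by
  have := continuous_mwgdPhi hm w V
  fun_prop

lemma exists_hasImproperIntegral_density (hm : 0 < m) (hw : 0 < w) (hV : ∀ i, 0 ≤ V i)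
    (hA : 1 / 4 < m ∨ ∃ i, 0 < V i) {r : ℝ} (hr : 0 < r)
    (h : r ∉ resonantRadii V ∨ 3 / 2 < 2 * m + (Nat.card {i : Fin N // 0 < V i} : ℝ) / 2) :
    ∃ L, HasImproperIntegral (fun ν => mwgdPhi m w V ν * (ν * besselJ 0 (r * ν))) L := by
  rcases h with h | h
  · obtain ⟨δ, hδ, hsep⟩ := exists_separation (V := V) (isCompact_singleton (x := r))
      (by rintro _ rfl; exact ⟨hr, h⟩)
    obtain ⟨C, q, -, hq, hT⟩ := exists_tailBound_density hm hw hV hA hδ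
    exact (hT r (hsep r rfl).1 (hsep r rfl).2).exists_hasImproperIntegral hq
      (continuous_density_integrand hm.le w V r)
  · obtain ⟨B, hB, hJ⟩ := exists_abs_besselJ_le
    obtain ⟨C, q, -, hq, hT⟩ := exists_tailBound_of_lt_phiDecay hm hw hV hB
      (fun x hx => (hJ x hx).1) 1 (by
        rw [phiDecay, card_posSupport]
        rcases le_total m 1 with h1 | h1
        · rw [min_eq_left h1]; linarith
        · rw [min_eq_right h1]
          have : (0 : ℝ) ≤ Nat.card {i : Fin N // 0 < V i} := Nat.cast_nonneg _
          linarith) hr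
    simp only [Real.rpow_one] at hT
    exact (hT r le_rfl).exists_hasImproperIntegral hq
      (continuous_density_integrand hm.le w V r)

lemma continuous_cdf_integrand (hm : 0 ≤ m) (w : ℝ) (V : Fin N → ℝ) (t : ℝ) :
    Continuous fun ν => mwgdPhi m w V ν * besselJ 1 (t * ν) := by
  have := continuous_mwgdPhi hm w V
  fun_prop

lemma exists_hasImproperIntegral_cdf (hm : 0 < m) (hw : 0 < w) (hV : ∀ i, 0 ≤ V i)
    {t : ℝ} (ht : 0 < t) :
    ∃ L, HasImproperIntegral (fun ν => mwgdPhi m w V ν * besselJ 1 (t * ν)) L := by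
  rcases lt_or_ge (1 / 2) (phiDecay m V) with h | h
  · obtain ⟨B, hB, hJ⟩ := exists_abs_besselJ_le
    obtain ⟨C, q, -, hq, hT⟩ := exists_tailBound_of_lt_phiDecay hm hw hV hB
      (fun x hx => (hJ x hx).2) 0 (by linarith) ht
    simp only [Real.rpow_zero, one_mul] at hT
    exact (hT t le_rfl).exists_hasImproperIntegral hq (continuous_cdf_integrand hm.le w V t)
  · -- slow decay forces all specular amplitudes to vanish, so `t` is the only frequency
    have hA : ¬(1 / 4 < m ∨ ∃ i, 0 < V i) := fun hA => (one_half_lt_phiDecay hm hA).not_ge h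
    push Not at hA
    have hV0 : ∀ i, V i = 0 := fun i => le_antisymm (hA.2 i) (hV i)
    obtain ⟨A, φ, C, hC, hJ⟩ := exists_besselJ_asymptotics
    have hd : 0 < phiDecay m V := by
      rw [phiDecay]; have := lt_min hm one_pos; positivity
    obtain ⟨C', q, -, hq, hT⟩ := exists_tailBound_of_nonresonant hm (by linarith) hw hV hC
      (A := A) (φ := φ + Real.pi / 2) continuous_besselJ_one
      (fun x hx => by
        rw [← sub_sub, Real.cos_sub_pi_div_two]; exact (hJ x hx).2) 0 (by linarith) ht
    simp only [Real.rpow_zero, one_mul] at hT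
    refine (hT t le_rfl fun ε _ => ?_).exists_hasImproperIntegral hq
      (continuous_cdf_integrand hm.le w V t)
    simp [hV0, le_abs_self]

end

/-! ### Gaussian smoothing -/

/-- Gaussian summation is regular: it assigns to a convergent improper integral its value.
Integrating by parts, the smoothed integral is the mean of the primitive `H (x / σ)` against the
probability density `2 x exp (-x²)`, and `H` is bounded and converges. -/
lemma HasImproperIntegral.tendsto_integral_mul_exp {g : ℝ → ℝ} {L : ℝ}
    (h : HasImproperIntegral g L) (hg : Continuous g)
    (hi : ∀ σ : ℝ, 0 < σ → IntegrableOn (fun ν => g ν * Real.exp (-σ ^ 2 * ν ^ 2)) (Set.Ioi 0)) :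
    Tendsto (fun σ : ℝ => ∫ ν in Set.Ioi (0 : ℝ), g ν * Real.exp (-σ ^ 2 * ν ^ 2))
      (𝓝[>] 0) (𝓝 L) := by
  set H : ℝ → ℝ := fun T => ∫ ν in (0 : ℝ)..T, g ν
  have hHd : ∀ x, HasDerivAt H (g x) x := fun x =>
    intervalIntegral.integral_hasDerivAt_right (hg.intervalIntegrable _ _)
      (hg.stronglyMeasurableAtFilter _ _) hg.continuousAt
  have hHc : Continuous H := continuous_iff_continuousAt.2 fun x => (hHd x).continuousAt
  obtain ⟨B, hB⟩ : ∃ B, ∀ x ∈ Set.Ici (0 : ℝ), |H x| ≤ B := by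
    obtain ⟨M, hM⟩ := (h.2.eventually (Metric.closedBall_mem_nhds L one_pos)).exists_forall_of_atTop
    obtain ⟨B, hB⟩ := (isCompact_Icc (a := (0 : ℝ)) (b := M)).exists_bound_of_continuousOn
      hHc.continuousOn
    refine ⟨max B (1 + |L|), fun x hx => ?_⟩
    rcases le_total x M with hxM | hxM
    · exact (hB x ⟨hx, hxM⟩).trans (le_max_left _ _)
    · have h1 := hM x hxM
      rw [Real.dist_eq] at h1
      change |H x - L| ≤ 1 at h1
      refine le_trans ?_ (le_max_right _ _)
      calc |H x| = |(H x - L) + L| := by rw [sub_add_cancel]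
        _ ≤ |H x - L| + |L| := abs_add_le _ _
        _ ≤ _ := by gcongr
  have hgauss : ∀ c : ℝ, 0 < c →
      IntegrableOn (fun x : ℝ => 2 * x * Real.exp (-c * x ^ 2)) (Set.Ioi 0) := fun c hc => by
    have h1 := (integrableOn_rpow_mul_exp_neg_mul_sq hc (s := 1) (by norm_num)).const_mul 2
    refine h1.congr (ae_of_all _ fun x => ?_)
    simp only [Real.rpow_one, mul_assoc]
  have hdom : ∀ (u : ℝ → ℝ) (c : ℝ), 0 < c → Continuous u → (∀ x ∈ Set.Ioi (0 : ℝ), |u x| ≤ B) →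
      IntegrableOn (fun x : ℝ => u x * (2 * x * Real.exp (-c * x ^ 2))) (Set.Ioi 0) :=
    fun u c hc hu hb => by
      refine Integrable.bdd_mul (c := B) (hgauss c hc) hu.aestronglyMeasurable ?_
      exact (ae_restrict_iff' measurableSet_Ioi).2 (ae_of_all _ hb)
  have hB' : ∀ σ : ℝ, 0 < σ → ∀ x ∈ Set.Ioi (0 : ℝ), |H (σ⁻¹ * x)| ≤ B := fun σ hσ x hx =>
    hB _ (mul_nonneg (inv_nonneg.2 hσ.le) (le_of_lt hx))
  have hparts : ∀ σ : ℝ, 0 < σ → ∫ ν in Set.Ioi (0 : ℝ), g ν * Real.exp (-σ ^ 2 * ν ^ 2) =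
      ∫ x in Set.Ioi (0 : ℝ), H (σ⁻¹ * x) * (2 * x * Real.exp (-1 * x ^ 2)) := by
    intro σ hσ
    have hexp : ∀ x : ℝ, HasDerivAt (fun ν : ℝ => Real.exp (-σ ^ 2 * ν ^ 2))
        (-(σ ^ 2 * (2 * x * Real.exp (-σ ^ 2 * x ^ 2)))) x := by
      intro x
      have := ((hasDerivAt_pow 2 x).const_mul (-σ ^ 2)).exp
      refine this.congr_deriv ?_
      simp only [Nat.cast_ofNat]
      ring
    have hHI := (hdom H (σ ^ 2) (by positivity) hHc fun x hx =>
      hB x (Set.mem_Ici.2 (le_of_lt hx))).const_mul (σ ^ 2)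
    have h1 := integral_Ioi_deriv_mul_eq_sub (a := 0) (u := H) (u' := g)
      (v := fun ν => Real.exp (-σ ^ 2 * ν ^ 2))
      (v' := fun x => -(σ ^ 2 * (2 * x * Real.exp (-σ ^ 2 * x ^ 2)))) (a' := 0) (b' := 0)
      (fun x _ => hHd x) (fun x _ => hexp x)
      (by
        refine ((hi σ hσ).sub hHI).congr (ae_of_all _ fun x => ?_)
        simp only [Pi.add_apply, Pi.mul_apply, Pi.sub_apply]
        ring)
      (by
        have hc : Continuous (H * fun ν : ℝ => Real.exp (-σ ^ 2 * ν ^ 2)) :=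
          hHc.mul (by fun_prop)
        have := hc.tendsto 0
        simp only [Pi.mul_apply, H, intervalIntegral.integral_same, zero_mul] at this
        exact this.mono_left nhdsWithin_le_nhds)
      (by
        have h2 : Tendsto (fun ν : ℝ => Real.exp (-σ ^ 2 * ν ^ 2)) atTop (𝓝 0) := by
          refine Real.tendsto_exp_atBot.comp ?_
          refine Tendsto.const_mul_atTop_of_neg (by nlinarith) (tendsto_pow_atTop two_ne_zero)
        have h6 := h.2.mul h2
        rw [mul_zero] at h6
        exact h6)
    have h3 : ∫ x in Set.Ioi (0 : ℝ), g x * Real.exp (-σ ^ 2 * x ^ 2) =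
        ∫ x in Set.Ioi (0 : ℝ), σ ^ 2 * (H x * (2 * x * Real.exp (-σ ^ 2 * x ^ 2))) := by
      have h4 : ∫ x in Set.Ioi (0 : ℝ), (g x * Real.exp (-σ ^ 2 * x ^ 2) -
          σ ^ 2 * (H x * (2 * x * Real.exp (-σ ^ 2 * x ^ 2)))) = 0 := by
        rw [sub_zero] at h1
        refine Eq.trans (integral_congr_ae (ae_of_all _ fun x => ?_)) h1
        ring
      rw [integral_sub (hi σ hσ) hHI] at h4
      linarith
    rw [h3]
    have h5 := integral_comp_mul_left_Ioi
      (fun x => H (σ⁻¹ * x) * (2 * x * Real.exp (-1 * x ^ 2))) 0 hσ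
    rw [mul_zero, smul_eq_mul] at h5
    rw [← mul_inv_cancel_left₀ hσ.ne' (∫ x in Set.Ioi (0 : ℝ), H (σ⁻¹ * x) * _), ← h5,
      ← integral_const_mul]
    refine integral_congr_ae (ae_of_all _ fun x => ?_)
    simp only
    rw [inv_mul_cancel_left₀ hσ.ne']
    ring_nf
  have hlim : Tendsto (fun σ : ℝ =>
      ∫ x in Set.Ioi (0 : ℝ), H (σ⁻¹ * x) * (2 * x * Real.exp (-1 * x ^ 2))) (𝓝[>] 0)
      (𝓝 (∫ x in Set.Ioi (0 : ℝ), L * (2 * x * Real.exp (-1 * x ^ 2)))) := by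
    refine tendsto_integral_filter_of_dominated_convergence
      (fun x => B * (2 * x * Real.exp (-1 * x ^ 2))) ?_ ?_ ((hgauss 1 one_pos).const_mul B) ?_
    · exact Eventually.of_forall fun σ =>
        (by fun_prop : Continuous fun x : ℝ => H (σ⁻¹ * x) * (2 * x * Real.exp (-1 * x ^ 2)))
          |>.aestronglyMeasurable
    · filter_upwards [self_mem_nhdsWithin] with σ hσ
      refine (ae_restrict_iff' measurableSet_Ioi).2 (ae_of_all _ fun x hx => ?_)
      have hx0 : (0 : ℝ) < x := hx
      rw [norm_mul, Real.norm_of_nonneg (by positivity : 0 ≤ 2 * x * Real.exp (-1 * x ^ 2))]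
      gcongr
      exact hB' σ hσ x hx
    · refine (ae_restrict_iff' measurableSet_Ioi).2 (ae_of_all _ fun x hx => ?_)
      refine Tendsto.mul_const _ (h.2.comp ?_)
      exact tendsto_inv_nhdsGT_zero.atTop_mul_const hx
  have hone : ∫ x in Set.Ioi (0 : ℝ), L * (2 * x * Real.exp (-1 * x ^ 2)) = L := by
    have h1 := integral_rpow_mul_exp_neg_sq (s := 1) (c := 1) one_pos one_pos
    norm_num at h1
    rw [integral_const_mul]
    simp only [neg_mul, one_mul]
    rw [h1, mul_one]
  rw [hone] at hlim
  refine hlim.congr' ?_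
  filter_upwards [self_mem_nhdsWithin] with σ hσ
  exact (hparts σ hσ).symm

lemma besselJ_zero_abs (x : ℝ) : besselJ 0 |x| = besselJ 0 x := by
  rw [besselJ_zero_eq, besselJ_zero_eq, sq_abs]

lemma integrableOn_mul_exp_neg_sq {σ : ℝ} (hσ : 0 < σ) :
    IntegrableOn (fun x : ℝ => x * Real.exp (-σ ^ 2 * x ^ 2)) (Set.Ioi 0) := by
  have h1 := integrableOn_rpow_mul_exp_neg_mul_sq (b := σ ^ 2) (by positivity) (s := 1)
    (by norm_num)
  simpa only [Real.rpow_one] using h1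

/-- Weber's second exponential integral, in the form of a circular average of Gaussians. -/
lemma integral_mul_exp_mul_besselJ_mul_besselJ {σ : ℝ} (hσ : 0 < σ) (ρ r : ℝ) :
    ∫ ν in Set.Ioi (0 : ℝ), ν * Real.exp (-σ ^ 2 * ν ^ 2) *
        (besselJ 0 (ρ * ν) * besselJ 0 (r * ν)) =
      (2 * Real.pi)⁻¹ * ∫ θ in (0 : ℝ)..2 * Real.pi, (2 * σ ^ 2)⁻¹ *
        Real.exp (-(‖(ρ : ℂ) + r * Complex.exp (Complex.I * θ)‖ ^ 2 / (4 * σ ^ 2))) := by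
  have hpi : 2 * Real.pi ≠ 0 := by have := Real.pi_pos; positivity
  set d : ℝ → ℝ := fun θ => ‖(ρ : ℂ) + r * Complex.exp (Complex.I * θ)‖
  have hdc : Continuous d := by simp only [d]; fun_prop
  have h1 : ∀ ν ∈ Set.Ioi (0 : ℝ), ν * Real.exp (-σ ^ 2 * ν ^ 2) *
      (besselJ 0 (ρ * ν) * besselJ 0 (r * ν)) = (2 * Real.pi)⁻¹ *
        ∫ θ in (0 : ℝ)..2 * Real.pi, ν * Real.exp (-σ ^ 2 * ν ^ 2) * besselJ 0 (d θ * ν) := by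
    intro ν hν
    have h2 := integral_besselJ_zero_norm_add ((ρ * ν : ℝ) : ℂ) (r * ν)
    rw [Complex.norm_real, Real.norm_eq_abs, besselJ_zero_abs] at h2
    have h3 : ∀ θ : ℝ, ‖((ρ * ν : ℝ) : ℂ) + ((r * ν : ℝ) : ℂ) * Complex.exp (Complex.I * θ)‖ =
        d θ * ν := by
      intro θ
      rw [show ((ρ * ν : ℝ) : ℂ) + ((r * ν : ℝ) : ℂ) * Complex.exp (Complex.I * θ) =
        ((ρ : ℂ) + r * Complex.exp (Complex.I * θ)) * (ν : ℂ) by push_cast; ring, norm_mul,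
        Complex.norm_real, Real.norm_of_nonneg (le_of_lt hν)]
    simp_rw [h3] at h2
    rw [intervalIntegral.integral_const_mul, h2]
    field_simp
  rw [setIntegral_congr_fun measurableSet_Ioi h1, integral_const_mul]
  congr 1
  rw [← intervalIntegral_integral_swap]
  · refine intervalIntegral.integral_congr fun θ _ => ?_
    exact (integral_mul_exp_mul_besselJ_zero (c := σ ^ 2) (by positivity) (d θ)).2
  · have h4 : Integrable (fun p : ℝ × ℝ => (1 : ℝ) * (p.2 * Real.exp (-σ ^ 2 * p.2 ^ 2)))
        ((volume.restrict (Set.uIoc 0 (2 * Real.pi))).prod (volume.restrict (Set.Ioi 0))) :=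
      Integrable.mul_prod (f := fun _ : ℝ => (1 : ℝ)) continuous_const.integrableOn_uIoc
        (integrableOn_mul_exp_neg_sq hσ)
    refine h4.norm.mono' (Continuous.aestronglyMeasurable
      (by unfold Function.uncurry; fun_prop)) (ae_of_all _ fun p => ?_)
    rw [Function.uncurry, norm_mul, one_mul]
    exact mul_le_of_le_one_right (norm_nonneg _) (abs_besselJ_zero_le _)

lemma integral_mul_exp_mul_besselJ_mul_besselJ_nonneg {σ : ℝ} (hσ : 0 < σ) (ρ r : ℝ) :
    0 ≤ ∫ ν in Set.Ioi (0 : ℝ), ν * Real.exp (-σ ^ 2 * ν ^ 2) *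
        (besselJ 0 (ρ * ν) * besselJ 0 (r * ν)) := by
  rw [integral_mul_exp_mul_besselJ_mul_besselJ hσ]
  have := Real.pi_pos
  refine mul_nonneg (by positivity) (intervalIntegral.integral_nonneg (by positivity) fun θ _ => ?_)
  positivity

/-- The mass that a Gaussian of scale `σ` centred at distance `ρ` from the origin gives to the
open disk of radius `t` about the origin, written as an integral over a fixed Gaussian. -/
noncomputable def gaussianDiskMass (σ t ρ : ℝ) : ℝ :=
  (4 * Real.pi)⁻¹ * ∫ y : ℂ, {y : ℂ | ‖σ • y - (ρ : ℂ)‖ < t}.indicator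
    (fun y => Real.exp (-(‖y‖ ^ 2 / 4))) y

lemma integrable_exp_neg_norm_sq : Integrable fun y : ℂ => Real.exp (-(‖y‖ ^ 2 / 4)) := by
  by_contra h
  have h1 := Complex.integral_exp_neg_mul_rpow (p := 2) (b := 1 / 4) (by norm_num) (by norm_num)
  simp_rw [Real.rpow_two] at h1
  have e : (fun y : ℂ => Real.exp (-(1 / 4) * ‖y‖ ^ 2)) =
      fun y : ℂ => Real.exp (-(‖y‖ ^ 2 / 4)) := by
    funext y; congr 1; ring
  rw [e, integral_undef h] at h1
  have h2 : 0 < Real.pi * (1 / 4 : ℝ) ^ (-2 / 2 : ℝ) * Real.Gamma (2 / 2 + 1) := by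
    have := Real.Gamma_pos_of_pos (s := 2 / 2 + 1) (by norm_num)
    have := Real.pi_pos
    positivity
  exact h2.ne h1

lemma integral_exp_neg_norm_sq : ∫ y : ℂ, Real.exp (-(‖y‖ ^ 2 / 4)) = 4 * Real.pi := by
  have h1 := Complex.integral_exp_neg_mul_rpow (p := 2) (b := 1 / 4) (by norm_num) (by norm_num)
  simp_rw [Real.rpow_two] at h1
  have e : (fun y : ℂ => Real.exp (-(1 / 4) * ‖y‖ ^ 2)) =
      fun y : ℂ => Real.exp (-(‖y‖ ^ 2 / 4)) := by
    funext y; congr 1; ring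
  rw [e] at h1
  rw [h1]
  norm_num [Real.rpow_neg_one, Real.Gamma_two]
  ring

lemma isOpen_disk (σ t ρ : ℝ) : IsOpen {y : ℂ | ‖σ • y - (ρ : ℂ)‖ < t} :=
  isOpen_lt (by fun_prop) continuous_const

lemma abs_gaussianDiskMass_le (σ t ρ : ℝ) : |gaussianDiskMass σ t ρ| ≤ 1 := by
  have hpi := Real.pi_pos
  have h : ‖∫ y : ℂ, {y : ℂ | ‖σ • y - (ρ : ℂ)‖ < t}.indicator
      (fun y => Real.exp (-(‖y‖ ^ 2 / 4))) y‖ ≤ 4 * Real.pi := by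
    rw [← integral_exp_neg_norm_sq]
    refine norm_integral_le_of_norm_le integrable_exp_neg_norm_sq (ae_of_all _ fun y => ?_)
    exact (norm_indicator_le_norm_self _ _).trans_eq (Real.norm_of_nonneg (Real.exp_pos _).le)
  rw [gaussianDiskMass, abs_mul, abs_of_pos (by positivity), ← Real.norm_eq_abs (∫ y : ℂ, _)]
  calc _ ≤ (4 * Real.pi)⁻¹ * (4 * Real.pi) := by gcongr
    _ = 1 := by field_simp

lemma tendsto_gaussianDiskMass {t ρ : ℝ} (h : |ρ| ≠ t) :
    Tendsto (fun σ => gaussianDiskMass σ t ρ) (𝓝[>] 0) (𝓝 (if |ρ| < t then 1 else 0)) := by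
  have hpi := Real.pi_pos
  have hlim : Tendsto (fun σ : ℝ => ∫ y : ℂ, {y : ℂ | ‖σ • y - (ρ : ℂ)‖ < t}.indicator
      (fun y => Real.exp (-(‖y‖ ^ 2 / 4))) y) (𝓝[>] 0)
      (𝓝 (∫ y : ℂ, if |ρ| < t then Real.exp (-(‖y‖ ^ 2 / 4)) else 0)) := by
    refine tendsto_integral_filter_of_dominated_convergence
      (fun y => Real.exp (-(‖y‖ ^ 2 / 4))) ?_ ?_ integrable_exp_neg_norm_sq ?_
    · exact Eventually.of_forall fun σ =>
        ((by fun_prop : Continuous fun y : ℂ => Real.exp (-(‖y‖ ^ 2 / 4))).aestronglyMeasurable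
          |>.indicator (isOpen_disk σ t ρ).measurableSet)
    · exact Eventually.of_forall fun σ => ae_of_all _ fun y =>
        (norm_indicator_le_norm_self _ _).trans_eq (Real.norm_of_nonneg (Real.exp_pos _).le)
    · refine ae_of_all _ fun y => ?_
      have hc : Tendsto (fun σ : ℝ => ‖σ • y - (ρ : ℂ)‖) (𝓝[>] 0) (𝓝 |ρ|) := by
        have : Continuous fun σ : ℝ => ‖σ • y - (ρ : ℂ)‖ := by fun_prop
        have h0 := this.tendsto 0
        simp only [zero_smul, zero_sub, norm_neg, Complex.norm_real, Real.norm_eq_abs] at h0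
        exact h0.mono_left nhdsWithin_le_nhds
      rcases lt_or_gt_of_ne h with h | h
      · rw [if_pos h]
        refine tendsto_const_nhds.congr' ?_
        filter_upwards [hc.eventually (gt_mem_nhds h)] with σ hσ
        rw [Set.indicator_of_mem (by exact hσ)]
      · rw [if_neg h.not_gt]
        refine tendsto_const_nhds.congr' ?_
        filter_upwards [hc.eventually (lt_mem_nhds h)] with σ hσ
        rw [Set.indicator_of_notMem (by simpa using hσ.le)]
  have h2 := hlim.const_mul (4 * Real.pi)⁻¹
  refine h2.trans (le_of_eq ?_)
  congr 1
  split_ifs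
  · rw [integral_exp_neg_norm_sq]; field_simp
  · simp

/-- The smoothed Weber discontinuous integral is the Gaussian mass of a disk. -/
lemma integral_besselJ_mul_besselJ_one_mul_exp {σ : ℝ} (hσ : 0 < σ) {t : ℝ} (ht : 0 ≤ t) (ρ : ℝ) :
    t * ∫ ν in Set.Ioi (0 : ℝ), besselJ 0 (ρ * ν) * besselJ 1 (t * ν) *
      Real.exp (-σ ^ 2 * ν ^ 2) = gaussianDiskMass σ t ρ := by
  have hpi := Real.pi_pos
  set E : ℂ → ℝ := fun z => Real.exp (-(‖(ρ : ℂ) + z‖ ^ 2 / (4 * σ ^ 2)))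
  have hEc : Continuous E := by simp only [E]; fun_prop
  -- the Bessel integral as an integral over radii
  have h1 : t * ∫ ν in Set.Ioi (0 : ℝ), besselJ 0 (ρ * ν) * besselJ 1 (t * ν) *
      Real.exp (-σ ^ 2 * ν ^ 2) = ∫ r in (0 : ℝ)..t, r * ∫ ν in Set.Ioi (0 : ℝ),
        ν * Real.exp (-σ ^ 2 * ν ^ 2) * (besselJ 0 (ρ * ν) * besselJ 0 (r * ν)) := by
    rw [← integral_const_mul]
    have h2 : ∀ ν : ℝ, t * (besselJ 0 (ρ * ν) * besselJ 1 (t * ν) * Real.exp (-σ ^ 2 * ν ^ 2)) =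
        ∫ r in (0 : ℝ)..t, r * (ν * Real.exp (-σ ^ 2 * ν ^ 2) *
          (besselJ 0 (ρ * ν) * besselJ 0 (r * ν))) := by
      intro ν
      have h3 := integral_mul_besselJ_zero 0 t ν
      rw [zero_mul, sub_zero] at h3
      have e : (fun r => r * (ν * Real.exp (-σ ^ 2 * ν ^ 2) *
          (besselJ 0 (ρ * ν) * besselJ 0 (r * ν)))) = fun r =>
          (besselJ 0 (ρ * ν) * Real.exp (-σ ^ 2 * ν ^ 2)) * (r * ν * besselJ 0 (r * ν)) := by
        funext r; ring
      rw [e, intervalIntegral.integral_const_mul, h3]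
      ring
    simp_rw [h2]
    rw [← intervalIntegral_integral_swap]
    · refine intervalIntegral.integral_congr fun r _ => ?_
      exact integral_const_mul _ _
    · have h4 : Integrable (fun p : ℝ × ℝ => p.1 * (p.2 * Real.exp (-σ ^ 2 * p.2 ^ 2)))
          ((volume.restrict (Set.uIoc 0 t)).prod (volume.restrict (Set.Ioi 0))) :=
        Integrable.mul_prod (f := fun x : ℝ => x)
          (continuous_id.integrableOn_uIoc) (integrableOn_mul_exp_neg_sq hσ)
      refine h4.norm.mono' (Continuous.aestronglyMeasurable
        (by unfold Function.uncurry; fun_prop)) (ae_of_all _ fun p => ?_)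
      rw [Function.uncurry, norm_mul, norm_mul p.1, norm_mul (p.2 * _), norm_mul (besselJ 0 _)]
      have hJ1 := abs_besselJ_zero_le (ρ * p.2)
      have hJ2 := abs_besselJ_zero_le (p.1 * p.2)
      gcongr
      exact mul_le_of_le_one_right (norm_nonneg _)
        (mul_le_one₀ hJ1 (norm_nonneg _) hJ2)
  -- polar coordinates
  have h5 : ∫ z : ℂ, {z : ℂ | ‖z‖ < t}.indicator E z =
      ∫ r in (0 : ℝ)..t, r * ∫ θ in (0 : ℝ)..2 * Real.pi, E (r * Complex.exp (Complex.I * θ)) := by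
    rw [← Complex.integral_comp_polarCoord_symm, polarCoord_target]
    set F : ℝ × ℝ → ℝ := fun p => p.1 * E (p.1 * Complex.exp (Complex.I * p.2))
    have hFc : Continuous F := by simp only [F]; fun_prop
    have e1 : ∀ p ∈ Set.Ioi (0 : ℝ) ×ˢ Set.Ioo (-Real.pi) Real.pi,
        p.1 • {z : ℂ | ‖z‖ < t}.indicator E (Complex.polarCoord.symm p) =
          (Set.Iio t ×ˢ Set.univ).indicator F p := by
      intro p hp
      have hp0 : 0 < p.1 := hp.1
      have e2 : Complex.polarCoord.symm p = p.1 * Complex.exp (Complex.I * p.2) := by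
        rw [Complex.polarCoord_symm_apply, mul_comm Complex.I, Complex.exp_mul_I]
        simp
      by_cases hpt : p.1 < t
      · rw [Set.indicator_of_mem (by simpa [abs_of_pos hp0] using hpt),
          Set.indicator_of_mem (by simpa using hpt), e2, smul_eq_mul]
      · rw [Set.indicator_of_notMem (by simpa [abs_of_pos hp0] using hpt),
          Set.indicator_of_notMem (by simpa using hpt), smul_zero]
    rw [setIntegral_congr_fun (measurableSet_Ioi.prod measurableSet_Ioo) e1,
      setIntegral_indicator (measurableSet_Iio.prod MeasurableSet.univ), Set.prod_inter_prod,
      Set.inter_univ, Set.Ioi_inter_Iio, Measure.volume_eq_prod, setIntegral_prod]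
    · rw [intervalIntegral.integral_of_le ht, integral_Ioc_eq_integral_Ioo]
      refine setIntegral_congr_fun measurableSet_Ioo fun r _ => ?_
      simp only [F]
      rw [integral_const_mul, ← integral_Ioc_eq_integral_Ioo,
        ← intervalIntegral.integral_of_le (by linarith)]
      congr 1
      have hper : Function.Periodic (fun θ : ℝ => E (r * Complex.exp (Complex.I * θ)))
          (2 * Real.pi) := fun θ => by
        simp only
        rw [show Complex.I * ((θ + 2 * Real.pi : ℝ) : ℂ) =
          Complex.I * θ + 2 * Real.pi * Complex.I by push_cast; ring, Complex.exp_periodic]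
      have := hper.intervalIntegral_add_eq (-Real.pi) 0
      rwa [zero_add, show -Real.pi + 2 * Real.pi = Real.pi by ring] at this
    · refine (hFc.continuousOn.integrableOn_compact
        (isCompact_Icc.prod isCompact_Icc)).mono_set
        (Set.prod_mono Set.Ioo_subset_Icc_self Set.Ioo_subset_Icc_self)
  -- translation and scaling to the fixed Gaussian
  have h6 : ∫ z : ℂ, {z : ℂ | ‖z‖ < t}.indicator E z =
      σ ^ 2 * ∫ y : ℂ, {y : ℂ | ‖σ • y - (ρ : ℂ)‖ < t}.indicator
        (fun y => Real.exp (-(‖y‖ ^ 2 / 4))) y := by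
    rw [← integral_sub_right_eq_self _ (ρ : ℂ)]
    have h7 := Measure.integral_comp_smul (volume : Measure ℂ)
      (fun z : ℂ => {z : ℂ | ‖z‖ < t}.indicator E (z - ρ)) σ
    rw [Complex.finrank_real_complex, abs_of_pos (by positivity), smul_eq_mul] at h7
    have e3 : ∀ y : ℂ, {z : ℂ | ‖z‖ < t}.indicator E (σ • y - ρ) =
        {y : ℂ | ‖σ • y - (ρ : ℂ)‖ < t}.indicator (fun y => Real.exp (-(‖y‖ ^ 2 / 4))) y := by
      intro y
      by_cases hy : ‖σ • y - (ρ : ℂ)‖ < t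
      · rw [Set.indicator_of_mem (by exact hy), Set.indicator_of_mem (by exact hy)]
        simp only [E]
        rw [add_sub_cancel, norm_smul, Real.norm_of_nonneg hσ.le]
        congr 1
        field_simp
      · rw [Set.indicator_of_notMem (by exact hy), Set.indicator_of_notMem (by exact hy)]
    simp_rw [e3] at h7
    rw [h7]
    field_simp
  rw [gaussianDiskMass, h1]
  have h8 : ∀ r : ℝ, r * ∫ ν in Set.Ioi (0 : ℝ),
      ν * Real.exp (-σ ^ 2 * ν ^ 2) * (besselJ 0 (ρ * ν) * besselJ 0 (r * ν)) =
      ((2 * Real.pi)⁻¹ * (2 * σ ^ 2)⁻¹) *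
        (r * ∫ θ in (0 : ℝ)..2 * Real.pi, E (r * Complex.exp (Complex.I * θ))) := by
    intro r
    rw [integral_mul_exp_mul_besselJ_mul_besselJ hσ, intervalIntegral.integral_const_mul]
    simp only [E]
    ring
  simp_rw [h8]
  rw [intervalIntegral.integral_const_mul, ← h5, h6]
  field_simp
  ring

/-! ### Inversion of the Hankel transform of a probability measure -/

section HankelInversion

variable {μ : Measure ℝ} [IsProbabilityMeasure μ]

lemma integrable_prod_besselJ_mul {K : ℝ → ℝ} (hK : IntegrableOn K (Set.Ioi 0)) :
    Integrable (fun p : ℝ × ℝ => besselJ 0 (p.1 * p.2) * K p.2)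
      (μ.prod (volume.restrict (Set.Ioi 0))) := by
  have h : Integrable (fun p : ℝ × ℝ => (1 : ℝ) * K p.2)
      (μ.prod (volume.restrict (Set.Ioi 0))) :=
    Integrable.mul_prod (f := fun _ : ℝ => (1 : ℝ)) (integrable_const 1) hK
  simp only [one_mul] at h
  refine h.bdd_mul (c := 1) (Continuous.aestronglyMeasurable (by fun_prop)) (ae_of_all _ fun p => ?_)
  exact abs_besselJ_zero_le _

lemma setIntegral_hankel_mul {Φ K : ℝ → ℝ} (hΦ : ∀ ν, ∫ ρ, besselJ 0 (ρ * ν) ∂μ = Φ ν)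
    (hK : IntegrableOn K (Set.Ioi 0)) :
    ∫ ν in Set.Ioi (0 : ℝ), Φ ν * K ν =
      ∫ ρ, (∫ ν in Set.Ioi (0 : ℝ), besselJ 0 (ρ * ν) * K ν) ∂μ := by
  rw [integral_integral_swap (f := fun ρ ν => besselJ 0 (ρ * ν) * K ν)
    (integrable_prod_besselJ_mul hK)]
  simp_rw [integral_mul_const, hΦ]

lemma abs_hankel_le_one {Φ : ℝ → ℝ} (hΦ : ∀ ν, ∫ ρ, besselJ 0 (ρ * ν) ∂μ = Φ ν) (ν : ℝ) :
    |Φ ν| ≤ 1 := by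
  rw [← hΦ, ← Real.norm_eq_abs]
  refine (norm_integral_le_of_norm_le_const (C := 1)
    (ae_of_all _ fun ρ => abs_besselJ_zero_le _)).trans ?_
  simp

lemma integrableOn_besselJ_one_mul_exp (t : ℝ) {σ : ℝ} (hσ : 0 < σ) :
    IntegrableOn (fun ν => besselJ 1 (t * ν) * Real.exp (-σ ^ 2 * ν ^ 2)) (Set.Ioi 0) := by
  refine Integrable.mono' ((integrableOn_mul_exp_neg_sq hσ).const_mul |t|)
    (Continuous.aestronglyMeasurable (by fun_prop)) ?_
  refine (ae_restrict_iff' measurableSet_Ioi).2 (ae_of_all _ fun ν hν => ?_)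
  rw [norm_mul, Real.norm_of_nonneg (Real.exp_nonneg _), ← mul_assoc]
  gcongr
  refine (abs_besselJ_one_le _).trans_eq ?_
  rw [abs_mul, abs_of_pos (Set.mem_Ioi.1 hν)]

/-- Inversion formula for the distribution function: the Hankel transform of a probability
measure determines the mass of the centred interval of radius `t`, if its end points carry
no mass. -/
theorem measureReal_abs_lt_eq_of_hankel {Φ : ℝ → ℝ}
    (hΦ : ∀ ν, ∫ ρ, besselJ 0 (ρ * ν) ∂μ = Φ ν) (hΦc : Continuous Φ) {t L : ℝ} (ht : 0 ≤ t)
    (hatom : μ {ρ | |ρ| = t} = 0)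
    (h : HasImproperIntegral (fun ν => Φ ν * besselJ 1 (t * ν)) L) :
    μ.real {ρ | |ρ| < t} = t * L := by
  have hK := fun {σ : ℝ} (hσ : 0 < σ) => integrableOn_besselJ_one_mul_exp t hσ
  have h1 := (h.tendsto_integral_mul_exp (by fun_prop) fun σ hσ => by
    have := (hK hσ).bdd_mul (c := 1) hΦc.aestronglyMeasurable
      (ae_of_all _ fun ν => abs_hankel_le_one hΦ ν)
    simpa only [IntegrableOn, mul_assoc] using this).const_mul t
  have h2 : ∀ σ : ℝ, 0 < σ → t * ∫ ν in Set.Ioi (0 : ℝ), Φ ν * besselJ 1 (t * ν) *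
      Real.exp (-σ ^ 2 * ν ^ 2) = ∫ ρ, gaussianDiskMass σ t ρ ∂μ := by
    intro σ hσ
    simp_rw [← integral_besselJ_mul_besselJ_one_mul_exp hσ ht, mul_assoc]
    rw [setIntegral_hankel_mul hΦ (hK hσ), integral_const_mul]
  have hmeas : MeasurableSet {ρ : ℝ | |ρ| < t} := measurableSet_lt (by fun_prop) (by fun_prop)
  have h3 : Tendsto (fun σ => ∫ ρ, gaussianDiskMass σ t ρ ∂μ) (𝓝[>] 0)
      (𝓝 (∫ ρ, {ρ : ℝ | |ρ| < t}.indicator 1 ρ ∂μ)) := by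
    refine tendsto_integral_filter_of_dominated_convergence (fun _ => 1) ?_ ?_
      (integrable_const 1) ?_
    · filter_upwards [self_mem_nhdsWithin] with σ hσ
      have := ((integrable_prod_besselJ_mul (μ := μ) (hK hσ)).integral_prod_left.const_mul
        t).aestronglyMeasurable
      simp_rw [← mul_assoc _ (besselJ 1 _), integral_besselJ_mul_besselJ_one_mul_exp hσ ht] at this
      exact this
    · filter_upwards [self_mem_nhdsWithin] with σ hσ
      exact ae_of_all _ fun ρ => abs_gaussianDiskMass_le σ t ρ
    · have : ∀ᵐ ρ ∂μ, |ρ| ≠ t := by rw [ae_iff]; simpa using hatom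
      filter_upwards [this] with ρ hρ
      have := tendsto_gaussianDiskMass hρ
      simpa only [Set.indicator_apply, Set.mem_ofPred_eq, Pi.one_apply] using this
  rw [integral_indicator_one hmeas] at h3
  refine tendsto_nhds_unique h3 (h1.congr' ?_)
  filter_upwards [self_mem_nhdsWithin] with σ hσ
  exact h2 σ hσ

/-- The density given by the inversion formula is nonnegative, being a limit of averages of
Gaussians. -/
theorem nonneg_of_hankel {Φ : ℝ → ℝ}
    (hΦ : ∀ ν, ∫ ρ, besselJ 0 (ρ * ν) ∂μ = Φ ν) (hΦc : Continuous Φ) {r L : ℝ}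
    (h : HasImproperIntegral (fun ν => Φ ν * (ν * besselJ 0 (r * ν))) L) : 0 ≤ L := by
  have hK : ∀ σ : ℝ, 0 < σ → IntegrableOn
      (fun ν => ν * besselJ 0 (r * ν) * Real.exp (-σ ^ 2 * ν ^ 2)) (Set.Ioi 0) := by
    intro σ hσ
    refine ((integrableOn_mul_exp_neg_sq hσ).bdd_mul (c := 1)
      (f := fun ν => besselJ 0 (r * ν)) (Continuous.aestronglyMeasurable (by fun_prop))
      (ae_of_all _ fun ν => abs_besselJ_zero_le _)).congr (ae_of_all _ fun ν => ?_)
    simp only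
    ring
  have h1 := h.tendsto_integral_mul_exp (by fun_prop) fun σ hσ => by
    have := (hK σ hσ).bdd_mul (c := 1) hΦc.aestronglyMeasurable
      (ae_of_all _ fun ν => abs_hankel_le_one hΦ ν)
    simpa only [IntegrableOn, mul_assoc] using this
  refine ge_of_tendsto h1 ?_
  filter_upwards [self_mem_nhdsWithin] with σ hσ
  simp_rw [mul_assoc (Φ _)]
  rw [setIntegral_hankel_mul hΦ (hK σ hσ)]
  refine integral_nonneg fun ρ => ?_
  refine (integral_mul_exp_mul_besselJ_mul_besselJ_nonneg hσ ρ r).trans_eq ?_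
  refine integral_congr_ae (ae_of_all _ fun ν => ?_)
  simp only
  ring

end HankelInversion

/-! ### The law of the envelope -/

lemma measurable_nakagamiDensity (m w : ℝ) : Measurable (nakagamiDensity m w) :=
  Measurable.ite measurableSet_Ioi (by fun_prop) measurable_const

lemma integral_nakagamiMeasure {m w : ℝ} (hm : 0 < m) (hw : 0 < w) (g : ℝ → ℝ) :
    ∫ x, g x ∂(nakagamiMeasure m w) = ∫ x in Set.Ioi 0, nakagamiDensity m w x * g x := by
  rw [nakagamiMeasure, integral_withDensity_eq_integral_toReal_smul
    (measurable_nakagamiDensity m w).ennreal_ofReal (ae_of_all _ fun _ => ENNReal.ofReal_lt_top)]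
  simp_rw [ENNReal.toReal_ofReal (nakagamiDensity_nonneg hm hw _), smul_eq_mul]
  refine (setIntegral_eq_integral_of_forall_compl_eq_zero fun x hx => ?_).symm
  rw [nakagamiDensity, if_neg (by exact hx), zero_mul]

lemma isProbabilityMeasure_nakagamiMeasure {m w : ℝ} (hm : 0 < m) (hw : 0 < w) :
    IsProbabilityMeasure (nakagamiMeasure m w) := by
  have h0 : ∀ x, x ∉ Set.Ioi (0 : ℝ) → nakagamiDensity m w x = 0 := fun x hx => if_neg hx
  have hint : Integrable (nakagamiDensity m w) :=
    (integrableOn_iff_integrable_of_support_subset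
      (Function.support_subset_iff'.2 h0)).1 (integrableOn_nakagamiDensity hm hw)
  refine ⟨?_⟩
  rw [nakagamiMeasure, withDensity_apply _ MeasurableSet.univ, Measure.restrict_univ,
    ← ofReal_integral_eq_lintegral_ofReal hint (ae_of_all _ (nakagamiDensity_nonneg hm hw)),
    ← setIntegral_eq_integral_of_forall_compl_eq_zero h0, integral_nakagamiDensity hm hw,
    ENNReal.ofReal_one]

lemma integral_cond_Icc_zero_two_pi (g : ℝ → ℝ) :
    ∫ θ, g θ ∂(cond volume (Set.Icc 0 (2 * Real.pi))) =
      (2 * Real.pi)⁻¹ * ∫ θ in (0 : ℝ)..2 * Real.pi, g θ := by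
  have hpi := Real.pi_pos
  rw [ProbabilityTheory.cond, integral_smul_measure, Real.volume_Icc, sub_zero, ENNReal.toReal_inv,
    ENNReal.toReal_ofReal (by positivity), smul_eq_mul,
    intervalIntegral.integral_of_le (by positivity), integral_Icc_eq_integral_Ioc]

section Phases

variable {S : Type*} [MeasurableSpace S] {P : Measure S} [IsProbabilityMeasure P]

/-- Averaging over an independent uniform phase factorizes `J₀` of the modulus of a sum. -/
lemma integral_besselJ_zero_norm_add_phase {X : S → ℂ} {v θ : S → ℝ}
    (hX : AEMeasurable X P) (hv : AEMeasurable v P)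
    (hθ : HasLaw θ (cond volume (Set.Icc 0 (2 * Real.pi))) P)
    (hind : IndepFun (fun s => (X s, v s)) θ P) :
    ∫ s, besselJ 0 ‖X s + v s * Complex.exp (Complex.I * θ s)‖ ∂P =
      ∫ s, besselJ 0 ‖X s‖ * besselJ 0 (v s) ∂P := by
  have hpi := Real.pi_pos
  have hY : AEMeasurable (fun s => (X s, v s)) P := hX.prodMk hv
  have hlaw := (indepFun_iff_map_prod_eq_prod_map_map hY hθ.aemeasurable).1 hind
  have hpU : IsProbabilityMeasure (P.map θ) := Measure.isProbabilityMeasure_map hθ.aemeasurable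
  have hpY : IsProbabilityMeasure (P.map fun s => (X s, v s)) :=
    Measure.isProbabilityMeasure_map hY
  set G : (ℂ × ℝ) × ℝ → ℝ := fun p =>
    besselJ 0 ‖p.1.1 + p.1.2 * Complex.exp (Complex.I * p.2)‖
  have hG : Continuous G := by simp only [G]; fun_prop
  calc ∫ s, besselJ 0 ‖X s + v s * Complex.exp (Complex.I * θ s)‖ ∂P
      = ∫ p, G p ∂(P.map fun s => ((X s, v s), θ s)) :=
        (integral_map (hY.prodMk hθ.aemeasurable) hG.aestronglyMeasurable).symm
    _ = ∫ y, besselJ 0 ‖y.1‖ * besselJ 0 y.2 ∂(P.map fun s => (X s, v s)) := by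
        rw [hlaw, integral_prod _ (Integrable.of_bound hG.aestronglyMeasurable 1
          (ae_of_all _ fun p => abs_besselJ_zero_le _))]
        refine integral_congr_ae (ae_of_all _ fun y => ?_)
        simp only [G]
        rw [hθ.map_eq, integral_cond_Icc_zero_two_pi, integral_besselJ_zero_norm_add]
        field_simp
    _ = _ := integral_map hY (Continuous.aestronglyMeasurable (by fun_prop))

variable {N : ℕ} {φ : Fin N → S → ℝ}

/-- The characteristic function of the specular part, adding one wave at a time. -/
lemma integral_besselJ_zero_norm_sum
    (hφ : ∀ i, HasLaw (φ i) (cond volume (Set.Icc 0 (2 * Real.pi))) P) (hind : iIndepFun φ P)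
    (V : Fin N → ℝ) (s : Finset (Fin N)) :
    ∫ x, besselJ 0 ‖∑ i ∈ s, (V i : ℂ) * Complex.exp (Complex.I * φ i x)‖ ∂P =
      ∏ i ∈ s, besselJ 0 (V i) := by
  induction s using Finset.induction_on with
  | empty => simp
  | insert i s hi ih =>
    have hm : ∀ j, AEMeasurable (φ j) P := fun j => (hφ j).aemeasurable
    have hexp : ∀ j, Measurable fun x : ℝ => (V j : ℂ) * Complex.exp (Complex.I * x) := fun j =>
      Continuous.measurable (by fun_prop)
    have hX : AEMeasurable
        (fun x => ∑ j ∈ s, (V j : ℂ) * Complex.exp (Complex.I * φ j x)) P :=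
      Finset.aemeasurable_fun_sum _ fun j _ => (hexp j).comp_aemeasurable (hm j)
    have h1 := hind.indepFun_finset₀ s {i} (by simpa using hi) hm
    have h2 : IndepFun (fun x => (∑ j ∈ s, (V j : ℂ) * Complex.exp (Complex.I * φ j x), V i))
        (φ i) P := by
      have hk : Measurable fun y : ({i} : Finset (Fin N)) → ℝ => y ⟨i, by simp⟩ :=
        measurable_pi_apply _
      have := h1.comp (φ := fun y : s → ℝ =>
          (∑ j : s, (V j : ℂ) * Complex.exp (Complex.I * y j), V i))
        (Continuous.measurable (by fun_prop)) hk
      convert this using 1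
      · funext x
        simp only [Function.comp]
        rw [← Finset.sum_coe_sort s]
      · rfl
    have h3 := integral_besselJ_zero_norm_add_phase hX aemeasurable_const (hφ i) h2
    rw [integral_mul_const, ih] at h3
    simp_rw [Finset.sum_insert hi, Finset.prod_insert hi, add_comm ((V i : ℂ) * _)]
    rw [h3, mul_comm]

end Phases

section Model

variable {S : Type*} [MeasurableSpace S] {P : Measure S} {N : ℕ} {m w : ℝ} {V : Fin N → ℝ}
  {φ : Fin N → S → ℝ} {φd Vd : S → ℝ}

lemma IsMWGD.aemeasurable_elim (h : IsMWGD P N m w φ φd Vd) (k : Fin N ⊕ Fin 2) :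
    AEMeasurable ((Sum.elim φ ![φd, Vd] : Fin N ⊕ Fin 2 → S → ℝ) k) P := by
  rcases k with i | k
  · exact (h.uniform_specular i).aemeasurable
  · fin_cases k
    · exact h.uniform_diffuse.aemeasurable
    · exact h.nakagami.aemeasurable

lemma IsMWGD.aemeasurable_specularSum (h : IsMWGD P N m w φ φd Vd) (V : Fin N → ℝ) :
    AEMeasurable (fun s => ∑ i, (V i : ℂ) * Complex.exp (Complex.I * φ i s)) P :=
  Finset.aemeasurable_fun_sum _ fun i _ =>
    (Continuous.measurable (by fun_prop) :
      Measurable fun x : ℝ => (V i : ℂ) * Complex.exp (Complex.I * x)).comp_aemeasurable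
      (h.uniform_specular i).aemeasurable

lemma IsMWGD.aemeasurable_envelope (h : IsMWGD P N m w φ φd Vd) (V : Fin N → ℝ) :
    AEMeasurable (envelope V φ φd Vd) P := by
  have h1 := h.aemeasurable_specularSum V
  have h2 := h.uniform_diffuse.aemeasurable
  have h3 := h.nakagami.aemeasurable
  have h4 : AEMeasurable (fun s => (Vd s : ℂ) * Complex.exp (Complex.I * φd s)) P :=
    (Continuous.measurable (by fun_prop) :
      Measurable fun p : ℝ × ℝ => (p.1 : ℂ) * Complex.exp (Complex.I * p.2)).comp_aemeasurable
      (h3.prodMk h2)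
  exact (h1.add h4).norm

lemma IsMWGD.indepFun_diffuse_phase (h : IsMWGD P N m w φ φd Vd) (V : Fin N → ℝ) :
    IndepFun (fun s => (∑ i, (V i : ℂ) * Complex.exp (Complex.I * φ i s), Vd s)) φd P := by
  have h1 := h.indep.indepFun_finset₀ (Finset.univ.erase (Sum.inr 0)) {Sum.inr 0} (by simp)
    h.aemeasurable_elim
  have hg : Measurable fun y : (Finset.univ.erase (Sum.inr 0 : Fin N ⊕ Fin 2)) → ℝ =>
      (∑ i, (V i : ℂ) * Complex.exp (Complex.I * (y ⟨Sum.inl i, by simp⟩ : ℝ)),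
        y ⟨Sum.inr 1, by simp⟩) := Continuous.measurable (by fun_prop)
  have hk : Measurable fun y : ({Sum.inr 0} : Finset (Fin N ⊕ Fin 2)) → ℝ =>
      y ⟨Sum.inr 0, by simp⟩ := measurable_pi_apply _
  exact h1.comp hg hk

lemma IsMWGD.indepFun_diffuse_amplitude (h : IsMWGD P N m w φ φd Vd) (V : Fin N → ℝ) :
    IndepFun (fun s => (∑ i, (V i : ℂ) * Complex.exp (Complex.I * φ i s), φd s)) Vd P := by
  have h1 := h.indep.indepFun_finset₀ (Finset.univ.erase (Sum.inr 1)) {Sum.inr 1} (by simp)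
    h.aemeasurable_elim
  have hg : Measurable fun y : (Finset.univ.erase (Sum.inr 1 : Fin N ⊕ Fin 2)) → ℝ =>
      (∑ i, (V i : ℂ) * Complex.exp (Complex.I * (y ⟨Sum.inl i, by simp⟩ : ℝ)),
        y ⟨Sum.inr 0, by simp⟩) := Continuous.measurable (by fun_prop)
  have hk : Measurable fun y : ({Sum.inr 1} : Finset (Fin N ⊕ Fin 2)) → ℝ =>
      y ⟨Sum.inr 1, by simp⟩ := measurable_pi_apply _
  exact h1.comp hg hk

variable [IsProbabilityMeasure P]

/-- `Φ` is the Hankel transform of the law of the envelope. -/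
theorem IsMWGD.integral_besselJ_envelope (h : IsMWGD P N m w φ φd Vd) (hm : 0 < m) (hw : 0 < w)
    (V : Fin N → ℝ) (ν : ℝ) :
    ∫ ρ, besselJ 0 (ρ * ν) ∂(P.map (envelope V φ φd Vd)) = mwgdPhi m w V ν := by
  rw [integral_map (h.aemeasurable_envelope V) (Continuous.aestronglyMeasurable (by fun_prop))]
  set X : S → ℂ := fun s => ∑ i, ((V i * ν : ℝ) : ℂ) * Complex.exp (Complex.I * φ i s)
  have hX : AEMeasurable X P := h.aemeasurable_specularSum fun i => V i * ν
  have hVd := h.nakagami.aemeasurable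
  have h1 : ∀ s, besselJ 0 (envelope V φ φd Vd s * ν) =
      besselJ 0 ‖X s + ((Vd s * ν : ℝ) : ℂ) * Complex.exp (Complex.I * φd s)‖ := by
    intro s
    rw [← besselJ_zero_abs (_ * ν), envelope, abs_mul, abs_norm, ← Real.norm_eq_abs ν,
      ← Complex.norm_real ν, ← norm_mul, add_mul, Finset.sum_mul]
    congr 2
    push_cast
    congr 1
    · exact Finset.sum_congr rfl fun i _ => by push_cast; ring
    · ring
  simp_rw [h1]
  have hind : IndepFun (fun s => (X s, Vd s * ν)) φd P :=
    (h.indepFun_diffuse_phase fun i => V i * ν).comp (φ := fun p : ℂ × ℝ => (p.1, p.2 * ν))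
      (ψ := id) (by fun_prop) measurable_id
  rw [integral_besselJ_zero_norm_add_phase hX (hVd.mul_const ν) h.uniform_diffuse hind]
  have hind' : IndepFun (fun s => besselJ 0 ‖X s‖) (fun s => besselJ 0 (Vd s * ν)) P :=
    (h.indepFun_diffuse_amplitude fun i => V i * ν).comp
      (φ := fun p : ℂ × ℝ => besselJ 0 ‖p.1‖) (ψ := fun x => besselJ 0 (x * ν))
      (Continuous.measurable (by fun_prop)) (Continuous.measurable (by fun_prop))
  rw [hind'.integral_fun_mul_eq_mul_integral
    ((Continuous.measurable (by fun_prop) : Measurable fun z : ℂ =>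
      besselJ 0 ‖z‖).comp_aemeasurable hX).aestronglyMeasurable
    ((Continuous.measurable (by fun_prop) : Measurable fun x : ℝ =>
      besselJ 0 (x * ν)).comp_aemeasurable hVd).aestronglyMeasurable]
  have hφ : iIndepFun φ P := h.indep.precomp (g := Sum.inl) Sum.inl_injective
  rw [integral_besselJ_zero_norm_sum h.uniform_specular hφ, mul_comm, mwgdPhi]
  congr 1
  have := h.nakagami.integral_comp (f := fun x => besselJ 0 (x * ν))
    (Continuous.aestronglyMeasurable (by fun_prop))
  simp only [Function.comp] at this
  rw [this, integral_nakagamiMeasure hm hw, ← integral_nakagami_besselJ_zero hm hw]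
  simp_rw [mul_comm ν]

/-- The envelope has no atoms: given the phases, `R = c` is a nontrivial quadratic equation for
the diffuse amplitude. -/
lemma IsMWGD.map_envelope_singleton (h : IsMWGD P N m w φ φd Vd) (hm : 0 < m) (hw : 0 < w)
    (V : Fin N → ℝ) (c : ℝ) : P.map (envelope V φ φd Vd) {c} = 0 := by
  set X : S → ℂ := fun s => ∑ i, (V i : ℂ) * Complex.exp (Complex.I * φ i s)
  have hX : AEMeasurable X P := h.aemeasurable_specularSum V
  have hY : AEMeasurable (fun s => (X s, φd s)) P := hX.prodMk h.uniform_diffuse.aemeasurable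
  have hlaw := (indepFun_iff_map_prod_eq_prod_map_map hY h.nakagami.aemeasurable).1
    (h.indepFun_diffuse_amplitude V)
  have := isProbabilityMeasure_nakagamiMeasure hm hw
  set G : (ℂ × ℝ) × ℝ → ℝ := fun p => ‖p.1.1 + p.2 * Complex.exp (Complex.I * p.1.2)‖
  have hG : Measurable G := Continuous.measurable (by simp only [G]; fun_prop)
  have hmap : P.map (envelope V φ φd Vd) =
      (((P.map fun s => (X s, φd s)).prod (nakagamiMeasure m w)).map G) := by
    rw [← h.nakagami.map_eq, ← hlaw, AEMeasurable.map_map_of_aemeasurable hG.aemeasurable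
      (hY.prodMk h.nakagami.aemeasurable)]
    rfl
  rw [hmap, Measure.map_apply hG (measurableSet_singleton c),
    Measure.measure_prod_null (hG (measurableSet_singleton c))]
  refine ae_of_all _ fun y => ?_
  have hac : nakagamiMeasure m w ≪ volume := withDensity_absolutelyContinuous _ _
  refine hac (Set.Finite.measure_zero ?_ _)
  -- dividing by the phase factor `u` makes the diffuse component real
  set u : ℂ := Complex.exp (Complex.I * y.2)
  set a : ℂ := y.1 * u⁻¹
  have hu : ‖u‖ = 1 := by
    simp only [u]; rw [mul_comm, Complex.norm_exp_ofReal_mul_I]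
  have hu0 : u ≠ 0 := Complex.exp_ne_zero _
  refine (Set.toFinite {√(c ^ 2 - a.im ^ 2) - a.re, -√(c ^ 2 - a.im ^ 2) - a.re}).subset ?_
  intro x hx
  have hx1 : ‖y.1 + x * u‖ = c := hx
  have hx2 : ‖a + x‖ = c := by
    rw [← hx1, ← mul_one ‖a + x‖, ← hu, ← norm_mul, add_mul, inv_mul_cancel_right₀ hu0]
  have hx3 : (a.re + x) ^ 2 = c ^ 2 - a.im ^ 2 := by
    rw [← hx2, ← Complex.normSq_eq_norm_sq, Complex.normSq_apply]
    simp only [Complex.add_re, Complex.ofReal_re, Complex.add_im, Complex.ofReal_im]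
    ring
  rw [← hx3, Real.sqrt_sq_eq_abs]
  rcases abs_choice (a.re + x) with e | e <;> rw [e] <;> simp

end Model

/-! ### The distribution function and the density -/

lemma HasImproperIntegral.unique {g : ℝ → ℝ} {L L' : ℝ} (h : HasImproperIntegral g L)
    (h' : HasImproperIntegral g L') : L = L' :=
  tendsto_nhds_unique h.2 h'.2

/-- A measure on `ℝ` carried by an open set `G` has density `f` if it assigns the mass `∫ f` to
the intervals whose closure lies in `G`. -/
lemma eq_withDensity_of_Icc_subset {μ : Measure ℝ} [IsFiniteMeasure μ] {f : ℝ → ℝ} {G : Set ℝ}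
    (hG : IsOpen G) (hf : ∀ x, 0 ≤ f x) (hμ : μ Gᶜ = 0)
    (hfG : (volume.withDensity fun x => ENNReal.ofReal (f x)) Gᶜ = 0)
    (h : ∀ a b, a ≤ b → Set.Icc a b ⊆ G →
      IntervalIntegrable f volume a b ∧ ∫ x in a..b, f x = μ.real (Set.Ioc a b)) :
    μ = volume.withDensity fun x => ENNReal.ofReal (f x) := by
  set ν : Measure ℝ := volume.withDensity fun x => ENNReal.ofReal (f x) with hν
  have hIoc : ∀ a b, a ≤ b → Set.Icc a b ⊆ G → ν (Set.Ioc a b) = μ (Set.Ioc a b) := by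
    intro a b hab hsub
    obtain ⟨hi, he⟩ := h a b hab hsub
    rw [hν, withDensity_apply _ measurableSet_Ioc, ← ofReal_integral_eq_lintegral_ofReal
      ((intervalIntegrable_iff_integrableOn_Ioc_of_le hab).1 hi) (ae_of_all _ hf),
      ← intervalIntegral.integral_of_le hab, he, ofReal_measureReal]
  have hres : ∀ a b, a ≤ b → Set.Icc a b ⊆ G →
      μ.restrict (Set.Ioc a b) = ν.restrict (Set.Ioc a b) := by
    intro a b hab hsub
    refine Measure.ext_of_Iic _ _ fun c => ?_
    rw [Measure.restrict_apply measurableSet_Iic, Measure.restrict_apply measurableSet_Iic,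
      Set.inter_comm, Set.Ioc_inter_Iic]
    rcases le_total a (min b c) with hc | hc
    · exact (hIoc a _ hc ((Set.Icc_subset_Icc_right (min_le_left _ _)).trans hsub)).symm
    · rw [Set.Ioc_eq_empty (not_lt.2 hc), measure_empty, measure_empty]
  set ι := {p : ℚ × ℚ // (p.1 : ℝ) ≤ p.2 ∧ Set.Icc (p.1 : ℝ) p.2 ⊆ G}
  have hcover : G = ⋃ p : ι, Set.Ioc (p.1.1 : ℝ) p.1.2 := by
    refine Set.Subset.antisymm (fun x hx => ?_)
      (Set.iUnion_subset fun p => Set.Ioc_subset_Icc_self.trans p.2.2)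
    obtain ⟨l, u, hx', hlu⟩ := mem_nhds_iff_exists_Ioo_subset.1 (hG.mem_nhds hx)
    obtain ⟨p, hp1, hp2⟩ := exists_rat_btwn hx'.1
    obtain ⟨q, hq1, hq2⟩ := exists_rat_btwn hx'.2
    refine Set.mem_iUnion.2 ⟨⟨(p, q), (hp2.trans hq1).le, fun y hy => hlu ?_⟩, hp2, hq1.le⟩
    exact ⟨hp1.trans_le hy.1, hy.2.trans_lt hq2⟩
  have hGG : μ.restrict G = ν.restrict G := by
    rw [hcover]
    exact Measure.restrict_iUnion_congr.2 fun p => hres _ _ p.2.1 p.2.2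
  rw [← Measure.restrict_eq_self_of_ae_mem (μ := μ) (s := G) (by rw [ae_iff]; exact hμ), hGG,
    Measure.restrict_eq_self_of_ae_mem (by rw [ae_iff]; exact hfG)]

section Density

variable {N : ℕ} {m w : ℝ} {V : Fin N → ℝ}

open Classical in
/-- The density of the envelope: `r ∫₀^∞ Φ(ν) ν J₀(rν) dν` where the improper integral converges,
and `0` where it does not and for `r ≤ 0`. -/
noncomputable def envelopeDensity {N : ℕ} (m w : ℝ) (V : Fin N → ℝ) (r : ℝ) : ℝ :=
  if h : 0 < r ∧ ∃ L : ℝ,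
    HasImproperIntegral (fun ν => mwgdPhi m w V ν * (ν * besselJ 0 (r * ν))) L then
  r * h.2.choose else 0

lemma envelopeDensity_eq {r L : ℝ} (hr : 0 ≤ r)
    (h : HasImproperIntegral (fun ν => mwgdPhi m w V ν * (ν * besselJ 0 (r * ν))) L) :
    envelopeDensity m w V r = r * L := by
  rcases hr.eq_or_lt with rfl | hr
  · rw [envelopeDensity, dif_neg (by simp), zero_mul]
  · have h' : 0 < r ∧ ∃ L : ℝ,
      HasImproperIntegral (fun ν => mwgdPhi m w V ν * (ν * besselJ 0 (r * ν))) L := ⟨hr, L, h⟩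
    rw [envelopeDensity, dif_pos h', h'.2.choose_spec.unique h]

lemma envelopeDensity_of_nonpos {r : ℝ} (hr : r ≤ 0) : envelopeDensity m w V r = 0 :=
  dif_neg fun h => hr.not_gt h.1

/-- The density truncated at the frequency `T`. -/
noncomputable def truncatedDensity {N : ℕ} (m w : ℝ) (V : Fin N → ℝ) (T r : ℝ) : ℝ :=
  r * ∫ ν in (0 : ℝ)..T, mwgdPhi m w V ν * (ν * besselJ 0 (r * ν))

lemma continuous_truncatedDensity (hm : 0 ≤ m) (w : ℝ) (V : Fin N → ℝ) (T : ℝ) :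
    Continuous (truncatedDensity m w V T) := by
  have := continuous_mwgdPhi hm w V
  refine continuous_id.mul
    (intervalIntegral.continuous_parametric_intervalIntegral_of_continuous' ?_ _ _)
  unfold Function.uncurry
  fun_prop

lemma tendsto_truncatedDensity {r : ℝ} (hr : 0 ≤ r)
    (h : ∃ L, HasImproperIntegral (fun ν => mwgdPhi m w V ν * (ν * besselJ 0 (r * ν))) L) :
    Tendsto (fun T => truncatedDensity m w V T r) atTop (𝓝 (envelopeDensity m w V r)) := by
  obtain ⟨L, hL⟩ := h
  rw [envelopeDensity_eq hr hL]
  exact hL.2.const_mul r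

lemma integral_truncatedDensity (hm : 0 ≤ m) (w : ℝ) (V : Fin N → ℝ) (T a b : ℝ) :
    ∫ r in a..b, truncatedDensity m w V T r =
      b * (∫ ν in (0 : ℝ)..T, mwgdPhi m w V ν * besselJ 1 (b * ν)) -
        a * ∫ ν in (0 : ℝ)..T, mwgdPhi m w V ν * besselJ 1 (a * ν) := by
  have hc := continuous_mwgdPhi hm w V
  have h1 : ∀ r, truncatedDensity m w V T r =
      ∫ ν in (0 : ℝ)..T, mwgdPhi m w V ν * (r * ν * besselJ 0 (r * ν)) := by
    intro r
    rw [truncatedDensity, ← intervalIntegral.integral_const_mul]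
    exact intervalIntegral.integral_congr fun ν _ => by ring
  simp_rw [h1]
  rw [intervalIntegral_swap_of_continuous (by unfold Function.uncurry; fun_prop)]
  simp_rw [intervalIntegral.integral_const_mul, integral_mul_besselJ_zero]
  rw [← intervalIntegral.integral_const_mul, ← intervalIntegral.integral_const_mul,
    ← intervalIntegral.integral_sub
      (Continuous.intervalIntegrable (by fun_prop) _ _)
      (Continuous.intervalIntegrable (by fun_prop) _ _)]
  exact intervalIntegral.integral_congr fun ν _ => by ring

/-- On an interval of nonresonant radii, the integral of the density is the increment of the
distribution function: this holds for the truncated densities up to the truncation of the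
distribution function, and they are bounded uniformly in the truncation. -/
lemma integral_envelopeDensity (hm : 0 < m) (hw : 0 < w) (hV : ∀ i, 0 ≤ V i)
    (hA : 1 / 4 < m ∨ ∃ i, 0 < V i) {a b La Lb : ℝ} (hab : a ≤ b)
    (hsub : Set.Icc a b ⊆ Set.Ioi 0 \ resonantRadii V)
    (ha : HasImproperIntegral (fun ν => mwgdPhi m w V ν * besselJ 1 (a * ν)) La)
    (hb : HasImproperIntegral (fun ν => mwgdPhi m w V ν * besselJ 1 (b * ν)) Lb) :
    IntervalIntegrable (envelopeDensity m w V) volume a b ∧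
      ∫ r in a..b, envelopeDensity m w V r = b * Lb - a * La := by
  obtain ⟨δ, hδ, hsep⟩ := exists_separation (V := V) (isCompact_Icc (a := a) (b := b))
    fun r hr => hsub hr
  obtain ⟨C, q, hC, hq, hT⟩ := exists_tailBound_density hm hw hV hA hδ
  have hlim : ∀ r ∈ Set.Icc a b,
      Tendsto (fun n : ℕ => truncatedDensity m w V n r) atTop (𝓝 (envelopeDensity m w V r)) := by
    intro r hr
    have hr' := hsub hr
    exact (tendsto_truncatedDensity (le_of_lt hr'.1)
      (exists_hasImproperIntegral_density hm hw hV hA hr'.1 (Or.inl hr'.2))).comp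
      tendsto_natCast_atTop_atTop
  have hbd : ∀ (n : ℕ), ∀ r ∈ Set.Icc a b, ‖truncatedDensity m w V n r‖ ≤ b * (1 + C) := by
    intro n r hr
    have hr0 : 0 < r := (hsub hr).1
    have h1 := (hT r (hsep r hr).1 (hsep r hr).2).abs_integral_le hC
      (continuous_density_integrand hm.le w V r) (D := 1) (fun ν hν => by
        rw [abs_mul, abs_mul, abs_of_nonneg hν.1]
        exact mul_le_one₀ (abs_mwgdPhi_le_one hm hw V ν) (mul_nonneg hν.1 (abs_nonneg _))
          (mul_le_one₀ hν.2 (abs_nonneg _) (abs_besselJ_zero_le _))) (Nat.cast_nonneg n)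
    rw [truncatedDensity, norm_mul, Real.norm_of_nonneg hr0.le]
    exact mul_le_mul hr.2 h1 (norm_nonneg _) (hr0.le.trans hr.2)
  have huIoc : ∀ r ∈ Set.uIoc a b, r ∈ Set.Icc a b := fun r hr => by
    rw [Set.uIoc_of_le hab] at hr
    exact Set.Ioc_subset_Icc_self hr
  have hmeas : ∀ n : ℕ, AEStronglyMeasurable (truncatedDensity m w V n)
      (volume.restrict (Set.uIoc a b)) := fun n =>
    (continuous_truncatedDensity hm.le w V n).aestronglyMeasurable
  have hlim' : ∀ᵐ r ∂(volume.restrict (Set.uIoc a b)),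
      Tendsto (fun n : ℕ => truncatedDensity m w V n r) atTop (𝓝 (envelopeDensity m w V r)) :=
    (ae_restrict_iff' measurableSet_uIoc).2 (ae_of_all _ fun r hr => hlim r (huIoc r hr))
  constructor
  · rw [intervalIntegrable_iff]
    refine IntegrableOn.of_bound (by simp) (aestronglyMeasurable_of_tendsto_ae atTop hmeas hlim')
      (b * (1 + C)) ((ae_restrict_iff' measurableSet_uIoc).2 (ae_of_all _ fun r hr => ?_))
    exact le_of_tendsto' (hlim r (huIoc r hr)).norm fun n => hbd n r (huIoc r hr)
  · have h1 := intervalIntegral.tendsto_integral_filter_of_dominated_convergence (μ := volume)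
      (a := a) (b := b) (F := fun n : ℕ => truncatedDensity m w V n) (l := atTop)
      (f := envelopeDensity m w V) (fun _ => b * (1 + C))
      (Eventually.of_forall hmeas)
      (Eventually.of_forall fun n => ae_of_all _ fun r hr => hbd n r (huIoc r hr))
      intervalIntegrable_const (ae_of_all _ fun r hr => hlim r (huIoc r hr))
    simp_rw [integral_truncatedDensity hm.le] at h1
    exact tendsto_nhds_unique h1
      (((hb.2.comp tendsto_natCast_atTop_atTop).const_mul b).sub
        ((ha.2.comp tendsto_natCast_atTop_atTop).const_mul a))

lemma aemeasurable_envelopeDensity (hm : 0 < m) (hw : 0 < w) (hV : ∀ i, 0 ≤ V i)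
    (hA : 1 / 4 < m ∨ ∃ i, 0 < V i) : AEMeasurable (envelopeDensity m w V) := by
  refine aemeasurable_of_tendsto_metrizable_ae atTop
    (f := fun n : ℕ => (Set.Ioi 0).indicator (truncatedDensity m w V n))
    (fun n => ((continuous_truncatedDensity hm.le w V n).measurable.indicator
      measurableSet_Ioi).aemeasurable) ?_
  filter_upwards [compl_mem_ae_iff.2 ((finite_resonantRadii V).measure_zero volume)] with r hres
  rcases lt_or_ge 0 r with hr | hr
  · simp only [Set.indicator_of_mem (Set.mem_Ioi.2 hr)]
    exact (tendsto_truncatedDensity hr.le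
      (exists_hasImproperIntegral_density hm hw hV hA hr (Or.inl hres))).comp
      tendsto_natCast_atTop_atTop
  · simp only [Set.indicator_of_notMem (Set.notMem_Ioi.2 hr), envelopeDensity_of_nonpos hr]
    exact tendsto_const_nhds

end Density

section Law

variable {S : Type*} [MeasurableSpace S] {P : Measure S}
  {N : ℕ} {m w : ℝ} {V : Fin N → ℝ} {φ : Fin N → S → ℝ} {φd Vd : S → ℝ}

lemma IsMWGD.map_envelope_Iio_zero (h : IsMWGD P N m w φ φd Vd) (V : Fin N → ℝ) :
    P.map (envelope V φ φd Vd) (Set.Iio 0) = 0 := by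
  rw [Measure.map_apply_of_aemeasurable (h.aemeasurable_envelope V) measurableSet_Iio]
  convert measure_empty (μ := P)
  exact Set.eq_empty_of_forall_notMem fun s hs => (norm_nonneg _).not_gt hs

/-- Without specular waves the envelope is the diffuse amplitude. -/
lemma IsMWGD.map_envelope_of_eq_zero (h : IsMWGD P N m w φ φd Vd) (hV : ∀ i, V i = 0) :
    P.map (envelope V φ φd Vd) = nakagamiMeasure m w := by
  have h1 : envelope V φ φd Vd = fun s => |Vd s| := by
    funext s
    simp only [envelope, hV, Complex.ofReal_zero, zero_mul, Finset.sum_const_zero, zero_add]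
    rw [norm_mul, mul_comm Complex.I, Complex.norm_exp_ofReal_mul_I, mul_one, Complex.norm_real,
      Real.norm_eq_abs]
  have h2 : Measurable fun x : ℝ => |x| := by fun_prop
  have h3 := AEMeasurable.map_map_of_aemeasurable (h2.aemeasurable (μ := P.map Vd))
    h.nakagami.aemeasurable
  rw [h1, show (fun s => |Vd s|) = (fun x : ℝ => |x|) ∘ Vd from rfl, ← h3, h.nakagami.map_eq]
  refine (Measure.map_congr ?_).trans Measure.map_id
  have h4 : nakagamiMeasure m w (Set.Iio 0) = 0 := by
    rw [nakagamiMeasure, withDensity_apply _ measurableSet_Iio]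
    refine (setLIntegral_congr_fun measurableSet_Iio fun x hx => ?_).trans lintegral_zero
    rw [nakagamiDensity, if_neg (not_lt.2 (le_of_lt hx)), ENNReal.ofReal_zero]
  have h5 : ∀ᵐ x ∂(nakagamiMeasure m w), 0 ≤ x := by
    rw [ae_iff]
    simp only [not_le]
    exact h4
  filter_upwards [h5] with x hx
  exact abs_of_nonneg hx

variable [IsProbabilityMeasure P]

/-- The envelope is nonnegative without atoms, so `P(R ≤ t) = P(|R| < t)` is given by the inversion
formula. -/
theorem IsMWGD.cdf_envelope (h : IsMWGD P N m w φ φd Vd) (hm : 0 < m) (hw : 0 < w)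
    (V : Fin N → ℝ) {t L : ℝ} (ht : 0 ≤ t)
    (hL : HasImproperIntegral (fun ν => mwgdPhi m w V ν * besselJ 1 (t * ν)) L) :
    cdf (P.map (envelope V φ φd Vd)) t = t * L := by
  have hprob := Measure.isProbabilityMeasure_map (h.aemeasurable_envelope V)
  have hsing := h.map_envelope_singleton hm hw V
  have hatom : P.map (envelope V φ φd Vd) {ρ | |ρ| = t} = 0 := by
    refine measure_mono_null (t := {t} ∪ {-t}) (fun ρ hρ => ?_)
      (measure_union_null (hsing t) (hsing (-t)))
    rcases eq_or_eq_neg_of_abs_eq hρ with e | e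
    · exact Or.inl e
    · exact Or.inr e
  rw [← measureReal_abs_lt_eq_of_hankel (h.integral_besselJ_envelope hm hw V)
    (continuous_mwgdPhi hm.le w V) ht hatom hL, cdf_eq_real]
  refine measureReal_congr ?_
  have h0 : ∀ᵐ ρ ∂(P.map (envelope V φ φd Vd)), 0 ≤ ρ := by
    rw [ae_iff]
    simp only [not_le]
    exact h.map_envelope_Iio_zero V
  have ht' : ∀ᵐ ρ ∂(P.map (envelope V φ φd Vd)), ρ ≠ t := by
    rw [ae_iff]
    simpa using hsing t
  filter_upwards [h0, ht'] with ρ hρ hρt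
  refine propext ?_
  change ρ ≤ t ↔ |ρ| < t
  rw [abs_of_nonneg hρ, lt_iff_le_and_ne]
  exact ⟨fun h => ⟨h, hρt⟩, fun h => h.1⟩

lemma IsMWGD.envelopeDensity_nonneg (h : IsMWGD P N m w φ φd Vd) (hm : 0 < m) (hw : 0 < w)
    (V : Fin N → ℝ) (r : ℝ) : 0 ≤ envelopeDensity m w V r := by
  have hprob := Measure.isProbabilityMeasure_map (h.aemeasurable_envelope V)
  rw [envelopeDensity]
  split_ifs with hr
  · exact mul_nonneg hr.1.le (nonneg_of_hankel (h.integral_besselJ_envelope hm hw V)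
      (continuous_mwgdPhi hm.le w V) hr.2.choose_spec)
  · exact le_rfl

/-- Outside `0` and the finitely many resonances, which carry no mass, the law is determined by the
increments of the distribution function. -/
theorem IsMWGD.map_envelope_eq_withDensity (h : IsMWGD P N m w φ φd Vd) (hm : 0 < m) (hw : 0 < w)
    (hV : ∀ i, 0 ≤ V i) (hA : 1 / 4 < m ∨ ∃ i, 0 < V i) :
    P.map (envelope V φ φd Vd) =
      volume.withDensity fun r => ENNReal.ofReal (envelopeDensity m w V r) := by
  have hprob := Measure.isProbabilityMeasure_map (h.aemeasurable_envelope V)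
  have hna : NullSingletonClass (P.map (envelope V φ φd Vd)) := ⟨h.map_envelope_singleton hm hw V⟩
  have hcompl : (Set.Ioi 0 \ resonantRadii V)ᶜ = Set.Iic 0 ∪ resonantRadii V := by
    rw [Set.sdiff_eq, Set.compl_inter, compl_compl, Set.compl_Ioi]
  refine eq_withDensity_of_Icc_subset (G := Set.Ioi 0 \ resonantRadii V)
    (isOpen_Ioi.sdiff (finite_resonantRadii V).isClosed) (h.envelopeDensity_nonneg hm hw V)
    ?_ ?_ fun a b hab hsub => ?_
  · rw [hcompl]
    refine measure_union_null ?_ ((finite_resonantRadii V).measure_zero _)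
    rw [← Set.Iio_union_right]
    exact measure_union_null (h.map_envelope_Iio_zero V) (measure_singleton 0)
  · rw [hcompl]
    refine measure_union_null ?_ (withDensity_absolutelyContinuous _ _
      ((finite_resonantRadii V).measure_zero _))
    rw [withDensity_apply _ measurableSet_Iic]
    refine (setLIntegral_congr_fun measurableSet_Iic fun r hr => ?_).trans lintegral_zero
    rw [envelopeDensity_of_nonpos hr, ENNReal.ofReal_zero]
  · have ha0 : 0 < a := (hsub (Set.left_mem_Icc.2 hab)).1
    have hb0 : 0 < b := ha0.trans_le hab
    obtain ⟨La, hLa⟩ := exists_hasImproperIntegral_cdf hm hw hV ha0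
    obtain ⟨Lb, hLb⟩ := exists_hasImproperIntegral_cdf hm hw hV hb0
    obtain ⟨h1, h2⟩ := integral_envelopeDensity hm hw hV hA hab hsub hLa hLb
    refine ⟨h1, ?_⟩
    rw [h2, ← h.cdf_envelope hm hw V ha0.le hLa, ← h.cdf_envelope hm hw V hb0.le hLb,
      cdf_eq_real, cdf_eq_real, ← Set.Iic_sdiff_Iic,
      measureReal_sdiff (Set.Iic_subset_Iic.2 hab) measurableSet_Iic]

end Law

/-! ### Integer shape parameter -/

section Integer

variable {N : ℕ}

lemma one_le_snoc_onesSeq {β : ℝ} (hβ : 1 ≤ β) (i : Fin (N + 1)) :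
    1 ≤ Fin.snoc (α := fun _ => ℝ) (onesSeq N) β i := by
  refine Fin.lastCases ?_ (fun j => ?_) i
  · rwa [Fin.snoc_last]
  · rw [Fin.snoc_castSucc, onesSeq]

lemma snoc_onesSeq_one : Fin.snoc (α := fun _ => ℝ) (onesSeq N) 1 = onesSeq (N + 1) := by
  funext i
  refine Fin.lastCases ?_ (fun j => ?_) i
  · rw [Fin.snoc_last, onesSeq]
  · rw [Fin.snoc_castSucc, onesSeq, onesSeq]

/-- For an integer shape parameter, the diffuse factor of `Φ` is a polynomial in `ν²` times a
Gaussian, and each monomial contributes a Gaussian moment of a product of Bessel functions. The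
last factor is `J₀(rν)` for `β = 1`, and `J₁(rν)` up to `rν / 2` for `β = 2`. -/
lemma integral_mwgdPhi_mul_hyp0F1 {n : ℕ} (hn : 0 < n) {w : ℝ} (hw : 0 < w) (V : Fin N → ℝ)
    {β : ℝ} (hβ : 1 ≤ β) (r : ℝ) :
    IntegrableOn (fun ν => mwgdPhi n w V ν * (ν * hyp0F1 β (-((r * ν) ^ 2 / 4)))) (Set.Ioi 0) ∧
      ∫ ν in Set.Ioi (0 : ℝ), mwgdPhi n w V ν * (ν * hyp0F1 β (-((r * ν) ^ 2 / 4))) =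
        2 * n / w * ∑ k ∈ Finset.range n, ((n - 1).choose k : ℝ) * (-1) ^ k *
          psi2 ((k : ℝ) + 1) (Fin.snoc (α := fun _ => ℝ) (onesSeq N) β) (mwgdAlpha n w V r) := by
  have hn' : (0 : ℝ) < n := Nat.cast_pos.2 hn
  set κ : ℝ := w / (4 * n)
  have hκ : 0 < κ := by positivity
  set b : Fin (N + 1) → ℝ := Fin.snoc (α := fun _ => ℝ) (onesSeq N) β
  set a : Fin (N + 1) → ℝ := Fin.snoc (α := fun _ => ℝ) V r
  have halpha : (fun i => -(a i ^ 2 / (4 * κ))) = mwgdAlpha n w V r := by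
    funext i
    refine Fin.lastCases ?_ (fun j => ?_) i
    · simp only [a, mwgdAlpha, Fin.snoc_last, κ]
      field_simp
    · simp only [a, mwgdAlpha, Fin.snoc_castSucc, κ]
      field_simp
  set M : ℕ → ℝ → ℝ := fun k x => 2 * x ^ (2 * ((k : ℝ) + 1) - 1) * Real.exp (-κ * x ^ 2) *
    ∏ i, hyp0F1 (b i) (-((a i * x) ^ 2 / 4))
  have hM : ∀ k : ℕ, IntegrableOn (M k) (Set.Ioi 0) ∧ ∫ x in Set.Ioi (0 : ℝ), M k x =
      κ ^ (-((k : ℝ) + 1)) * Real.Gamma ((k : ℝ) + 1) * psi2 ((k : ℝ) + 1) b (mwgdAlpha n w V r) :=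
    fun k => by
      have h := integral_prod_hyp0F1 (s := (k : ℝ) + 1) (by positivity) hκ
        (one_le_snoc_onesSeq hβ) a
      rwa [halpha] at h
  set c : ℕ → ℝ := fun k => ((n - 1).choose k : ℝ) * ((-κ) ^ k / (2 * k.factorial))
  have hexp : ∀ ν ∈ Set.Ioi (0 : ℝ), mwgdPhi n w V ν * (ν * hyp0F1 β (-((r * ν) ^ 2 / 4))) =
      ∑ k ∈ Finset.range n, c k * M k ν := by
    intro ν hν
    have hprod : ∏ i, hyp0F1 (b i) (-((a i * ν) ^ 2 / 4)) =
        (∏ i, besselJ 0 (V i * ν)) * hyp0F1 β (-((r * ν) ^ 2 / 4)) := by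
      rw [Fin.prod_univ_castSucc]
      simp only [a, b, Fin.snoc_last, Fin.snoc_castSucc, onesSeq, besselJ_zero_eq]
    rw [mwgdPhi, show w / (4 * (n : ℝ)) = κ from rfl, hyp1F1_natCast hn, Finset.mul_sum,
      Finset.sum_mul, Finset.sum_mul]
    refine Finset.sum_congr rfl fun k _ => ?_
    have hpow : ν ^ (2 * ((k : ℝ) + 1) - 1) = (ν ^ 2) ^ k * ν := by
      rw [← pow_mul, ← pow_succ, ← Real.rpow_natCast]
      congr 1
      push_cast
      ring
    have hf : (k.factorial : ℝ) ≠ 0 := by positivity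
    simp only [M, c]
    rw [hprod, hpow, neg_mul κ, show (-(κ * ν ^ 2)) ^ k = (-κ) ^ k * (ν ^ 2) ^ k by
      rw [← mul_pow, neg_mul]]
    field_simp
  have hint : IntegrableOn (fun ν => ∑ k ∈ Finset.range n, c k * M k ν) (Set.Ioi 0) :=
    integrable_finsetSum _ fun k _ => (hM k).1.const_mul (c k)
  refine ⟨hint.congr_fun (fun ν hν => (hexp ν hν).symm) measurableSet_Ioi, ?_⟩
  rw [setIntegral_congr_fun measurableSet_Ioi hexp,
    integral_finsetSum _ fun k _ => (hM k).1.const_mul (c k), Finset.mul_sum]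
  refine Finset.sum_congr rfl fun k _ => ?_
  have hf : (k.factorial : ℝ) ≠ 0 := by positivity
  rw [integral_const_mul, (hM k).2, Real.Gamma_nat_eq_factorial,
    show (k : ℝ) + 1 = ((k + 1 : ℕ) : ℝ) by push_cast; ring, Real.rpow_neg hκ.le,
    Real.rpow_natCast]
  simp only [c]
  rw [neg_pow κ, show 2 * (n : ℝ) / w = 1 / (2 * κ) by simp only [κ]; field_simp; norm_num]
  field_simp
  ring

lemma hasImproperIntegral_of_integrableOn_Ioi {g : ℝ → ℝ} (h : IntegrableOn g (Set.Ioi 0)) :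
    HasImproperIntegral g (∫ ν in Set.Ioi 0, g ν) :=
  ⟨fun _ hT => (intervalIntegrable_iff_integrableOn_Ioc_of_le hT).2
      (h.mono_set Set.Ioc_subset_Ioi_self),
    intervalIntegral_tendsto_integral_Ioi 0 h tendsto_id⟩

lemma hasImproperIntegral_density_natCast {n : ℕ} (hn : 0 < n) {w : ℝ} (hw : 0 < w)
    (V : Fin N → ℝ) (r : ℝ) :
    HasImproperIntegral (fun ν => mwgdPhi n w V ν * (ν * besselJ 0 (r * ν)))
      (2 * n / w * ∑ k ∈ Finset.range n, ((n - 1).choose k : ℝ) * (-1) ^ k *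
        psi2 ((k : ℝ) + 1) (onesSeq (N + 1)) (mwgdAlpha n w V r)) := by
  obtain ⟨h1, h2⟩ := integral_mwgdPhi_mul_hyp0F1 hn hw V le_rfl r
  rw [← snoc_onesSeq_one, ← h2]
  simpa only [besselJ_zero_eq] using hasImproperIntegral_of_integrableOn_Ioi h1

lemma hasImproperIntegral_cdf_natCast {n : ℕ} (hn : 0 < n) {w : ℝ} (hw : 0 < w)
    (V : Fin N → ℝ) (t : ℝ) :
    HasImproperIntegral (fun ν => mwgdPhi n w V ν * besselJ 1 (t * ν))
      (t / 2 * (2 * n / w * ∑ k ∈ Finset.range n, ((n - 1).choose k : ℝ) * (-1) ^ k *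
        psi2 ((k : ℝ) + 1) (onesTwoSeq N) (mwgdAlpha n w V t))) := by
  obtain ⟨h1, h2⟩ := integral_mwgdPhi_mul_hyp0F1 hn hw V one_le_two t
  rw [onesTwoSeq, ← h2, ← integral_const_mul]
  convert hasImproperIntegral_of_integrableOn_Ioi (h1.const_mul (t / 2)) using 2 with ν
  rw [besselJ_one_eq]
  ring

end Integer

theorem theorem1 {S : Type*} [MeasurableSpace S] (P : Measure S) [IsProbabilityMeasure P]
    (N : ℕ) (m w : ℝ) (hm : 0 < m) (hw : 0 < w)
    (V : Fin N → ℝ) (hV : ∀ i, 0 ≤ V i)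
    (φ : Fin N → S → ℝ) (φd Vd : S → ℝ) (hmodel : IsMWGD P N m w φ φd Vd) :
    -- the density of the envelope
    (∃ f : ℝ → ℝ,
      HasPDF (envelope V φ φd Vd) P volume ∧
      pdf (envelope V φ φd Vd) P volume =ᵐ[volume] (fun r => ENNReal.ofReal (f r)) ∧
      (∀ r, 0 ≤ f r) ∧
      (∀ r, r < 0 → f r = 0) ∧
      ((1 / 4 < m ∨ ∃ i, 0 < V i) →
        ∀ r, 0 < r →
          (r ∉ resonantRadii V ∨
            3 / 2 < 2 * m + (Nat.card {i : Fin N // 0 < V i} : ℝ) / 2) →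
          ∃ L : ℝ,
            HasImproperIntegral (fun ν => mwgdPhi m w V ν * (ν * besselJ 0 (r * ν))) L ∧
            f r = r * L) ∧
      (∀ n : ℕ, m = n → ∀ r, 0 ≤ r →
        (∃ L : ℝ,
          HasImproperIntegral (fun ν => mwgdPhi m w V ν * (ν * besselJ 0 (r * ν))) L ∧
          f r = r * L) ∧
        (∀ k ∈ Finset.range n,
          Summable (psi2Term ((k : ℝ) + 1) (onesSeq (N + 1)) (mwgdAlpha m w V r))) ∧
        f r = 2 * m / w * r * ∑ k ∈ Finset.range n, ((n - 1).choose k : ℝ) * (-1) ^ k *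
          psi2 ((k : ℝ) + 1) (onesSeq (N + 1)) (mwgdAlpha m w V r))) ∧
    -- the distribution function of the envelope
    (∀ t : ℝ, 0 ≤ t →
      (∃ L : ℝ,
        HasImproperIntegral (fun ν => mwgdPhi m w V ν * besselJ 1 (t * ν)) L ∧
        cdf (P.map (envelope V φ φd Vd)) t = t * L) ∧
      (∀ n : ℕ, m = n →
        (∀ k ∈ Finset.range n,
          Summable (psi2Term ((k : ℝ) + 1) (onesTwoSeq N) (mwgdAlpha m w V t))) ∧
        cdf (P.map (envelope V φ φd Vd)) t =
          m / w * t ^ 2 * ∑ k ∈ Finset.range n, ((n - 1).choose k : ℝ) * (-1) ^ k *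
            psi2 ((k : ℝ) + 1) (onesTwoSeq N) (mwgdAlpha m w V t))) := by
  have hae := hmodel.aemeasurable_envelope V
  refine ⟨?_, fun t ht => ⟨?_, ?_⟩⟩
  · by_cases hA : 1 / 4 < m ∨ ∃ i, 0 < V i
    · have hmap := hmodel.map_envelope_eq_withDensity hm hw hV hA
      have hfm := (aemeasurable_envelopeDensity hm hw hV hA).ennreal_ofReal
      have hpdf := hasPDF_of_map_eq_withDensity hae _ hfm hmap
      refine ⟨envelopeDensity m w V, hpdf, (pdf.eq_of_map_eq_withDensity' _ hfm).1 hmap,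
        hmodel.envelopeDensity_nonneg hm hw V, fun r hr => envelopeDensity_of_nonpos hr.le,
        fun _ r hr hres => ?_, ?_⟩
      · obtain ⟨L, hL⟩ := exists_hasImproperIntegral_density hm hw hV hA hr hres
        exact ⟨L, hL, envelopeDensity_eq hr.le hL⟩
      · rintro n rfl r hr
        have hL := hasImproperIntegral_density_natCast (Nat.cast_pos.1 hm) hw V r
        refine ⟨⟨_, hL, envelopeDensity_eq hr hL⟩, fun k _ => summable_psi2Term (by positivity)
          (fun i => le_rfl) _, ?_⟩
        rw [envelopeDensity_eq hr hL]
        ring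
    · -- slow decay without specular waves: the density is the Nakagami density
      have hA' := hA
      push Not at hA'
      have hmap := hmodel.map_envelope_of_eq_zero fun i => le_antisymm (hA'.2 i) (hV i)
      have hfm := (measurable_nakagamiDensity m w).ennreal_ofReal.aemeasurable (μ := volume)
      have hpdf := hasPDF_of_map_eq_withDensity hae _ hfm hmap
      refine ⟨nakagamiDensity m w, hpdf, (pdf.eq_of_map_eq_withDensity' _ hfm).1 hmap,
        nakagamiDensity_nonneg hm hw, fun r hr => if_neg hr.not_gt, fun h => absurd h hA, ?_⟩
      rintro n rfl
      have : (1 : ℝ) ≤ n := by exact_mod_cast Nat.cast_pos.1 hm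
      linarith [hA'.1]
  · rcases ht.eq_or_lt with rfl | ht'
    · -- here `J₁(0) = 0`, and the distribution function vanishes since there is no atom at `0`
      have h0 : HasImproperIntegral (fun ν => mwgdPhi m w V ν * besselJ 1 (0 * ν)) 0 := by
        simpa [besselJ_one_eq] using
          hasImproperIntegral_of_integrableOn_Ioi (g := fun _ => 0) (by simp)
      exact ⟨0, h0, hmodel.cdf_envelope hm hw V le_rfl h0⟩
    · obtain ⟨L, hL⟩ := exists_hasImproperIntegral_cdf hm hw hV ht'
      exact ⟨L, hL, hmodel.cdf_envelope hm hw V ht hL⟩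
  · rintro n rfl
    have hL := hasImproperIntegral_cdf_natCast (Nat.cast_pos.1 hm) hw V t
    refine ⟨fun k _ => summable_psi2Term (by positivity) (one_le_snoc_onesSeq one_le_two) _, ?_⟩
    rw [hmodel.cdf_envelope hm hw V ht hL]
    ring
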